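/- Let $(M,\omega)$ be a connected symplectic surface (possibly with boundary, not necessarily compact), and let $L\subset M$ be a smoothly embedded closed oriented curve lying in the interior of $M$ such that $M\setminus L$ is connected. Let $e\in H^1(L;\mathbb{Z})\cong\mathbb{Z}$ be the positive generator given by the orientation. Then for every $k\in\mathbb{Z}$ $$\mathrm{bp}_L(ke)=\mathrm{def}_L(ke)=+\infty .$$ Here the two invariants are defined as follows. (1) For $\alpha\in H^1(L;\mathbb{R})$, $\mathrm{def}_L(\alpha)$ is the supremum of all $T\ge 0$ for which there is a smooth isotopy $\psi=\{\psi_t:L\to M\}_{0\le t\le T}$ of Lagrangian embeddings such that $\psi_0$ is the inclusion and $\mathrm{Flux}(\psi)_t=-t\alpha$ for all $t\in[0,T]$. The class $\mathrm{Flux}(\psi)_t\in H^1(L;\mathbb{R})$ is the one whose value on a closed curve $C\subset L$ is the integral of $\omega$ over the trace of $C$ under $\{\psi_s\}_{0\le s\le t}$. (2) For $G\in C^\infty(M)$ let $\operatorname{sgrad}G$ be the vector field with $\omega(\operatorname{sgrad}G,\cdot)=-dG$, and let $\{F,G\}=\omega(\operatorname{sgrad}G,\operatorname{sgrad}F)$.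 For compact sets $X_0,X_1,Y_0,Y_1\subset M$ with $X_0\cap X_1=Y_0\cap Y_1=\emptyset$ put $$pb_4^+(X_0,X_1,Y_0,Y_1)=\inf_{(F,G)}\max_M\{F,G\},$$ where the infimum is over all compactly supported smooth functions $F,G$ on $M$ with $F|_{X_0}\le 0$, $F|_{X_1}\ge 1$, $G|_{Y_0}\le 0$, $G|_{Y_1}\ge 1$. Set $\mathrm{bp}_L(0)=+\infty$. For $k\ne 0$ let $f:L\to S^1$ be a smooth fibration such that $f^*d\theta$ represents $ke$ (where $d\theta$ has integral $1$ over $S^1$), divide $S^1$ into four consecutive closed arcs $\gamma_1,\gamma_2,\gamma_3,\gamma_4$ in the counterclockwise order, and set $$\mathrm{bp}_L(ke)=\frac{1}{pb_4^+\big(f^{-1}(\gamma_1),f^{-1}(\gamma_3),f^{-1}(\gamma_4),f^{-1}(\gamma_2)\big)},$$ read as $+\infty$ if the denominator is $\le 0$. The value does not depend on the choice of $f$ and of the arcs; to be definite, take the infimum of this expression over all choices. -/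

import Mathlib

open scoped Manifold ContDiff Bundle

namespace SymplecticSurface

noncomputable section

/-- A symplectic form on a smooth surface `M` (possibly with boundary): a smooth, alternating,
nondegenerate 2-form. It is automatically closed, since every 3-form on a surface vanishes. -/
structure SymplecticForm (M : Type*) [TopologicalSpace M]
    [ChartedSpace (EuclideanHalfSpace 2) M] [IsManifold (𝓡∂ 2) ∞ M] where
  /-- the bilinear form on each tangent plane -/
  form : ∀ x : M, TangentSpace (𝓡∂ 2) x →L[ℝ] TangentSpace (𝓡∂ 2) x →L[ℝ] ℝ
  alternating : ∀ (x : M) (v : TangentSpace (𝓡∂ 2) x), form x v v = 0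
  nondegenerate : ∀ (x : M) (v : TangentSpace (𝓡∂ 2) x), (∀ w, form x v w = 0) → v = 0
  smooth : ContMDiff (𝓡∂ 2) ((𝓡∂ 2).prod
      𝓘(ℝ, EuclideanSpace ℝ (Fin 2) →L[ℝ] EuclideanSpace ℝ (Fin 2) →L[ℝ] ℝ)) ∞
    (fun x : M => Bundle.TotalSpace.mk'
      (EuclideanSpace ℝ (Fin 2) →L[ℝ] EuclideanSpace ℝ (Fin 2) →L[ℝ] ℝ)
      (E := fun x : M => TangentSpace (𝓡∂ 2) x →L[ℝ] TangentSpace (𝓡∂ 2) x →L[ℝ] ℝ) x (form x))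

variable {M : Type*} [TopologicalSpace M] [ChartedSpace (EuclideanHalfSpace 2) M]
  [IsManifold (𝓡∂ 2) ∞ M]

/-- The differential of a real function at a point, as a covector. -/
def differential (G : M → ℝ) (x : M) : TangentSpace (𝓡∂ 2) x →L[ℝ] ℝ :=
  mfderiv (𝓡∂ 2) 𝓘(ℝ, ℝ) G x

theorem exists_dual_vector (Ω : SymplecticForm M) (x : M)
    (φ : TangentSpace (𝓡∂ 2) x →L[ℝ] ℝ) :
    ∃ X : TangentSpace (𝓡∂ 2) x, ∀ w, Ω.form x X w = φ w := by
  let B : EuclideanSpace ℝ (Fin 2) →ₗ[ℝ] Module.Dual ℝ (EuclideanSpace ℝ (Fin 2)) :=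
    { toFun := fun v => (Ω.form x v : EuclideanSpace ℝ (Fin 2) →L[ℝ] ℝ).toLinearMap
      map_add' := fun u v => by
        ext w
        exact DFunLike.congr_fun ((Ω.form x).map_add u v) w
      map_smul' := fun c v => by
        ext w
        exact DFunLike.congr_fun ((Ω.form x).map_smul c v) w }
  have hinj : Function.Injective B := by
    rw [← LinearMap.ker_eq_bot, LinearMap.ker_eq_bot']
    intro v hv
    exact Ω.nondegenerate x v (fun w => DFunLike.congr_fun hv w)
  have hsurj : Function.Surjective B :=
    (LinearMap.injective_iff_surjective_of_finrank_eq_finrank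
      (Subspace.dual_finrank_eq).symm).1 hinj
  obtain ⟨X, hX⟩ := hsurj (φ : EuclideanSpace ℝ (Fin 2) →L[ℝ] ℝ).toLinearMap
  exact ⟨X, fun w => DFunLike.congr_fun hX w⟩

/-- The skew gradient (Hamiltonian vector field) of `G`: the unique vector field with
`Ω (sgrad G, ·) = - dG`. -/
def sgrad (Ω : SymplecticForm M) (G : M → ℝ) (x : M) : TangentSpace (𝓡∂ 2) x :=
  Classical.choose (exists_dual_vector Ω x (-differential G x))

theorem sgrad_spec (Ω : SymplecticForm M) (G : M → ℝ) (x : M) (w : TangentSpace (𝓡∂ 2) x) :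
    Ω.form x (sgrad Ω G x) w = -differential G x w :=
  Classical.choose_spec (exists_dual_vector Ω x (-differential G x)) w

/-- The Poisson bracket `{F, G} = Ω (sgrad G, sgrad F) = dF (sgrad G)`. -/
def poissonBracket (Ω : SymplecticForm M) (F G : M → ℝ) (x : M) : ℝ :=
  Ω.form x (sgrad Ω G x) (sgrad Ω F x)

/-- The set of pairs of compactly supported smooth functions `(F, G)` with
`F ≤ 0` on `X₀`, `F ≥ 1` on `X₁`, `G ≤ 0` on `Y₀` and `G ≥ 1` on `Y₁`.
The supports may meet the boundary of `M`. -/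
def admissiblePairs (X₀ X₁ Y₀ Y₁ : Set M) : Set ((M → ℝ) × (M → ℝ)) :=
  {p | ContMDiff (𝓡∂ 2) 𝓘(ℝ, ℝ) ∞ p.1 ∧ HasCompactSupport p.1 ∧
    ContMDiff (𝓡∂ 2) 𝓘(ℝ, ℝ) ∞ p.2 ∧ HasCompactSupport p.2 ∧
    (∀ x ∈ X₀, p.1 x ≤ 0) ∧ (∀ x ∈ X₁, 1 ≤ p.1 x) ∧
    (∀ x ∈ Y₀, p.2 x ≤ 0) ∧ (∀ x ∈ Y₁, 1 ≤ p.2 x)}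

/-- The Poisson bracket invariant `pb₄⁺ = inf_{(F, G)} max_M {F, G}`. -/
def pb4Plus (Ω : SymplecticForm M) (X₀ X₁ Y₀ Y₁ : Set M) : EReal :=
  ⨅ p ∈ admissiblePairs X₀ X₁ Y₀ Y₁, ⨆ x : M, ((poissonBracket Ω p.1 p.2 x : ℝ) : EReal)

open scoped Classical in
/-- `1 / pb₄⁺`, read as `+∞` when `pb₄⁺` vanishes (or is negative, which can happen only if `M` is
compact with nonempty boundary). -/
def invPb4Plus (Ω : SymplecticForm M) (X₀ X₁ Y₀ Y₁ : Set M) : EReal :=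
  if pb4Plus Ω X₀ X₁ Y₀ Y₁ ≤ 0 then ⊤ else (pb4Plus Ω X₀ X₁ Y₀ Y₁)⁻¹

/-- The standard covering `ℝ → ℝ / ℤ = S¹`, `θ ↦ exp (2 π i θ)`. -/
def unitAngle (θ : ℝ) : Circle := Circle.exp (2 * Real.pi * θ)

/-- A smooth embedding of the circle: a smooth injective immersion (the circle is compact). Its
image is a simple closed curve, oriented by the counterclockwise orientation of the circle. -/
structure IsEmbeddedCircle (c : Circle → M) : Prop where
  smooth : ContMDiff (𝓡 1) (𝓡∂ 2) ∞ c
  injective : Function.Injective c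
  immersion : ∀ z : Circle, Function.Injective (mfderiv (𝓡 1) (𝓡∂ 2) c z)

/-- A Lagrangian embedding of the circle: an embedding which pulls `Ω` back to zero. -/
structure IsLagrangianEmbedding (Ω : SymplecticForm M) (c : Circle → M) : Prop
    extends IsEmbeddedCircle c where
  isotropic : ∀ (z : Circle) (u v : TangentSpace (𝓡 1) z),
    Ω.form (c z) (mfderiv (𝓡 1) (𝓡∂ 2) c z u) (mfderiv (𝓡 1) (𝓡∂ 2) c z v) = 0

/-- A smooth fibration of the circle over `S¹`; by compactness this is the same as a smooth
submersion. -/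
structure IsCircleFibration (f : Circle → Circle) : Prop where
  smooth : ContMDiff (𝓡 1) (𝓡 1) ∞ f
  submersion : ∀ z : Circle, Function.Surjective (mfderiv (𝓡 1) (𝓡 1) f z)

/-- The class `f^* [dθ]` in `H¹(S¹; ℤ) ≅ ℤ` equals `k` times the positive generator `e`: in the
angle coordinates of `ℝ / ℤ`, a continuous lift of `f` increases by `k` along one full positive
turn. -/
def HasClass (f : Circle → Circle) (k : ℤ) : Prop :=
  ∃ g : ℝ → ℝ, Continuous g ∧ (∀ θ, f (unitAngle θ) = unitAngle (g θ)) ∧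
    ∀ θ, g (θ + 1) = g θ + k

/-- A division of `S¹` into four consecutive closed arcs in the counterclockwise order, given by
their endpoints in angle coordinates: `[t₀, t₁]`, `[t₁, t₂]`, `[t₂, t₃]`, `[t₃, t₀ + 1]`. -/
structure ArcDivision where
  t₀ : ℝ
  t₁ : ℝ
  t₂ : ℝ
  t₃ : ℝ
  h₀₁ : t₀ < t₁
  h₁₂ : t₁ < t₂
  h₂₃ : t₂ < t₃
  h₃₀ : t₃ < t₀ + 1

/-- The first arc `γ₁`. -/
def ArcDivision.arc₁ (d : ArcDivision) : Set Circle := unitAngle '' Set.Icc d.t₀ d.t₁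

/-- The second arc `γ₂`. -/
def ArcDivision.arc₂ (d : ArcDivision) : Set Circle := unitAngle '' Set.Icc d.t₁ d.t₂

/-- The third arc `γ₃`. -/
def ArcDivision.arc₃ (d : ArcDivision) : Set Circle := unitAngle '' Set.Icc d.t₂ d.t₃

/-- The fourth arc `γ₄`. -/
def ArcDivision.arc₄ (d : ArcDivision) : Set Circle := unitAngle '' Set.Icc d.t₃ (d.t₀ + 1)

/-- `1 / pb₄⁺ (X₀, X₁, Y₀, Y₁)` for the quadruple associated to a fibration `f` of the curve
`c` and a division of `S¹` into arcs: `X₀`, `X₁`, `Y₀`, `Y₁` are the subsets of the curve that lie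
over `γ₁`, `γ₃`, `γ₄`, `γ₂` respectively. -/
def bpOfFibration (Ω : SymplecticForm M) (c : Circle → M) (f : Circle → Circle)
    (d : ArcDivision) : EReal :=
  invPb4Plus Ω (c '' (f ⁻¹' d.arc₁)) (c '' (f ⁻¹' d.arc₃))
    (c '' (f ⁻¹' d.arc₄)) (c '' (f ⁻¹' d.arc₂))

open scoped Classical in
/-- The Poisson bracket invariant `bp_L (k e)` of the oriented curve `L = c (S¹)`: it is `+∞` for
`k = 0`, and for `k ≠ 0` it is the value of `1 / pb₄⁺ (X₀, X₁, Y₀, Y₁)` for the fibrations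
`f` in the class `k e`. That value does not depend on `f` or on the division into arcs; the
definition takes the infimum over all of them instead of choosing one. -/
def bp (Ω : SymplecticForm M) (c : Circle → M) (k : ℤ) : EReal :=
  if k = 0 then ⊤
  else ⨅ (f : Circle → Circle) (_ : IsCircleFibration f) (_ : HasClass f k) (d : ArcDivision),
    bpOfFibration Ω c f d

/-- `ψ` is a Lagrangian isotopy `{ψ_t}`, `0 ≤ t ≤ T`, of the curve `c`: a smooth family of
Lagrangian embeddings starting at `c`. -/
structure IsLagrangianIsotopy (Ω : SymplecticForm M) (c : Circle → M) (T : ℝ)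
    (ψ : ℝ → Circle → M) : Prop where
  smooth : ContMDiffOn (𝓘(ℝ, ℝ).prod (𝓡 1)) (𝓡∂ 2) ∞ (fun p : ℝ × Circle => ψ p.1 p.2)
    (Set.Icc 0 T ×ˢ Set.univ)
  initial : ψ 0 = c
  lagrangian : ∀ t ∈ Set.Icc 0 T, IsLagrangianEmbedding Ω (ψ t)

/-- The velocity `∂ψ/∂t` of the isotopy at time `t` and the point with angle coordinate `θ`. -/
def isotopyVelocity (T : ℝ) (ψ : ℝ → Circle → M) (t θ : ℝ) :
    TangentSpace (𝓡∂ 2) (ψ t (unitAngle θ)) :=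
  mfderivWithin 𝓘(ℝ, ℝ) (𝓡∂ 2) (fun s : ℝ => ψ s (unitAngle θ)) (Set.Icc 0 T) t (1 : ℝ)

/-- The tangent vector `∂ψ/∂θ` of the curve `ψ_t` at the point with angle coordinate `θ`. -/
def curveVelocity (ψ : ℝ → Circle → M) (t θ : ℝ) :
    TangentSpace (𝓡∂ 2) (ψ t (unitAngle θ)) :=
  mfderiv 𝓘(ℝ, ℝ) (𝓡∂ 2) (fun η : ℝ => ψ t (unitAngle η)) θ (1 : ℝ)

/-- The Lagrangian flux `Flux(ψ)_t` in `H¹(L; ℝ) ≅ ℝ`, given by its period over the oriented curve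
`L`: the integral of `Ω` over the trace of `L` under `{ψ_s}`, `0 ≤ s ≤ t`. -/
def flux (Ω : SymplecticForm M) (T : ℝ) (ψ : ℝ → Circle → M) (t : ℝ) : ℝ :=
  ∫ s in (0 : ℝ)..t, ∫ θ in (0 : ℝ)..1,
    Ω.form (ψ s (unitAngle θ)) (isotopyVelocity T ψ s θ) (curveVelocity ψ s θ)

/-- The deformation invariant `def_L (α)` of the oriented curve `L = c (S¹)`, for the class
`α = a e` in `H¹(L; ℝ) = ℝ e`: the supremum of all `T ≥ 0` for which there is a Lagrangian isotopy
of `L` on `[0, T]` whose flux at each time `t` is `- t α`. -/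
def deformationInvariant (Ω : SymplecticForm M) (c : Circle → M) (a : ℝ) : EReal :=
  sSup {E : EReal | ∃ T : ℝ, 0 ≤ T ∧ E = (T : EReal) ∧
    ∃ ψ : ℝ → Circle → M, IsLagrangianIsotopy Ω c T ψ ∧
      ∀ t ∈ Set.Icc 0 T, flux Ω T ψ t = -(t * a)}

end

end SymplecticSurface

set_option linter.unusedSectionVars false

/-! Because the complement of the curve is connected, some loop crosses the curve exactly once. The
proof uses the dual object: a smooth map `u` from the surface to the unit circle, equal to `1` off a
compact subset of the interior, with degree one along the curve (`exists_isDegreeOneMap`). Both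
invariants are infinite because `u` exists.

Deformations (`deformationInvariant_eq_top`): for real `a`, let `X` be the field dual under `Ω` to
`-a` times the angular form of `u`. It vanishes off a compact subset of the interior, so its flow
runs for arbitrarily long times. In dimension two every embedded curve is Lagrangian, and the flux
of the moving curve grows at the rate `-a` times the degree of `u` along it. That degree is an
integer depending continuously on time, so it stays equal to `1`.

Poisson brackets (`bp_eq_top`): the `k`-th power of `u`, corrected by a real phase, is a
circle-valued map `U` that is constant off a compact set and close to `f` along the curve. If `F`
and `G` are functions in the plane that separate opposite arcs, the pair `F ∘ U`, `1 - G ∘ U` is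
admissible. Both differentials are multiples of the angular form of `U`, so the bracket vanishes
identically and `pb4Plus` is at most `0`.

Construction of `u`: a dipole is a unimodular function with winding numbers `1` and `-1` around two
points and equal to `1` far away. In a chart it is the normalized `(z - p) / (z - q)` with its
argument cut off away from the segment from `p` to `q`. Dipoles can be concatenated, so any two
distinct interior points of a connected open set bound one supported there. Let `p` and `q` be the
ends of a short segment crossing the curve once. The chart dipole of this segment, multiplied by a
dipole from `q` to `p` supported off the curve, has removable singularities. Along the curve it is
the chart dipole, whose angle jumps by one full turn at the crossing, so its degree is one. -/

namespace SymplecticSurface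

open Set Filter Topology MeasureTheory

/-! ### Smoothness of composition operators on spaces of continuous maps -/

section SuperpositionOperator

variable {K E F : Type} [TopologicalSpace K] [CompactSpace K]
  [NormedAddCommGroup E] [NormedSpace ℝ E] [NormedAddCommGroup F] [NormedSpace ℝ F]

set_option synthInstance.maxHeartbeats 400000 in
/-- Pointwise application of a continuous family of operators to a continuous family of vectors. -/
noncomputable def pointwiseApply :
    C(K, E →L[ℝ] F) →L[ℝ] C(K, E) →L[ℝ] C(K, F) :=
  LinearMap.mkContinuous₂
    (LinearMap.mk₂ ℝ (fun (A : C(K, E →L[ℝ] F)) (h : C(K, E)) =>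
        (⟨fun t => A t (h t), by fun_prop⟩ : C(K, F)))
      (fun _ _ _ => by ext; simp) (fun _ _ _ => by ext; simp)
      (fun _ _ _ => by ext; simp) (fun _ _ _ => by ext; simp)) 1
    (fun A h => by
      rw [one_mul, ContinuousMap.norm_le _ (by positivity)]
      intro t
      exact (A t).le_of_opNorm_le_of_le (A.norm_coe_le_norm t) (h.norm_coe_le_norm t))

set_option synthInstance.maxHeartbeats 400000 in
@[simp] theorem pointwiseApply_apply (A : C(K, E →L[ℝ] F)) (h : C(K, E)) (t : K) :
    pointwiseApply A h t = A t (h t) := rfl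

-- The range of `γ` is compact, so `fderiv ℝ f` varies by at most `ε` on balls of one radius `δ`
-- around all its points. The mean value inequality then bounds the first-order remainder uniformly
-- in `t`.
set_option synthInstance.maxHeartbeats 400000 in
theorem hasFDerivAt_comp_continuousMap {f : E → F} (hf : ContDiff ℝ 1 f) (γ : C(K, E)) :
    HasFDerivAt (fun γ : C(K, E) => (⟨f, hf.continuous⟩ : C(E, F)).comp γ)
      (pointwiseApply ((⟨fderiv ℝ f, hf.continuous_fderiv one_ne_zero⟩ :
        C(E, E →L[ℝ] F)).comp γ)) γ := by
  rw [hasFDerivAt_iff_isLittleO_nhds_zero, Asymptotics.isLittleO_iff]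
  intro ε hε
  have hc : IsCompact (range γ) := isCompact_range γ.continuous
  have hu := hc.uniformContinuousAt_of_continuousAt (fderiv ℝ f)
    (fun x _ => (hf.continuous_fderiv one_ne_zero).continuousAt) (Metric.dist_mem_uniformity hε)
  obtain ⟨δ, hδ, hδ'⟩ := Metric.mem_uniformity_dist.1 hu
  filter_upwards [Metric.ball_mem_nhds (0 : C(K, E)) hδ] with h hh
  rw [ContinuousMap.norm_le _ (by positivity)]
  intro t
  have hht : ‖h t‖ < δ := (h.norm_coe_le_norm t).trans_lt (by simpa using hh)
  have hb : ∀ x ∈ Metric.ball (γ t) δ, ‖fderiv ℝ f x - fderiv ℝ f (γ t)‖ ≤ ε := by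
    intro x hx
    have := @hδ' (γ t) x (by rw [dist_comm]; exact hx) (mem_range_self t)
    rw [← dist_eq_norm, dist_comm]
    exact le_of_lt this
  have := (convex_ball (γ t) δ).norm_image_sub_le_of_norm_fderiv_le'
    (f := f) (φ := fderiv ℝ f (γ t)) (C := ε) (𝕜 := ℝ)
    (fun x _ => (hf.differentiable one_ne_zero) x) hb
    (Metric.mem_ball_self hδ) (y := γ t + h t) (by simpa using hht)
  calc _ = ‖f (γ t + h t) - f (γ t) - fderiv ℝ f (γ t) (γ t + h t - γ t)‖ := by simp
    _ ≤ ε * ‖γ t + h t - γ t‖ := this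
    _ ≤ ε * ‖h‖ := by
      rw [add_sub_cancel_left]
      gcongr
      exact h.norm_coe_le_norm t

set_option synthInstance.maxHeartbeats 400000 in
/-- Composition with a smooth map is a smooth operation on continuous maps from a compact space. -/
theorem contDiff_comp_continuousMap (n : ℕ) : ∀ {F : Type} [NormedAddCommGroup F] [NormedSpace ℝ F]
    {f : E → F} (hf : ContDiff ℝ ∞ f),
    ContDiff ℝ n (fun γ : C(K, E) => (⟨f, hf.continuous⟩ : C(E, F)).comp γ) := by
  induction n with
  | zero =>
    intro F _ _ f hf
    rw [Nat.cast_zero, contDiff_zero]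
    exact ContinuousMap.continuous_postcomp _
  | succ n ih =>
    intro F _ _ f hf
    have h1 : ContDiff ℝ 1 f := hf.of_le (by norm_cast)
    have hd : ContDiff ℝ ∞ (fderiv ℝ f) := hf.fderiv_right le_rfl
    rw [Nat.cast_succ, contDiff_succ_iff_fderiv]
    refine ⟨fun γ => (hasFDerivAt_comp_continuousMap h1 γ).differentiableAt, by simp, ?_⟩
    -- The derivative is a bounded linear map applied to the composition operator of `fderiv ℝ f`.
    -- That operator has another target space, which is why the induction is over all `F`.
    have : fderiv ℝ (fun γ : C(K, E) => (⟨f, hf.continuous⟩ : C(E, F)).comp γ) =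
        fun γ => pointwiseApply ((⟨fderiv ℝ f, hd.continuous⟩ : C(E, E →L[ℝ] F)).comp γ) := by
      funext γ
      exact (hasFDerivAt_comp_continuousMap h1 γ).fderiv
    rw [this]
    exact (pointwiseApply (K := K) (E := E) (F := F)).contDiff.comp (ih hd)

theorem contDiff_infty_comp_continuousMap {f : E → F} (hf : ContDiff ℝ ∞ f) :
    ContDiff ℝ ∞ (fun γ : C(K, E) => (⟨f, hf.continuous⟩ : C(E, F)).comp γ) :=
  contDiff_infty.2 fun n => contDiff_comp_continuousMap n hf

end SuperpositionOperator

/-! ### Smooth local flows in Banach spaces, by the implicit function theorem for the Picard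
equation -/

section LocalFlow

variable {E : Type} [NormedAddCommGroup E] [NormedSpace ℝ E] [CompleteSpace E]

/-- Extension of a continuous path on the unit interval to the line by constants. -/
noncomputable def extendPath (γ : C(Icc (0 : ℝ) 1, E)) (t : ℝ) : E := γ (projIcc 0 1 zero_le_one t)

theorem continuous_extendPath (γ : C(Icc (0 : ℝ) 1, E)) : Continuous (extendPath γ) :=
  γ.continuous.comp continuous_projIcc

/-- The primitive of a path on the unit interval. -/
noncomputable def pathPrimitive : C(Icc (0 : ℝ) 1, E) →L[ℝ] C(Icc (0 : ℝ) 1, E) :=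
  LinearMap.mkContinuous
    { toFun := fun γ => ⟨fun t => ∫ τ in (0 : ℝ)..t, extendPath γ τ, by
        have := intervalIntegral.continuous_primitive (μ := volume)
          (fun a b => (continuous_extendPath γ).intervalIntegrable a b) 0
        exact this.comp continuous_subtype_val⟩
      map_add' := fun γ γ' => by
        ext t
        exact intervalIntegral.integral_add ((continuous_extendPath γ).intervalIntegrable _ _)
          ((continuous_extendPath γ').intervalIntegrable _ _)
      map_smul' := fun a γ => by
        ext t
        exact intervalIntegral.integral_smul a _ } 1
    (fun γ => by
      rw [one_mul, ContinuousMap.norm_le _ (norm_nonneg _)]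
      intro t
      refine (intervalIntegral.norm_integral_le_of_norm_le_const (C := ‖γ‖)
        fun τ _ => γ.norm_coe_le_norm _).trans ?_
      have h0 := t.2.1
      have h1 := t.2.2
      rw [sub_zero, abs_of_nonneg h0]
      nlinarith [norm_nonneg γ])

/-- Constant paths. -/
noncomputable def constPath : E →L[ℝ] C(Icc (0 : ℝ) 1, E) :=
  LinearMap.mkContinuous
    { toFun := fun x => ContinuousMap.const _ x
      map_add' := fun _ _ => rfl
      map_smul' := fun _ _ => rfl } 1
    (fun x => by
      rw [one_mul, ContinuousMap.norm_le _ (norm_nonneg _)]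
      intro t
      rfl)

/-- The Picard equation of a vector field `X`, with the time as a parameter. -/
noncomputable def picardDefect {X : E → E} (hX : Continuous X)
    (p : (ℝ × E) × C(Icc (0 : ℝ) 1, E)) : C(Icc (0 : ℝ) 1, E) :=
  p.2 - constPath p.1.2 - p.1.1 • pathPrimitive ((⟨X, hX⟩ : C(E, E)).comp p.2)

theorem contDiff_picardDefect {X : E → E} (hX : ContDiff ℝ ∞ X) :
    ContDiff ℝ ∞ (picardDefect hX.continuous) := by
  unfold picardDefect
  refine (contDiff_snd.sub ((constPath (E := E)).contDiff.comp (contDiff_snd.comp contDiff_fst))).sub ?_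
  exact (contDiff_fst.comp contDiff_fst).smul ((pathPrimitive (E := E)).contDiff.comp
    ((contDiff_infty_comp_continuousMap hX).comp contDiff_snd))

/-- The integral term carries the time as a factor. At time `0` it disappears and the defect is
affine in the path; this invertibility is what the implicit function theorem needs. -/
theorem fderiv_picardDefect_constPath {X : E → E} (hX : ContDiff ℝ ∞ X) (x₀ : E) :
    fderiv ℝ (picardDefect hX.continuous) ((0, x₀), constPath x₀) ∘L
      .inr ℝ (ℝ × E) C(Icc (0 : ℝ) 1, E) = ContinuousLinearMap.id ℝ _ := by
  have h1 : HasFDerivAt (fun γ => picardDefect hX.continuous ((0, x₀), γ))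
      (fderiv ℝ (picardDefect hX.continuous) ((0, x₀), constPath x₀) ∘L
        .inr ℝ (ℝ × E) C(Icc (0 : ℝ) 1, E)) (constPath x₀) :=
    (((contDiff_picardDefect hX).differentiable (by simp)) _).hasFDerivAt.comp (constPath x₀)
      (hasFDerivAt_prodMk_right (𝕜 := ℝ) ((0 : ℝ), x₀) (constPath x₀))
  have h2 : HasFDerivAt (fun γ => picardDefect hX.continuous ((0, x₀), γ))
      (ContinuousLinearMap.id ℝ C(Icc (0 : ℝ) 1, E)) (constPath x₀) := by
    have : (fun γ => picardDefect hX.continuous ((0, x₀), γ)) = fun γ => γ - constPath x₀ := by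
      funext γ
      simp [picardDefect]
    rw [this]
    exact (hasFDerivAt_id _).sub_const _
  exact h1.unique h2

/-- The implicit function theorem gives `C^∞` regularity only at the base point: each finite order
has its own neighbourhood. So it is applied again at every nearby `p`, where the partial derivative
is still invertible, and local uniqueness identifies the new implicit function with `σ` near `p`. -/
theorem exists_contDiffAt_picard_solution {X : E → E} (hX : ContDiff ℝ ∞ X) (x₀ : E) :
    ∃ σ : ℝ × E → C(Icc (0 : ℝ) 1, E), ∀ᶠ p in 𝓝 ((0 : ℝ), x₀), ContDiffAt ℝ ∞ σ p ∧
      picardDefect hX.continuous (p, σ p) = 0 := by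
  set a : (ℝ × E) × C(Icc (0 : ℝ) 1, E) := ((0, x₀), constPath x₀) with ha
  have hG := contDiff_picardDefect hX
  have h0 : picardDefect hX.continuous a = 0 := by simp [picardDefect, ha]
  have hcd : ContDiffAt ℝ ∞ (picardDefect hX.continuous) a := hG.contDiffAt
  have hinv : (fderiv ℝ (picardDefect hX.continuous) a ∘L
      .inr ℝ (ℝ × E) C(Icc (0 : ℝ) 1, E)).IsInvertible := by
    rw [fderiv_picardDefect_constPath hX x₀]
    exact ContinuousLinearMap.isInvertible_equiv (f := ContinuousLinearEquiv.refl ℝ _)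
  set σ := hcd.implicitFunction (by simp) hinv with hσdef
  have hσ : ContDiffAt ℝ ∞ σ (0, x₀) := hcd.contDiffAt_implicitFunction (by simp) hinv
  have hσa : σ (0, x₀) = constPath x₀ := hcd.implicitFunction_apply_self (by simp) hinv
  have hσ0 : ∀ᶠ p in 𝓝 ((0 : ℝ), x₀), picardDefect hX.continuous (p, σ p) = 0 := by
    have := hcd.eventually_apply_implicitFunction (by simp) hinv
    rwa [h0] at this
  have hσ1 : ∀ᶠ p in 𝓝 ((0 : ℝ), x₀), ContDiffAt ℝ 1 σ p :=
    (hσ.of_le (by norm_cast)).eventually (by simp)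
  have hinv' : ∀ᶠ p in 𝓝 ((0 : ℝ), x₀), (fderiv ℝ (picardDefect hX.continuous) (p, σ p) ∘L
      .inr ℝ (ℝ × E) C(Icc (0 : ℝ) 1, E)).IsInvertible := by
    have hc : ContinuousAt (fun p => fderiv ℝ (picardDefect hX.continuous) (p, σ p) ∘L
        .inr ℝ (ℝ × E) C(Icc (0 : ℝ) 1, E)) (0, x₀) := by
      refine ContinuousAt.clm_comp ?_ continuousAt_const
      exact (hG.continuous_fderiv (by simp)).continuousAt.comp
        (continuousAt_id.prodMk hσ.continuousAt)
    refine hc.eventually ?_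
    have hid : fderiv ℝ (picardDefect hX.continuous) ((0, x₀), σ (0, x₀)) ∘L
        .inr ℝ (ℝ × E) C(Icc (0 : ℝ) 1, E) = ContinuousLinearMap.id ℝ _ := by
      rw [hσa, fderiv_picardDefect_constPath hX x₀]
    beta_reduce
    rw [hid]
    filter_upwards [ContinuousLinearEquiv.nhds
      (ContinuousLinearEquiv.refl ℝ C(Icc (0 : ℝ) 1, E))] with f hf
    obtain ⟨e, rfl⟩ := hf
    exact ContinuousLinearMap.isInvertible_equiv
  refine ⟨σ, ?_⟩
  filter_upwards [hσ0.eventually_nhds, hσ1, hinv'] with p hp hp1 hpinv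
  refine ⟨?_, hp.self_of_nhds⟩
  have hcp : ContDiffAt ℝ ∞ (picardDefect hX.continuous) (p, σ p) := hG.contDiffAt
  refine (hcp.contDiffAt_implicitFunction (by simp) hpinv).congr_of_eventuallyEq ?_
  have h2 := (continuousAt_id.prodMk hp1.continuousAt).eventually
    (hcp.eventually_apply_eq_iff_implicitFunction (by simp) hpinv)
  filter_upwards [h2, hp] with q hq hq0
  exact (hq.1 (hq0.trans hp.self_of_nhds.symm)).symm

theorem extendPath_eq_of_picardDefect_eq_zero {X : E → E} (hX : Continuous X) {s : ℝ} {x : E}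
    {γ : C(Icc (0 : ℝ) 1, E)} (h : picardDefect hX ((s, x), γ) = 0) {t : ℝ}
    (ht : t ∈ Icc (0 : ℝ) 1) :
    extendPath γ t = x + s • ∫ τ in (0 : ℝ)..t, X (extendPath γ τ) := by
  have h1 := DFunLike.congr_fun h ⟨t, ht⟩
  have h2 : extendPath γ t = γ ⟨t, ht⟩ := by simp [extendPath, projIcc_of_mem zero_le_one ht]
  have h3 : γ ⟨t, ht⟩ - x - s • ∫ τ in (0 : ℝ)..t, X (extendPath γ τ) = 0 := h1
  rw [h2, ← sub_eq_zero, ← sub_sub, h3]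

/-- A globally defined curve solving the equation `y' = s X y` on `[0, 1)`. -/
theorem hasDerivWithinAt_extendPath {X : E → E} (hX : Continuous X) {s : ℝ} {x : E}
    {γ : C(Icc (0 : ℝ) 1, E)} (h : picardDefect hX ((s, x), γ) = 0) {t : ℝ}
    (ht : t ∈ Icc (0 : ℝ) 1) :
    HasDerivWithinAt (extendPath γ) (s • X (extendPath γ t)) (Icc 0 1) t := by
  have hc : Continuous fun τ => X (extendPath γ τ) := hX.comp (continuous_extendPath γ)
  have h1 : HasDerivAt (fun t => x + s • ∫ τ in (0 : ℝ)..t, X (extendPath γ τ))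
      (s • X (extendPath γ t)) t :=
    ((intervalIntegral.integral_hasDerivAt_right (hc.intervalIntegrable _ _)
      (hc.stronglyMeasurableAtFilter _ _) hc.continuousAt).const_smul s).const_add x
  exact h1.hasDerivWithinAt.congr
    (fun y hy => extendPath_eq_of_picardDefect_eq_zero hX h hy)
    (extendPath_eq_of_picardDefect_eq_zero hX h ht)

/-- After rescaling the time by `a`, both paths solve `y' = s' X y` with the same initial value.
Hence interior values of one Picard solution are endpoints of others, which allows differentiation
of the endpoint in the time parameter. -/
theorem extendPath_mul_eq {X : E → E} (hX : Continuous X) {C : NNReal} (hL : LipschitzWith C X)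
    {s s' a : ℝ} (ha : a ∈ Icc (0 : ℝ) 1) (hs : s' = a * s) {x : E}
    {γ γ' : C(Icc (0 : ℝ) 1, E)} (h : picardDefect hX ((s, x), γ) = 0)
    (h' : picardDefect hX ((s', x), γ') = 0) :
    extendPath γ a = extendPath γ' 1 := by
  have hm : ∀ t ∈ Icc (0 : ℝ) 1, a * t ∈ Icc (0 : ℝ) 1 := fun t ht =>
    ⟨mul_nonneg ha.1 ht.1, by nlinarith [ha.1, ha.2, ht.1, ht.2]⟩
  have key : EqOn (fun t => extendPath γ (a * t)) (extendPath γ') (Icc 0 1) := by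
    refine ODE_solution_unique (v := fun _ y => s' • X y) (K := ‖s'‖₊ * C) (fun _ => ?_)
      ((continuous_extendPath γ).comp (continuous_const.mul continuous_id)).continuousOn ?_
      (continuous_extendPath γ').continuousOn ?_ ?_
    · exact (lipschitzWith_smul s').comp hL
    · intro t ht
      have h1 := (hasDerivWithinAt_extendPath hX h (hm t (Ico_subset_Icc_self ht))).scomp t
        (((hasDerivAt_id t).const_mul a).hasDerivWithinAt (s := Icc 0 1)) hm
      have h2 : HasDerivWithinAt (fun t => extendPath γ (a * t))
          (s' • X (extendPath γ (a * t))) (Icc 0 1) t := by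
        convert! h1 using 1
        simp only [mul_one, hs, smul_smul]
      exact h2.mono_of_mem_nhdsWithin (Icc_mem_nhdsGE_of_mem ht)
    · intro t ht
      exact (hasDerivWithinAt_extendPath hX h' (Ico_subset_Icc_self ht)).mono_of_mem_nhdsWithin
        (Icc_mem_nhdsGE_of_mem ht)
    · have e1 := extendPath_eq_of_picardDefect_eq_zero hX h (t := 0) (by simp)
      have e2 := extendPath_eq_of_picardDefect_eq_zero hX h' (t := 0) (by simp)
      simp only [intervalIntegral.integral_same, smul_zero, add_zero] at e1 e2
      simp [e1, e2]
  simpa using key (right_mem_Icc.2 zero_le_one)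

/-- A smooth Lipschitz vector field on a Banach space has a smooth local flow. -/
theorem exists_contDiffOn_flow_of_lipschitz {X : E → E} (hX : ContDiff ℝ ∞ X) {C : NNReal}
    (hL : LipschitzWith C X) (x₀ : E) :
    ∃ ε > 0, ∃ U ∈ 𝓝 x₀, ∃ Φ : ℝ × E → E, ContDiffOn ℝ ∞ Φ (Ioo (-ε) ε ×ˢ U) ∧
      ∀ x ∈ U, Φ (0, x) = x ∧
        ∀ t ∈ Ioo (-ε) ε, HasDerivAt (fun t => Φ (t, x)) (X (Φ (t, x))) t := by
  obtain ⟨σ, hσ⟩ := exists_contDiffAt_picard_solution hX x₀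
  obtain ⟨V, hV, U, hU, hVU⟩ := mem_nhds_prod_iff.1 hσ
  obtain ⟨ε, hε, hεV⟩ := Metric.mem_nhds_iff.1 hV
  rw [Real.ball_eq_Ioo, zero_sub, zero_add] at hεV
  have hmem : ∀ t ∈ Ioo (-ε) ε, ∀ x ∈ U, ContDiffAt ℝ ∞ σ (t, x) ∧
      picardDefect hX.continuous ((t, x), σ (t, x)) = 0 := fun t ht x hx => hVU ⟨hεV ht, hx⟩
  have hend : ∀ γ : C(Icc (0 : ℝ) 1, E), extendPath γ 1 = γ 1 := fun γ => by
    simp [extendPath]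
  have hzero : (0 : ℝ) ∈ Ioo (-ε) ε := ⟨by linarith, hε⟩
  have hval : ∀ s ∈ Ioo (-ε) ε, ∀ a ∈ Icc (0 : ℝ) 1, ∀ x ∈ U,
      σ (a * s, x) 1 = extendPath (σ (s, x)) a := by
    intro s hs a ha x hx
    have has : a * s ∈ Ioo (-ε) ε := by
      constructor <;> nlinarith [ha.1, ha.2, hs.1, hs.2]
    rw [← hend]
    exact (extendPath_mul_eq hX.continuous hL ha rfl (hmem s hs x hx).2 (hmem _ has x hx).2).symm
  let ev : C(Icc (0 : ℝ) 1, E) →L[ℝ] E := ContinuousMap.evalCLM ℝ 1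
  have hΦ : ∀ p ∈ Ioo (-ε) ε ×ˢ U, ContDiffAt ℝ ∞ (fun p => σ p 1) p := fun p hp =>
    (ev.contDiff.contDiffAt (x := σ p)).comp p (hmem p.1 hp.1 p.2 hp.2).1
  refine ⟨ε, hε, U, hU, fun p => σ p 1, fun p hp => (hΦ p hp).contDiffWithinAt, fun x hx => ?_⟩
  have hx0 : σ (0, x) 1 = x := by
    have h1 := extendPath_eq_of_picardDefect_eq_zero hX.continuous (hmem 0 hzero x hx).2
      (t := 1) (by simp)
    rwa [zero_smul, add_zero, hend] at h1
  refine ⟨hx0, fun t ht => ?_⟩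
  have hdiff : ∀ t ∈ Ioo (-ε) ε, DifferentiableAt ℝ (fun t => σ (t, x) 1) t := fun t ht =>
    DifferentiableAt.comp (g := fun p => σ p 1) (f := fun t => (t, x)) t
      ((hΦ (t, x) ⟨ht, hx⟩).differentiableAt (by simp)) (by fun_prop)
  rw [show X (σ (t, x) 1) = deriv (fun t => σ (t, x) 1) t from ?_]
  · exact (hdiff t ht).hasDerivAt
  -- The endpoint at time `a * s` is the value at `a` of the path of total time `s`, whose
  -- derivative in `a` is known. Both expressions for that derivative contain the factor `s`, so `s
  -- ≠ 0` is required; time `0` is reached with `a = 0`.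
  have hs : ∃ s ∈ Ioo (-ε) ε, s ≠ 0 ∧ ∃ a ∈ Icc (0 : ℝ) 1, t = a * s := by
    rcases eq_or_ne t 0 with rfl | h
    · exact ⟨ε / 2, ⟨by linarith, by linarith⟩, by positivity, 0, by simp, by simp⟩
    · exact ⟨t, ht, h, 1, by simp, by simp⟩
  obtain ⟨s, hs, hs0, a, ha, rfl⟩ := hs
  have h1 := hasDerivWithinAt_extendPath hX.continuous (hmem s hs x hx).2 ha
  rw [← hval s hs a ha x hx] at h1
  have h2 : HasDerivWithinAt (extendPath (σ (s, x)))
      (s • deriv (fun t => σ (t, x) 1) (a * s)) (Icc 0 1) a := by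
    have h3 := (hdiff _ ht).hasDerivAt.scomp a ((hasDerivAt_id a).mul_const s)
    rw [one_mul] at h3
    exact h3.hasDerivWithinAt.congr (fun b hb => (hval s hs b hb x hx).symm)
      (hval s hs a ha x hx).symm
  have h3 := (uniqueDiffOn_Icc_zero_one a ha).eq_deriv _ h1 h2
  exact smul_right_injective E hs0 h3

/-- A vector field that is smooth near a point of a finite dimensional space has a smooth local
flow around that point. -/
theorem exists_contDiffOn_flow [FiniteDimensional ℝ E] {X : E → E} {W : Set E} {x₀ : E}
    (hW : W ∈ 𝓝 x₀) (hX : ∀ x ∈ W, ContDiffAt ℝ ∞ X x) :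
    ∃ ε > 0, ∃ U ∈ 𝓝 x₀, ∃ Φ : ℝ × E → E, ContDiffOn ℝ ∞ Φ (Ioo (-ε) ε ×ˢ U) ∧
      ∀ x ∈ U, Φ (0, x) = x ∧ ∀ t ∈ Ioo (-ε) ε, Φ (t, x) ∈ W ∧
        HasDerivAt (fun t => Φ (t, x)) (X (Φ (t, x))) t := by
  obtain ⟨r, hr, hrW⟩ := Metric.mem_nhds_iff.1 hW
  let χ : ContDiffBump x₀ := ⟨r / 3, r / 2, by positivity, by linarith⟩
  -- The cut-off field is smooth with compact support, hence globally Lipschitz. It agrees with `X`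
  -- on the ball of radius `r / 3`, and the flow domain is shrunk below so that the flow stays in
  -- that ball.
  have hY : ContDiff ℝ ∞ (fun x => χ x • X x) := by
    rw [contDiff_iff_contDiffAt]
    intro x
    by_cases hx : x ∈ W
    · exact χ.contDiffAt.smul (hX x hx)
    · have hx' : x ∉ tsupport χ := by
        rw [χ.tsupport_eq]
        exact fun h => hx (hrW (Metric.closedBall_subset_ball (by simp [χ]; linarith) h))
      have : (fun x => χ x • X x) =ᶠ[𝓝 x] fun _ => 0 := by
        filter_upwards [(notMem_tsupport_iff_eventuallyEq.1 hx')] with y hy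
        simp [hy]
      exact contDiffAt_const.congr_of_eventuallyEq this
  have hc : HasCompactSupport (fun x => χ x • X x) := χ.hasCompactSupport.smul_right
  obtain ⟨C, hC⟩ := ContDiff.lipschitzWith_of_hasCompactSupport hc hY (by simp)
  obtain ⟨ε, hε, U, hU, Φ, hΦ, h⟩ := exists_contDiffOn_flow_of_lipschitz hY hC x₀
  have hcont : ContinuousAt Φ (0, x₀) :=
    (hΦ.continuousOn.continuousAt (prod_mem_nhds (Ioo_mem_nhds (by linarith) hε) hU))
  have hev : Φ ⁻¹' Metric.ball x₀ (r / 3) ∈ 𝓝 ((0 : ℝ), x₀) := by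
    refine hcont.preimage_mem_nhds ?_
    rw [(h x₀ (mem_of_mem_nhds hU)).1]
    exact Metric.ball_mem_nhds _ (by positivity)
  obtain ⟨V, hV, U', hU', hVU⟩ := mem_nhds_prod_iff.1 hev
  obtain ⟨δ, hδ, hδV⟩ := Metric.mem_nhds_iff.1 hV
  rw [Real.ball_eq_Ioo, zero_sub, zero_add] at hδV
  have hsub : Ioo (-(min ε δ)) (min ε δ) ⊆ Ioo (-ε) ε ∩ Ioo (-δ) δ := fun t ht =>
    ⟨⟨by linarith [ht.1, min_le_left ε δ], ht.2.trans_le (min_le_left _ _)⟩,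
      ⟨by linarith [ht.1, min_le_right ε δ], ht.2.trans_le (min_le_right _ _)⟩⟩
  refine ⟨min ε δ, lt_min hε hδ, U ∩ U', inter_mem hU hU', Φ,
    hΦ.mono (prod_mono (fun t ht => (hsub ht).1) inter_subset_left), fun x hx =>
    ⟨(h x hx.1).1, fun t ht => ?_⟩⟩
  have hb : Φ (t, x) ∈ Metric.ball x₀ (r / 3) := hVU ⟨hδV (hsub ht).2, hx.2⟩
  refine ⟨hrW (Metric.ball_subset_ball (by linarith) hb), ?_⟩
  have := (h x hx.1).2 t (hsub ht).1
  rwa [χ.one_of_mem_closedBall (Metric.ball_subset_closedBall hb), one_smul] at this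

end LocalFlow

end SymplecticSurface

/-! ### Local flows around interior points of the surface -/

namespace SymplecticSurface

open Set Filter Topology

variable {M : Type*} [TopologicalSpace M] [ChartedSpace (EuclideanHalfSpace 2) M]
  [IsManifold (𝓡∂ 2) ∞ M]

/-- The smoothness of a vector field on the surface. -/
def IsSmoothField (X : ∀ x : M, TangentSpace (𝓡∂ 2) x) : Prop :=
  ContMDiff (𝓡∂ 2) (𝓡∂ 2).tangent ∞ (fun x => (⟨x, X x⟩ : TangentBundle (𝓡∂ 2) M))

theorem isInteriorPoint_iff_extChartAt {x₀ x : M} (hx : x ∈ (extChartAt (𝓡∂ 2) x₀).source) :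
    (𝓡∂ 2).IsInteriorPoint x ↔
      extChartAt (𝓡∂ 2) x₀ x ∈ interior (extChartAt (𝓡∂ 2) x₀).target :=
  ModelWithCorners.isInteriorPoint_iff_of_mem_atlas (n := ∞) (by simp) (chart_mem_atlas _ x₀)
    (by simpa using hx)

theorem isOpen_interior_surface : IsOpen ((𝓡∂ 2).interior M) :=
  ModelWithCorners.isOpen_interior (n := ∞) (by simp)

theorem contMDiffAt_extChartAt_symm_of_mem_interior {x₀ : M} {y : EuclideanSpace ℝ (Fin 2)}
    (hy : y ∈ interior (extChartAt (𝓡∂ 2) x₀).target) :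
    ContMDiffAt 𝓘(ℝ, EuclideanSpace ℝ (Fin 2)) (𝓡∂ 2) ∞ (extChartAt (𝓡∂ 2) x₀).symm y :=
  (contMDiffOn_extChartAt_symm x₀).contMDiffAt (mem_interior_iff_mem_nhds.1 hy)

/-- A vector field in the chart around `x₀`. -/
noncomputable def fieldInChart (X : ∀ x : M, TangentSpace (𝓡∂ 2) x) (x₀ : M)
    (y : EuclideanSpace ℝ (Fin 2)) : EuclideanSpace ℝ (Fin 2) :=
  (trivializationAt (EuclideanSpace ℝ (Fin 2)) (TangentSpace (𝓡∂ 2)) x₀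
    ⟨(extChartAt (𝓡∂ 2) x₀).symm y, X ((extChartAt (𝓡∂ 2) x₀).symm y)⟩).2

theorem fieldInChart_eq (X : ∀ x : M, TangentSpace (𝓡∂ 2) x) (x₀ : M)
    {y : EuclideanSpace ℝ (Fin 2)} (hy : y ∈ (extChartAt (𝓡∂ 2) x₀).target) :
    fieldInChart X x₀ y = mfderiv (𝓡∂ 2) 𝓘(ℝ, EuclideanSpace ℝ (Fin 2)) (extChartAt (𝓡∂ 2) x₀)
      ((extChartAt (𝓡∂ 2) x₀).symm y) (X ((extChartAt (𝓡∂ 2) x₀).symm y)) := by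
  have h : (extChartAt (𝓡∂ 2) x₀).symm y ∈ (chartAt (EuclideanHalfSpace 2) x₀).source := by
    simpa using (extChartAt (𝓡∂ 2) x₀).map_target hy
  have e1 : (trivializationAt (EuclideanSpace ℝ (Fin 2)) (TangentSpace (𝓡∂ 2)) x₀).continuousLinearMapAt
      ℝ ((extChartAt (𝓡∂ 2) x₀).symm y) (X ((extChartAt (𝓡∂ 2) x₀).symm y)) =
      fieldInChart X x₀ y := by
    rw [Bundle.Trivialization.continuousLinearMapAt_apply,
      Bundle.Trivialization.linearMapAt_apply, if_pos (by simpa using h)]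
    rfl
  exact e1.symm.trans
    (DFunLike.congr_fun (TangentBundle.continuousLinearMapAt_trivializationAt h) _)

theorem contDiffAt_fieldInChart {X : ∀ x : M, TangentSpace (𝓡∂ 2) x} (hX : IsSmoothField X)
    (x₀ : M) {y : EuclideanSpace ℝ (Fin 2)}
    (hy : y ∈ interior (extChartAt (𝓡∂ 2) x₀).target) :
    ContDiffAt ℝ ∞ (fieldInChart X x₀) y := by
  have h : (extChartAt (𝓡∂ 2) x₀).symm y ∈ (chartAt (EuclideanHalfSpace 2) x₀).source := by
    simpa using (extChartAt (𝓡∂ 2) x₀).map_target (interior_subset hy)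
  have h1 := (Bundle.Trivialization.contMDiffAt_section_iff (n := ∞)
    (trivializationAt (EuclideanSpace ℝ (Fin 2)) (TangentSpace (𝓡∂ 2)) x₀)
    (by simpa using h)).1 (hX ((extChartAt (𝓡∂ 2) x₀).symm y))
  exact (h1.comp y (contMDiffAt_extChartAt_symm_of_mem_interior hy)).contDiffAt

/-- A curve in the chart that solves the equation in the chart gives an integral curve. -/
theorem hasMFDerivAt_extChartAt_symm_comp (X : ∀ x : M, TangentSpace (𝓡∂ 2) x) (x₀ : M)
    {f : ℝ → EuclideanSpace ℝ (Fin 2)} {t : ℝ}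
    (hy : f t ∈ interior (extChartAt (𝓡∂ 2) x₀).target)
    (hf : HasDerivAt f (fieldInChart X x₀ (f t)) t) :
    HasMFDerivAt 𝓘(ℝ, ℝ) (𝓡∂ 2) (fun t => (extChartAt (𝓡∂ 2) x₀).symm (f t)) t
      ((1 : ℝ →L[ℝ] ℝ).smulRight (X ((extChartAt (𝓡∂ 2) x₀).symm (f t)))) := by
  have hy' := interior_subset hy
  have hr : range (𝓡∂ 2) ∈ 𝓝 (f t) :=
    mem_of_superset (mem_interior_iff_mem_nhds.1 hy) (extChartAt_target_subset_range x₀)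
  have h1 : HasMFDerivAt 𝓘(ℝ, EuclideanSpace ℝ (Fin 2)) (𝓡∂ 2) (extChartAt (𝓡∂ 2) x₀).symm (f t)
      (mfderivWithin 𝓘(ℝ, EuclideanSpace ℝ (Fin 2)) (𝓡∂ 2) (extChartAt (𝓡∂ 2) x₀).symm
        (range (𝓡∂ 2)) (f t)) :=
    (mdifferentiableWithinAt_extChartAt_symm hy').hasMFDerivWithinAt.hasMFDerivAt hr
  have h2 := h1.comp t (hasMFDerivAt_iff_hasFDerivAt.2 hf.hasFDerivAt)
  have h3 := DFunLike.congr_fun (mfderivWithin_extChartAt_symm_comp_mfderiv_extChartAt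
    (I := 𝓡∂ 2) hy') (X ((extChartAt (𝓡∂ 2) x₀).symm (f t)))
  have h4 : mfderivWithin 𝓘(ℝ, EuclideanSpace ℝ (Fin 2)) (𝓡∂ 2) (extChartAt (𝓡∂ 2) x₀).symm
        (range (𝓡∂ 2)) (f t) (fieldInChart X x₀ (f t)) =
      X ((extChartAt (𝓡∂ 2) x₀).symm (f t)) :=
    (congrArg _ (fieldInChart_eq X x₀ hy')).trans h3
  refine h2.congr_mfderiv (ContinuousLinearMap.ext fun a => ?_)
  have h5 : mfderivWithin 𝓘(ℝ, EuclideanSpace ℝ (Fin 2)) (𝓡∂ 2) (extChartAt (𝓡∂ 2) x₀).symm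
        (range (𝓡∂ 2)) (f t) ((show ℝ from a) • fieldInChart X x₀ (f t)) =
      (show ℝ from a) • X ((extChartAt (𝓡∂ 2) x₀).symm (f t)) :=
    (ContinuousLinearMap.map_smul _ (show ℝ from a) _).trans (congrArg ((show ℝ from a) • ·) h4)
  exact h5

/-- A smooth vector field on the surface has a smooth local flow around each interior point. -/
theorem exists_flowBox {X : ∀ x : M, TangentSpace (𝓡∂ 2) x} (hX : IsSmoothField X) {x₀ : M}
    (hx₀ : (𝓡∂ 2).IsInteriorPoint x₀) :
    ∃ ε > 0, ∃ U ∈ 𝓝 x₀, ∃ Φ : ℝ × M → M,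
      ContMDiffOn (𝓘(ℝ, ℝ).prod (𝓡∂ 2)) (𝓡∂ 2) ∞ Φ (Ioo (-ε) ε ×ˢ U) ∧
      ∀ x ∈ U, Φ (0, x) = x ∧ (∀ t ∈ Ioo (-ε) ε, (𝓡∂ 2).IsInteriorPoint (Φ (t, x))) ∧
        IsMIntegralCurveOn (fun t => Φ (t, x)) X (Ioo (-ε) ε) := by
  set φ := extChartAt (𝓡∂ 2) x₀ with hφ
  have hW : interior φ.target ∈ 𝓝 (φ x₀) := isOpen_interior.mem_nhds
    ((isInteriorPoint_iff_extChartAt (mem_extChartAt_source x₀)).1 hx₀)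
  obtain ⟨ε, hε, U, hU, Ψ, hΨ, h⟩ := exists_contDiffOn_flow hW
    (fun y hy => contDiffAt_fieldInChart hX x₀ hy)
  have hU' : φ.source ∩ φ ⁻¹' (interior U) ∈ 𝓝 x₀ :=
    inter_mem (extChartAt_source_mem_nhds x₀) ((continuousAt_extChartAt x₀).preimage_mem_nhds
      (interior_mem_nhds.2 hU))
  refine ⟨ε, hε, _, hU', fun p => φ.symm (Ψ (p.1, φ p.2)), ?_, fun x hx => ⟨?_, ?_, ?_⟩⟩
  · intro p hp
    have hx := hp.2.1
    have hxU : φ p.2 ∈ interior U := hp.2.2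
    have h1 : ContMDiffAt (𝓘(ℝ, ℝ).prod (𝓡∂ 2)) 𝓘(ℝ, ℝ × EuclideanSpace ℝ (Fin 2)) ∞
        (fun p : ℝ × M => (p.1, φ p.2)) p := by
      refine contMDiffAt_fst.prodMk_space ?_
      exact (contMDiffAt_extChartAt' (by simpa [hφ] using hx)).comp p contMDiffAt_snd
    have h2 : ContDiffAt ℝ ∞ Ψ (p.1, φ p.2) := (hΨ _ ⟨hp.1, interior_subset hxU⟩).contDiffAt
      (prod_mem_nhds (Ioo_mem_nhds hp.1.1 hp.1.2) (mem_interior_iff_mem_nhds.1 hxU))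
    have h3 := contMDiffAt_extChartAt_symm_of_mem_interior
      ((h _ (interior_subset hxU)).2 p.1 hp.1).1
    exact (h3.comp p (h2.contMDiffAt.comp p h1)).contMDiffWithinAt
  · simp only
    rw [(h _ (interior_subset hx.2)).1, φ.left_inv hx.1]
  · intro t ht
    have h1 := ((h _ (interior_subset hx.2)).2 t ht).1
    have h2 := φ.map_target (interior_subset h1)
    rw [isInteriorPoint_iff_extChartAt h2, φ.right_inv (interior_subset h1)]
    exact h1
  · intro t ht
    have h1 := (h _ (interior_subset hx.2)).2 t ht
    exact (hasMFDerivAt_extChartAt_symm_comp X x₀ h1.1 h1.2).hasMFDerivWithinAt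

end SymplecticSurface

/-! ### Flows of compactly supported fields for arbitrarily long times -/

namespace SymplecticSurface

open Set Filter Topology

variable {M : Type*} [TopologicalSpace M] [ChartedSpace (EuclideanHalfSpace 2) M]
  [IsManifold (𝓡∂ 2) ∞ M]

/-- `Φ` is a smooth flow of `X` for times in `(-ε, ε)`, on the points of `U`, and it stays in the
interior of the surface. -/
structure IsFlowOn (X : ∀ x : M, TangentSpace (𝓡∂ 2) x) (ε : ℝ) (U : Set M) (Φ : ℝ × M → M) :
    Prop where
  smooth : ContMDiffOn (𝓘(ℝ, ℝ).prod (𝓡∂ 2)) (𝓡∂ 2) ∞ Φ (Ioo (-ε) ε ×ˢ U)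
  zero : ∀ x ∈ U, Φ (0, x) = x
  interior : ∀ x ∈ U, ∀ t ∈ Ioo (-ε) ε, (𝓡∂ 2).IsInteriorPoint (Φ (t, x))
  integral : ∀ x ∈ U, IsMIntegralCurveOn (fun t => Φ (t, x)) X (Ioo (-ε) ε)

theorem IsFlowOn.mono {X : ∀ x : M, TangentSpace (𝓡∂ 2) x} {ε δ : ℝ} {U V : Set M}
    {Φ : ℝ × M → M} (h : IsFlowOn X ε U Φ) (hδ : δ ≤ ε) (hV : V ⊆ U) : IsFlowOn X δ V Φ := by
  have hI : Ioo (-δ) δ ⊆ Ioo (-ε) ε := Ioo_subset_Ioo (neg_le_neg hδ) hδ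
  exact ⟨h.smooth.mono (prod_mono hI hV), fun x hx => h.zero x (hV hx),
    fun x hx t ht => h.interior x (hV hx) t (hI ht), fun x hx => (h.integral x (hV hx)).mono hI⟩

theorem exists_isFlowOn_nhds {X : ∀ x : M, TangentSpace (𝓡∂ 2) x} (hX : IsSmoothField X) {x₀ : M}
    (hx₀ : (𝓡∂ 2).IsInteriorPoint x₀) :
    ∃ ε > 0, ∃ U ∈ 𝓝 x₀, ∃ Φ : ℝ × M → M, IsFlowOn X ε U Φ := by
  obtain ⟨ε, hε, U, hU, Φ, h1, h2⟩ := exists_flowBox hX hx₀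
  exact ⟨ε, hε, U, hU, Φ, h1, fun x hx => (h2 x hx).1, fun x hx => (h2 x hx).2.1,
    fun x hx => (h2 x hx).2.2⟩

/-- Compactness of `K` turns the local existence times into a single one. Off `K` the field is zero
and the stationary flow `Prod.snd` serves for any time. -/
theorem exists_uniform_isFlowOn [T2Space M] {X : ∀ x : M, TangentSpace (𝓡∂ 2) x}
    (hX : IsSmoothField X)
    {K : Set M} (hK : IsCompact K) (hKint : K ⊆ (𝓡∂ 2).interior M) (hXK : ∀ x ∉ K, X x = 0) :
    ∃ ε > 0, ∀ x ∈ (𝓡∂ 2).interior M, ∃ U ∈ 𝓝 x, ∃ Φ : ℝ × M → M, IsFlowOn X ε U Φ := by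
  obtain ⟨ε, hε, h⟩ : ∃ ε > 0, ∀ x ∈ K, ∃ U ∈ 𝓝 x, ∃ Φ : ℝ × M → M, IsFlowOn X ε U Φ := by
    refine hK.induction_on (p := fun s => ∃ ε > 0, ∀ x ∈ s, ∃ U ∈ 𝓝 x, ∃ Φ, IsFlowOn X ε U Φ)
      ⟨1, one_pos, by simp⟩ ?_ ?_ ?_
    · rintro s t hst ⟨ε, hε, h⟩
      exact ⟨ε, hε, fun x hx => h x (hst hx)⟩
    · rintro s t ⟨ε, hε, h⟩ ⟨δ, hδ, h'⟩
      refine ⟨min ε δ, lt_min hε hδ, ?_⟩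
      rintro x (hx | hx)
      · obtain ⟨U, hU, Φ, hΦ⟩ := h x hx
        exact ⟨U, hU, Φ, hΦ.mono (min_le_left _ _) subset_rfl⟩
      · obtain ⟨U, hU, Φ, hΦ⟩ := h' x hx
        exact ⟨U, hU, Φ, hΦ.mono (min_le_right _ _) subset_rfl⟩
    · intro x hx
      obtain ⟨ε, hε, U, hU, Φ, hΦ⟩ := exists_isFlowOn_nhds hX (hKint hx)
      exact ⟨interior U, mem_nhdsWithin_of_mem_nhds (interior_mem_nhds.2 hU), ε, hε,
        fun y hy => ⟨U, mem_interior_iff_mem_nhds.1 hy, Φ, hΦ⟩⟩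
  refine ⟨ε, hε, fun x hx => ?_⟩
  by_cases hxK : x ∈ K
  · exact h x hxK
  · refine ⟨(𝓡∂ 2).interior M ∩ Kᶜ, (isOpen_interior_surface.inter hK.isClosed.isOpen_compl).mem_nhds
      ⟨hx, hxK⟩, Prod.snd, contMDiffOn_snd, fun _ _ => rfl, fun y hy _ _ => hy.1, fun y hy => ?_⟩
    exact (isMIntegralCurve_const (hXK y hy.2)).isMIntegralCurveOn _

theorem IsFlowOn.eqOn [T2Space M] {X : ∀ x : M, TangentSpace (𝓡∂ 2) x} (hX : IsSmoothField X)
    {ε : ℝ} (hε : 0 < ε) {U V : Set M} {Φ Ψ : ℝ × M → M} (h : IsFlowOn X ε U Φ)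
    (h' : IsFlowOn X ε V Ψ) {x : M} (hxU : x ∈ U) (hxV : x ∈ V) {t : ℝ} (ht : t ∈ Ioo (-ε) ε) :
    Φ (t, x) = Ψ (t, x) :=
  isMIntegralCurveOn_Ioo_eqOn_of_contMDiff (t₀ := 0) ⟨by linarith, hε⟩ (h.interior x hxU)
    (ContMDiff.of_le hX (by norm_cast)) (h.integral x hxU) (h'.integral x hxV)
    ((h.zero x hxU).trans (h'.zero x hxV).symm) ht

/-- A compactly supported smooth vector field has a smooth flow for a uniform short time. -/
theorem exists_isFlowOn_interior [T2Space M] {X : ∀ x : M, TangentSpace (𝓡∂ 2) x}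
    (hX : IsSmoothField X)
    {K : Set M} (hK : IsCompact K) (hKint : K ⊆ (𝓡∂ 2).interior M) (hXK : ∀ x ∉ K, X x = 0) :
    ∃ ε > 0, ∃ Φ : ℝ × M → M, IsFlowOn X ε ((𝓡∂ 2).interior M) Φ := by
  obtain ⟨ε, hε, h⟩ := exists_uniform_isFlowOn hX hK hKint hXK
  choose! U hU Φ hΦ using h
  have hself : ∀ x ∈ (𝓡∂ 2).interior M, x ∈ U x := fun x hx => mem_of_mem_nhds (hU x hx)
  have heq : ∀ x ∈ (𝓡∂ 2).interior M, ∀ y ∈ U x, y ∈ (𝓡∂ 2).interior M → ∀ t ∈ Ioo (-ε) ε,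
      Φ y (t, y) = Φ x (t, y) := fun x hx y hy hy' t ht =>
    (hΦ y hy').eqOn hX hε (hΦ x hx) (hself y hy') hy ht
  -- Each point is moved by the local flow chosen for that very point. By uniqueness this coincides
  -- near `x` with the single flow `Φ x`, so it is smooth.
  refine ⟨ε, hε, fun p => Φ p.2 p, ?_, fun x hx => (hΦ x hx).zero x (hself x hx),
    fun x hx => (hΦ x hx).interior x (hself x hx), fun x hx => (hΦ x hx).integral x (hself x hx)⟩
  rintro ⟨t, x⟩ ⟨ht, hx⟩
  have hn : Ioo (-ε) ε ×ˢ (U x ∩ (𝓡∂ 2).interior M) ∈ 𝓝 (t, x) := prod_mem_nhds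
    (Ioo_mem_nhds ht.1 ht.2) (inter_mem (hU x hx) (isOpen_interior_surface.mem_nhds hx))
  have h1 : ContMDiffAt (𝓘(ℝ, ℝ).prod (𝓡∂ 2)) (𝓡∂ 2) ∞ (Φ x) (t, x) :=
    ((hΦ x hx).smooth (t, x) ⟨ht, hself x hx⟩).contMDiffAt
      (mem_of_superset hn (prod_mono subset_rfl inter_subset_left))
  refine (h1.congr_of_eventuallyEq ?_).contMDiffWithinAt
  filter_upwards [hn] with p hp
  exact heq x hx p.2 hp.2.1 hp.2.2 p.1 hp.1

theorem IsFlowOn.add [T2Space M] {X : ∀ x : M, TangentSpace (𝓡∂ 2) x} (hX : IsSmoothField X)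
    {ε : ℝ} {Φ : ℝ × M → M} (h : IsFlowOn X ε ((𝓡∂ 2).interior M) Φ)
    {x : M} (hx : x ∈ (𝓡∂ 2).interior M) {a b : ℝ} (ha : a ∈ Ioo (-ε) ε) (hb : b ∈ Ioo (-ε) ε)
    (hab : a + b ∈ Ioo (-ε) ε) : Φ (a, Φ (b, x)) = Φ (a + b, x) := by
  have hε : 0 < ε := by linarith [ha.1, ha.2]
  have hbx := h.interior x hx b hb
  -- This interval consists of the `s` for which both `s` and `s + b` are admissible times. It is
  -- connected and contains `0`, so uniqueness of integral curves applies on it.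
  have hm : ∀ {s}, s ∈ Ioo (max (-ε) (-ε - b)) (min ε (ε - b)) →
      s ∈ Ioo (-ε) ε ∧ s + b ∈ Ioo (-ε) ε := by
    intro s hs
    have h1 := max_lt_iff.1 hs.1
    have h2 := lt_min_iff.1 hs.2
    exact ⟨⟨h1.1, h2.1⟩, by linarith, by linarith⟩
  have hm' : ∀ {s}, s ∈ Ioo (-ε) ε → s + b ∈ Ioo (-ε) ε →
      s ∈ Ioo (max (-ε) (-ε - b)) (min ε (ε - b)) := fun hs hs' =>
    ⟨max_lt hs.1 (by linarith [hs'.1]), lt_min hs.2 (by linarith [hs'.2])⟩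
  refine isMIntegralCurveOn_Ioo_eqOn_of_contMDiff (t₀ := 0)
    (γ := fun s => Φ (s, Φ (b, x))) (γ' := fun s => Φ (s + b, x)) (v := X)
    (hm' ⟨by linarith, hε⟩ (by simpa using hb)) (fun s hs => h.interior _ hbx s (hm hs).1)
    (ContMDiff.of_le hX (by norm_cast)) ((h.integral _ hbx).mono fun s hs => (hm hs).1) ?_ ?_
    (hm' ha hab)
  · exact ((h.integral x hx).comp_add b).mono fun s hs => (hm hs).2
  · simp only [h.zero _ hbx, zero_add]

/-- The flow at time `t` is the flow at time `t / 2` performed twice, which makes sense on an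
interval twice as long. -/
theorem IsFlowOn.double [T2Space M] {X : ∀ x : M, TangentSpace (𝓡∂ 2) x} (hX : IsSmoothField X)
    {ε : ℝ} (hε : 0 < ε) {Φ : ℝ × M → M} (h : IsFlowOn X ε ((𝓡∂ 2).interior M) Φ) :
    IsFlowOn X (2 * ε) ((𝓡∂ 2).interior M) (fun p => Φ (p.1 / 2, Φ (p.1 / 2, p.2))) := by
  have hhalf : ∀ {t}, t ∈ Ioo (-(2 * ε)) (2 * ε) → t / 2 ∈ Ioo (-ε) ε := fun ht =>
    ⟨by linarith [ht.1], by linarith [ht.2]⟩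
  have hopen : IsOpen (Ioo (-ε) ε ×ˢ (𝓡∂ 2).interior M) := isOpen_Ioo.prod isOpen_interior_surface
  have hat : ∀ t ∈ Ioo (-ε) ε, ∀ x ∈ (𝓡∂ 2).interior M,
      ContMDiffAt (𝓘(ℝ, ℝ).prod (𝓡∂ 2)) (𝓡∂ 2) ∞ Φ (t, x) := fun t ht x hx =>
    (h.smooth (t, x) ⟨ht, hx⟩).contMDiffAt (hopen.mem_nhds ⟨ht, hx⟩)
  refine ⟨?_, fun x hx => ?_, fun x hx t ht => ?_, fun x hx => ?_⟩
  · rintro ⟨t, x⟩ ⟨ht, hx⟩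
    have h0 : ContMDiffAt (𝓘(ℝ, ℝ).prod (𝓡∂ 2)) 𝓘(ℝ, ℝ) ∞ (fun p : ℝ × M => p.1 / 2) (t, x) :=
      (contDiff_id.div_const (2 : ℝ)).contMDiff.contMDiffAt.comp (t, x) contMDiffAt_fst
    have h1 : ContMDiffAt (𝓘(ℝ, ℝ).prod (𝓡∂ 2)) (𝓡∂ 2) ∞
        (fun p : ℝ × M => Φ (p.1 / 2, p.2)) (t, x) :=
      (hat (t / 2) (hhalf ht) x hx).comp (t, x) (h0.prodMk contMDiffAt_snd)
    exact ((hat (t / 2) (hhalf ht) _ (h.interior x hx _ (hhalf ht))).comp (t, x)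
      (h0.prodMk h1)).contMDiffWithinAt
  · simp only [zero_div, h.zero x hx]
  · exact h.interior _ (h.interior x hx _ (hhalf ht)) _ (hhalf ht)
  · refine IsMIntegralCurveAt.isMIntegralCurveOn fun t ht => ?_
    have hz := h.interior x hx _ (hhalf ht)
    have h1 : IsMIntegralCurveAt (fun s => Φ (s + -(t / 2), Φ (t / 2, x))) X t := by
      have h2 : IsMIntegralCurveAt (fun s => Φ (s, Φ (t / 2, x))) X (t / 2) :=
        (h.integral _ hz).isMIntegralCurveAt (Ioo_mem_nhds (hhalf ht).1 (hhalf ht).2)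
      have h3 := h2.comp_add (-(t / 2))
      rwa [sub_neg_eq_add, add_halves] at h3
    -- Near `t` the doubled flow is a single flow line issuing from the fixed point `Φ (t / 2, x)`.
    -- Additivity is used for `(s - t) / 2 + t / 2 = s / 2` and for `s / 2 + (s - t) / 2 = s - t /
    -- 2`; all these times are admissible for the original flow.
    have hev : ∀ᶠ s in 𝓝 t, Φ (s / 2, Φ (s / 2, x)) = Φ (s + -(t / 2), Φ (t / 2, x)) := by
      have e1 : ∀ᶠ s in 𝓝 t, s ∈ Ioo (-(2 * ε)) (2 * ε) := Ioo_mem_nhds ht.1 ht.2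
      have e2 : ∀ᶠ s in 𝓝 t, (s - t) / 2 ∈ Ioo (-ε) ε := by
        have : ContinuousAt (fun s => (s - t) / 2) t := by fun_prop
        exact this.eventually_mem (Ioo_mem_nhds (by simp [hε]) (by simp [hε]))
      have e3 : ∀ᶠ s in 𝓝 t, s + -(t / 2) ∈ Ioo (-ε) ε := by
        have : ContinuousAt (fun s => s + -(t / 2)) t := by fun_prop
        exact this.eventually_mem (Ioo_mem_nhds (by linarith [ht.1]) (by linarith [ht.2]))
      filter_upwards [e1, e2, e3] with s h1 h2 h3
      have e4 := h.add hX hx h2 (hhalf ht) (by convert hhalf h1 using 1; ring)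
      rw [show (s - t) / 2 + t / 2 = s / 2 by ring] at e4
      have e5 := h.add hX hz (hhalf h1) h2 (by convert h3 using 1; ring)
      rw [e4, show s / 2 + (s - t) / 2 = s + -(t / 2) by ring] at e5
      exact e5
    have h4 : ∀ᶠ s in 𝓝 t, (fun s => Φ (s / 2, Φ (s / 2, x))) =ᶠ[𝓝 s]
        fun s => Φ (s + -(t / 2), Φ (t / 2, x)) := hev.eventually_nhds
    filter_upwards [h1, h4] with s hs hs'
    have hXeq : ∀ a b : M, a = b →
        (show EuclideanSpace ℝ (Fin 2) from X a) = (show EuclideanSpace ℝ (Fin 2) from X b) := by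
      rintro a _ rfl
      rfl
    exact (hs.congr_of_eventuallyEq hs').congr_mfderiv (congrArg
      (fun v : EuclideanSpace ℝ (Fin 2) => (1 : ℝ →L[ℝ] ℝ).smulRight v)
      (hXeq _ _ hs'.self_of_nhds.symm))

/-- A compactly supported smooth vector field has a smooth flow for arbitrarily long times. -/
theorem exists_isFlowOn_long_time [T2Space M] {X : ∀ x : M, TangentSpace (𝓡∂ 2) x}
    (hX : IsSmoothField X)
    {K : Set M} (hK : IsCompact K) (hKint : K ⊆ (𝓡∂ 2).interior M) (hXK : ∀ x ∉ K, X x = 0)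
    (T : ℝ) : ∃ Φ : ℝ × M → M, IsFlowOn X T ((𝓡∂ 2).interior M) Φ := by
  obtain ⟨ε, hε, h⟩ := exists_isFlowOn_interior hX hK hKint hXK
  have hn : ∀ n : ℕ, ∃ Φ : ℝ × M → M, IsFlowOn X (2 ^ n * ε) ((𝓡∂ 2).interior M) Φ := by
    intro n
    induction n with
    | zero => simpa using h
    | succ n ih =>
      obtain ⟨Φ, hΦ⟩ := ih
      refine ⟨_, (pow_succ' (2 : ℝ) n ▸ mul_assoc (2 : ℝ) _ ε ▸ hΦ.double hX (by positivity))⟩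
  obtain ⟨n, hn'⟩ := pow_unbounded_of_one_lt (T / ε) one_lt_two
  obtain ⟨Φ, hΦ⟩ := hn n
  exact ⟨Φ, hΦ.mono ((div_lt_iff₀ hε).1 hn').le subset_rfl⟩

end SymplecticSurface

/-! ### The symplectic form in charts, fields dual to one-forms, and the angular form -/

namespace SymplecticSurface

open Set Filter Topology

variable {M : Type*} [TopologicalSpace M] [ChartedSpace (EuclideanHalfSpace 2) M]
  [IsManifold (𝓡∂ 2) ∞ M]

/-- The vector field which is constant, equal to `v`, in the chart around `x₀`. -/
noncomputable def chartField (x₀ : M) (v : EuclideanSpace ℝ (Fin 2)) (x : M) :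
    TangentSpace (𝓡∂ 2) x :=
  (trivializationAt (EuclideanSpace ℝ (Fin 2)) (TangentSpace (𝓡∂ 2)) x₀).symmL ℝ x v

theorem trivialization_chartField (x₀ : M) (v : EuclideanSpace ℝ (Fin 2)) {x : M}
    (hx : x ∈ (chartAt (EuclideanHalfSpace 2) x₀).source) :
    (trivializationAt (EuclideanSpace ℝ (Fin 2)) (TangentSpace (𝓡∂ 2)) x₀
      ⟨x, chartField x₀ v x⟩).2 = v := by
  have h := Bundle.Trivialization.continuousLinearMapAt_symmL (R := ℝ)
    (trivializationAt (EuclideanSpace ℝ (Fin 2)) (TangentSpace (𝓡∂ 2)) x₀) (b := x)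
    (by simpa using hx) v
  rw [Bundle.Trivialization.continuousLinearMapAt_apply,
    Bundle.Trivialization.linearMapAt_apply, if_pos (by simpa using hx)] at h
  exact h

theorem mfderiv_extChartAt_chartField (x₀ : M) (v : EuclideanSpace ℝ (Fin 2)) {x : M}
    (hx : x ∈ (chartAt (EuclideanHalfSpace 2) x₀).source) :
    mfderiv (𝓡∂ 2) 𝓘(ℝ, EuclideanSpace ℝ (Fin 2)) (extChartAt (𝓡∂ 2) x₀) x
      (chartField x₀ v x) = v := by
  have h := Bundle.Trivialization.continuousLinearMapAt_symmL (R := ℝ)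
    (trivializationAt (EuclideanSpace ℝ (Fin 2)) (TangentSpace (𝓡∂ 2)) x₀) (b := x)
    (by simpa using hx) v
  exact (DFunLike.congr_fun (TangentBundle.continuousLinearMapAt_trivializationAt (I := 𝓡∂ 2) hx)
    (chartField x₀ v x)).symm.trans h

theorem exists_chartField_eq (x₀ : M) {x : M}
    (hx : x ∈ (chartAt (EuclideanHalfSpace 2) x₀).source) (w : TangentSpace (𝓡∂ 2) x) :
    ∃ v, chartField x₀ v x = w :=
  ⟨_, Bundle.Trivialization.symmL_continuousLinearMapAt (R := ℝ)
    (trivializationAt (EuclideanSpace ℝ (Fin 2)) (TangentSpace (𝓡∂ 2)) x₀) (b := x)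
    (by simpa using hx) w⟩

theorem chartField_add (x₀ : M) (v w : EuclideanSpace ℝ (Fin 2)) (x : M) :
    chartField x₀ (v + w) x = chartField x₀ v x + chartField x₀ w x := map_add _ v w

theorem chartField_smul (x₀ : M) (a : ℝ) (v : EuclideanSpace ℝ (Fin 2)) (x : M) :
    chartField x₀ (a • v) x = a • chartField x₀ v x := map_smul _ a v

theorem contMDiffAt_chartField_of_contMDiffAt {x₀ : M} {v : M → EuclideanSpace ℝ (Fin 2)}
    (hv : ContMDiffAt (𝓡∂ 2) 𝓘(ℝ, EuclideanSpace ℝ (Fin 2)) ∞ v x₀) :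
    ContMDiffAt (𝓡∂ 2) (𝓡∂ 2).tangent ∞
      (fun x => (⟨x, chartField x₀ (v x) x⟩ : TangentBundle (𝓡∂ 2) M)) x₀ := by
  refine (Bundle.contMDiffAt_section x₀).2 (hv.congr_of_eventuallyEq ?_)
  filter_upwards [(chartAt (EuclideanHalfSpace 2) x₀).open_source.mem_nhds
    (mem_chart_source _ x₀)] with x hx
  exact trivialization_chartField x₀ (v x) hx

theorem contMDiffAt_chartField (x₀ : M) (v : EuclideanSpace ℝ (Fin 2)) :
    ContMDiffAt (𝓡∂ 2) (𝓡∂ 2).tangent ∞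
      (fun x => (⟨x, chartField x₀ v x⟩ : TangentBundle (𝓡∂ 2) M)) x₀ :=
  contMDiffAt_chartField_of_contMDiffAt contMDiffAt_const

theorem contMDiffAt_form_apply (Ω : SymplecticForm M) {x₀ : M}
    {V W : ∀ x : M, TangentSpace (𝓡∂ 2) x}
    (hV : ContMDiffAt (𝓡∂ 2) (𝓡∂ 2).tangent ∞
      (fun x => (⟨x, V x⟩ : TangentBundle (𝓡∂ 2) M)) x₀)
    (hW : ContMDiffAt (𝓡∂ 2) (𝓡∂ 2).tangent ∞
      (fun x => (⟨x, W x⟩ : TangentBundle (𝓡∂ 2) M)) x₀) :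
    ContMDiffAt (𝓡∂ 2) 𝓘(ℝ, ℝ) ∞ (fun x => Ω.form x (V x) (W x)) x₀ := by
  have : ContMDiffAt (𝓡∂ 2) ((𝓡∂ 2).prod 𝓘(ℝ, ℝ)) ∞
      (fun x ↦ Bundle.TotalSpace.mk' ℝ (E := Bundle.Trivial M ℝ) x (Ω.form x (V x) (W x))) x₀ := by
    apply ContMDiffAt.clm_bundle_apply₂ (F₁ := EuclideanSpace ℝ (Fin 2))
      (F₂ := EuclideanSpace ℝ (Fin 2))
    · exact Ω.smooth x₀
    · exact hV
    · exact hW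
  rw [Bundle.contMDiffAt_totalSpace] at this
  exact this.2

theorem form_swap (Ω : SymplecticForm M) (x : M) (v w : TangentSpace (𝓡∂ 2) x) :
    Ω.form x v w = - Ω.form x w v := by
  have h := Ω.alternating x (v + w)
  simp only [map_add, add_apply, Ω.alternating, zero_add, add_zero] at h
  linarith

theorem euclidean_eq_smul_add_smul (v : EuclideanSpace ℝ (Fin 2)) :
    v = v 0 • EuclideanSpace.single (0 : Fin 2) (1 : ℝ) +
      v 1 • EuclideanSpace.single (1 : Fin 2) (1 : ℝ) := by
  ext i
  fin_cases i <;> simp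

/-- The value of the symplectic form on the coordinate frame of the chart around `x₀`. -/
noncomputable def areaDensity (Ω : SymplecticForm M) (x₀ x : M) : ℝ :=
  Ω.form x (chartField x₀ (EuclideanSpace.single (0 : Fin 2) (1 : ℝ)) x)
    (chartField x₀ (EuclideanSpace.single (1 : Fin 2) (1 : ℝ)) x)

theorem form_chartField (Ω : SymplecticForm M) (x₀ x : M) (v w : EuclideanSpace ℝ (Fin 2)) :
    Ω.form x (chartField x₀ v x) (chartField x₀ w x) =
      areaDensity Ω x₀ x * (v 0 * w 1 - v 1 * w 0) := by
  conv_lhs => rw [euclidean_eq_smul_add_smul v, euclidean_eq_smul_add_smul w]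
  simp only [chartField_add, chartField_smul, map_add, map_smul, add_apply,
    smul_apply, Ω.alternating, smul_eq_mul, areaDensity]
  rw [form_swap Ω x (chartField x₀ (EuclideanSpace.single (1 : Fin 2) (1 : ℝ)) x)]
  ring

theorem contMDiffAt_areaDensity (Ω : SymplecticForm M) (x₀ : M) :
    ContMDiffAt (𝓡∂ 2) 𝓘(ℝ, ℝ) ∞ (areaDensity Ω x₀) x₀ :=
  contMDiffAt_form_apply Ω (contMDiffAt_chartField _ _) (contMDiffAt_chartField _ _)

theorem areaDensity_ne_zero (Ω : SymplecticForm M) (x₀ : M) {x : M}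
    (hx : x ∈ (chartAt (EuclideanHalfSpace 2) x₀).source) : areaDensity Ω x₀ x ≠ 0 := by
  intro h
  have h1 : chartField x₀ (EuclideanSpace.single (0 : Fin 2) (1 : ℝ)) x = 0 := by
    refine Ω.nondegenerate x _ fun w => ?_
    obtain ⟨v, rfl⟩ := exists_chartField_eq x₀ hx w
    rw [form_chartField, h, zero_mul]
  have h2 := mfderiv_extChartAt_chartField x₀ (EuclideanSpace.single (0 : Fin 2) (1 : ℝ)) hx
  rw [h1] at h2
  have h3 : (EuclideanSpace.single (0 : Fin 2) (1 : ℝ)) = 0 :=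
    h2.symm.trans (ContinuousLinearMap.map_zero _)
  simpa using congrArg (fun v : EuclideanSpace ℝ (Fin 2) => v 0) h3

/-- The vector field dual to a one-form. -/
noncomputable def dualField (Ω : SymplecticForm M) (β : ∀ x : M, TangentSpace (𝓡∂ 2) x →L[ℝ] ℝ)
    (x : M) : TangentSpace (𝓡∂ 2) x :=
  Classical.choose (exists_dual_vector Ω x (β x))

theorem form_dualField (Ω : SymplecticForm M) (β : ∀ x : M, TangentSpace (𝓡∂ 2) x →L[ℝ] ℝ) (x : M)
    (w : TangentSpace (𝓡∂ 2) x) : Ω.form x (dualField Ω β x) w = β x w :=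
  Classical.choose_spec (exists_dual_vector Ω x (β x)) w

theorem form_left_injective (Ω : SymplecticForm M) (x : M) {v w : TangentSpace (𝓡∂ 2) x}
    (h : ∀ u, Ω.form x v u = Ω.form x w u) : v = w := by
  refine sub_eq_zero.1 (Ω.nondegenerate x (v - w) fun u => ?_)
  rw [map_sub, sub_apply, h, sub_self]

theorem isSmoothField_dualField (Ω : SymplecticForm M)
    {β : ∀ x : M, TangentSpace (𝓡∂ 2) x →L[ℝ] ℝ}
    (hβ : ∀ (x₀ : M) (v : EuclideanSpace ℝ (Fin 2)),
      ContMDiffAt (𝓡∂ 2) 𝓘(ℝ, ℝ) ∞ (fun x => β x (chartField x₀ v x)) x₀) :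
    IsSmoothField (dualField Ω β) := by
  intro x₀
  set e₀ := EuclideanSpace.single (0 : Fin 2) (1 : ℝ) with he₀
  set e₁ := EuclideanSpace.single (1 : Fin 2) (1 : ℝ) with he₁
  -- Cramer's rule in the coordinate frame, where the form is `areaDensity` times the determinant.
  -- Smoothness of the dual field can be read off from these coefficients.
  let v : M → EuclideanSpace ℝ (Fin 2) := fun x =>
    (β x (chartField x₀ e₁ x) / areaDensity Ω x₀ x) • e₀ +
      (-(β x (chartField x₀ e₀ x)) / areaDensity Ω x₀ x) • e₁
  have hv : ContMDiffAt (𝓡∂ 2) 𝓘(ℝ, EuclideanSpace ℝ (Fin 2)) ∞ v x₀ := by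
    have hD := contMDiffAt_areaDensity Ω x₀
    have hne := areaDensity_ne_zero Ω x₀ (mem_chart_source _ x₀)
    exact ((((hβ x₀ e₁).div₀ hD hne)).smul contMDiffAt_const).add
      ((((hβ x₀ e₀).neg.div₀ hD hne)).smul contMDiffAt_const)
  refine (contMDiffAt_chartField_of_contMDiffAt hv).congr_of_eventuallyEq ?_
  filter_upwards [(chartAt (EuclideanHalfSpace 2) x₀).open_source.mem_nhds
    (mem_chart_source _ x₀)] with x hx
  have hne := areaDensity_ne_zero Ω x₀ hx
  congr 1
  refine form_left_injective Ω x fun u => ?_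
  rw [form_dualField]
  obtain ⟨w, rfl⟩ := exists_chartField_eq x₀ hx u
  rw [form_chartField]
  conv_lhs => rw [euclidean_eq_smul_add_smul w]
  simp only [chartField_add, chartField_smul, map_add, map_smul, smul_eq_mul]
  have hv0 : v x 0 = β x (chartField x₀ e₁ x) / areaDensity Ω x₀ x := by simp [v, he₀, he₁]
  have hv1 : v x 1 = -(β x (chartField x₀ e₀ x)) / areaDensity Ω x₀ x := by simp [v, he₀, he₁]
  rw [hv0, hv1]
  field_simp
  ring

theorem _root_.ContMDiffAt.complex_mul {E H N : Type*} [NormedAddCommGroup E] [NormedSpace ℝ E]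
    [TopologicalSpace H] {I : ModelWithCorners ℝ E H} [TopologicalSpace N] [ChartedSpace H N]
    {u v : N → ℂ} {x : N} (hu : ContMDiffAt I 𝓘(ℝ, ℂ) ∞ u x) (hv : ContMDiffAt I 𝓘(ℝ, ℂ) ∞ v x) :
    ContMDiffAt I 𝓘(ℝ, ℂ) ∞ (fun y => u y * v y) x :=
  (contDiff_mul (𝕜 := ℝ) (𝔸 := ℂ) (n := ∞)).contMDiff.contMDiffAt.comp x (hu.prodMk_space hv)

/-- The angular one-form `(2 π)⁻¹ Im (conj u du)`: the differential of the angle, measured in turns,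
of a function with values in the unit circle. -/
noncomputable def angularForm (u : M → ℂ) (x : M) : TangentSpace (𝓡∂ 2) x →L[ℝ] ℝ :=
  (2 * Real.pi)⁻¹ • (Complex.imCLM ∘L (ContinuousLinearMap.mul ℝ ℂ (starRingEnd ℂ (u x)))) ∘L
    (show TangentSpace (𝓡∂ 2) x →L[ℝ] ℂ from mfderiv (𝓡∂ 2) 𝓘(ℝ, ℂ) u x)

theorem angularForm_apply (u : M → ℂ) (x : M) (v : TangentSpace (𝓡∂ 2) x) :
    angularForm u x v = (2 * Real.pi)⁻¹ * (starRingEnd ℂ (u x) *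
      (show ℂ from mfderiv (𝓡∂ 2) 𝓘(ℝ, ℂ) u x v)).im := rfl

theorem contMDiffAt_angularForm_chartField {u : M → ℂ} (hu : ContMDiff (𝓡∂ 2) 𝓘(ℝ, ℂ) ∞ u) (x₀ : M)
    (v : EuclideanSpace ℝ (Fin 2)) :
    ContMDiffAt (𝓡∂ 2) 𝓘(ℝ, ℝ) ∞ (fun x => angularForm u x (chartField x₀ v x)) x₀ := by
  have h1 : ContMDiffAt (𝓡∂ 2) 𝓘(ℝ, ℂ) ∞
      (fun x => (show ℂ from mfderiv (𝓡∂ 2) 𝓘(ℝ, ℂ) u x (chartField x₀ v x))) x₀ :=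
    (contMDiff_snd_tangentBundle_modelSpace ℂ 𝓘(ℝ, ℂ)).contMDiffAt.comp x₀
      ((hu.contMDiff_tangentMap (m := ∞) (by simp)).contMDiffAt.comp x₀
        (contMDiffAt_chartField x₀ v))
  have h2 : ContMDiffAt (𝓡∂ 2) 𝓘(ℝ, ℂ) ∞ (fun x => starRingEnd ℂ (u x)) x₀ :=
    (Complex.conjCLE.contDiff.contMDiff.contMDiffAt).comp x₀ (hu x₀)
  have h3 : ContMDiffAt (𝓡∂ 2) 𝓘(ℝ, ℝ) ∞ (fun x => (starRingEnd ℂ (u x) *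
      (show ℂ from mfderiv (𝓡∂ 2) 𝓘(ℝ, ℂ) u x (chartField x₀ v x))).im) x₀ :=
    (Complex.imCLM.contDiff.contMDiff.contMDiffAt).comp x₀ (h2.complex_mul h1)
  simp only [angularForm_apply]
  exact contMDiffAt_const.mul h3

end SymplecticSurface

/-! ### Rotation of curves in the unit circle -/

namespace SymplecticSurface

open Set Filter Topology MeasureTheory

/-- The rate of rotation, in turns, of a curve in the unit circle. -/
noncomputable def turnRate (w : ℝ → ℂ) (θ : ℝ) : ℝ :=
  (2 * Real.pi)⁻¹ * (starRingEnd ℂ (w θ) * deriv w θ).im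

theorem continuous_turnRate {w : ℝ → ℂ} (hw : ContDiff ℝ 1 w) : Continuous (turnRate w) :=
  continuous_const.mul (Complex.continuous_im.comp
    ((Complex.continuous_conj.comp hw.continuous).mul (hw.continuous_deriv le_rfl)))

theorem conj_mul_self_of_norm_eq_one {z : ℂ} (hz : ‖z‖ = 1) : starRingEnd ℂ z * z = 1 := by
  rw [Complex.conj_mul', hz]
  simp

/-- Differentiating `conj w * w = 1` shows that `conj w * w'` is purely imaginary, hence determined
by `turnRate`. -/
theorem deriv_eq_of_norm_eq_one {w : ℝ → ℂ} (hw : ContDiff ℝ 1 w) (h1 : ∀ θ, ‖w θ‖ = 1) (θ : ℝ) :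
    deriv w θ = w θ * (2 * Real.pi * Complex.I * turnRate w θ) := by
  have hd : HasDerivAt w (deriv w θ) θ := ((hw.differentiable one_ne_zero) θ).hasDerivAt
  have hc : HasDerivAt (fun θ => starRingEnd ℂ (w θ)) (starRingEnd ℂ (deriv w θ)) θ :=
    Complex.conjCLE.hasFDerivAt.comp_hasDerivAt θ hd
  have hm := hc.mul hd
  have hconst : (fun θ => starRingEnd ℂ (w θ)) * w = fun _ => 1 := by
    funext θ
    exact conj_mul_self_of_norm_eq_one (h1 θ)
  rw [hconst] at hm
  have h0 := hm.unique (hasDerivAt_const θ (1 : ℂ))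
  have hre : (starRingEnd ℂ (w θ) * deriv w θ).re = 0 := by
    have := congrArg Complex.re h0
    simp only [Complex.add_re, Complex.mul_re, Complex.conj_re, Complex.conj_im,
      Complex.zero_re] at this ⊢
    linarith
  have hpi := Real.pi_ne_zero
  have key : starRingEnd ℂ (w θ) * deriv w θ = 2 * Real.pi * Complex.I * turnRate w θ := by
    apply Complex.ext
    · rw [hre]
      simp
    · have h2 : (2 * (Real.pi : ℂ) * Complex.I * (turnRate w θ : ℂ)) =
          ((2 * Real.pi * turnRate w θ : ℝ) : ℂ) * Complex.I := by
        push_cast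
        ring
      rw [h2, Complex.im_ofReal_mul, Complex.I_im, mul_one, turnRate]
      field_simp
  rw [← key, ← mul_assoc, mul_comm (w θ), conj_mul_self_of_norm_eq_one (h1 θ), one_mul]

theorem eq_mul_exp_integral_turnRate {w : ℝ → ℂ} (hw : ContDiff ℝ 1 w) (h1 : ∀ θ, ‖w θ‖ = 1)
    (θ : ℝ) : w θ = w 0 * Complex.exp (2 * Real.pi * Complex.I *
      ((∫ η in (0 : ℝ)..θ, turnRate w η : ℝ) : ℂ)) := by
  have hJ : ∀ θ, HasDerivAt (fun θ => ((∫ η in (0 : ℝ)..θ, turnRate w η : ℝ) : ℂ))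
      (turnRate w θ : ℂ) θ := fun θ =>
    (intervalIntegral.integral_hasDerivAt_right
      ((continuous_turnRate hw).intervalIntegrable _ _)
      ((continuous_turnRate hw).stronglyMeasurableAtFilter _ _)
      (continuous_turnRate hw).continuousAt).ofReal_comp
  have hd : ∀ θ, HasDerivAt (fun θ => w θ * Complex.exp (-(2 * Real.pi * Complex.I *
      ((∫ η in (0 : ℝ)..θ, turnRate w η : ℝ) : ℂ)))) 0 θ := by
    intro θ
    have h2 := (((hw.differentiable one_ne_zero) θ).hasDerivAt).mul
      (((hJ θ).const_mul (2 * Real.pi * Complex.I)).neg.cexp)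
    convert! h2 using 1
    rw [deriv_eq_of_norm_eq_one hw h1]
    ring
  have h3 := is_const_of_deriv_eq_zero (fun θ => (hd θ).differentiableAt)
    (fun θ => (hd θ).deriv) θ 0
  simp only [intervalIntegral.integral_same, Complex.ofReal_zero, mul_zero, neg_zero,
    Complex.exp_zero, mul_one] at h3
  rw [← h3, mul_assoc, ← Complex.exp_add, neg_add_cancel, Complex.exp_zero, mul_one]

theorem exists_int_eq_of_exp_eq_one {a : ℝ}
    (h : Complex.exp (2 * Real.pi * Complex.I * (a : ℂ)) = 1) : ∃ n : ℤ, a = n := by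
  obtain ⟨n, hn⟩ := Complex.exp_eq_one_iff.1 h
  refine ⟨n, ?_⟩
  have hne : (2 * Real.pi * Complex.I : ℂ) ≠ 0 := Complex.two_pi_I_ne_zero
  have h2 : (a : ℂ) = n := mul_left_cancel₀ hne (by rw [hn]; ring)
  exact_mod_cast h2

/-- A continuous real function with integer values on a preconnected set is constant there. -/
theorem eq_of_continuousOn_of_forall_exists_int {α : Type*} [TopologicalSpace α] {S : Set α}
    (hS : IsPreconnected S) {f : α → ℝ} (hf : ContinuousOn f S) (h : ∀ x ∈ S, ∃ n : ℤ, f x = n)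
    {x y : α} (hx : x ∈ S) (hy : y ∈ S) : f x = f y := by
  have hd : IsDiscrete (range ((↑) : ℤ → ℝ)) := by
    constructor
    exact Int.isClosedEmbedding_coe_real.isEmbedding.toHomeomorph.symm.isEmbedding.discreteTopology
  refine hS.constant_of_mapsTo hd hf (fun z hz => ?_) hx hy
  obtain ⟨n, hn⟩ := h z hz
  exact ⟨n, hn.symm⟩

theorem exists_int_integral_turnRate {w : ℝ → ℂ} (hw : ContDiff ℝ 1 w) (h1 : ∀ θ, ‖w θ‖ = 1)
    (hper : w 1 = w 0) : ∃ n : ℤ, ∫ η in (0 : ℝ)..1, turnRate w η = n := by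
  refine exists_int_eq_of_exp_eq_one ?_
  have h := eq_mul_exp_integral_turnRate hw h1 1
  rw [hper] at h
  have hne : w 0 ≠ 0 := fun h0 => by simpa [h0] using h1 0
  exact (mul_left_cancel₀ hne (by rw [mul_one]; exact h)).symm

/-- The integral of the rate of rotation is the increment of any continuous lift. -/
theorem integral_turnRate_eq {w : ℝ → ℂ} (hw : ContDiff ℝ 1 w) {h : ℝ → ℝ} (hc : Continuous h)
    (hwh : ∀ θ, w θ = unitAngle (h θ)) : ∫ η in (0 : ℝ)..1, turnRate w η = h 1 - h 0 := by
  have h1 : ∀ θ, ‖w θ‖ = 1 := fun θ => by rw [hwh, Circle.norm_coe]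
  have hexp : ∀ θ, w θ = Complex.exp (2 * Real.pi * Complex.I * (h θ : ℂ)) := fun θ => by
    rw [hwh, unitAngle, Circle.coe_exp]
    push_cast
    ring_nf
  -- Two continuous angles of the same curve differ by an integer, hence by a constant, and both
  -- increments are `0` at `θ = 0`.
  have hint : ∀ θ, ∃ n : ℤ, (∫ η in (0 : ℝ)..θ, turnRate w η) - (h θ - h 0) = n := by
    intro θ
    refine exists_int_eq_of_exp_eq_one ?_
    have h2 := eq_mul_exp_integral_turnRate hw h1 θ
    rw [hexp θ, hexp 0, ← Complex.exp_add] at h2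
    have h3 : (2 * Real.pi * Complex.I * ((∫ η in (0 : ℝ)..θ, turnRate w η) - (h θ - h 0) : ℝ) : ℂ)
        = (2 * Real.pi * Complex.I * (h 0 : ℂ) + 2 * Real.pi * Complex.I *
          ((∫ η in (0 : ℝ)..θ, turnRate w η : ℝ) : ℂ)) - 2 * Real.pi * Complex.I * (h θ : ℂ) := by
      push_cast
      ring
    rw [h3, Complex.exp_sub, ← h2, div_self (Complex.exp_ne_zero _)]
  have hcont : Continuous fun θ => (∫ η in (0 : ℝ)..θ, turnRate w η) - (h θ - h 0) :=
    (intervalIntegral.continuous_primitive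
      (fun a b => (continuous_turnRate hw).intervalIntegrable a b) 0).sub (hc.sub continuous_const)
  have h4 := eq_of_continuousOn_of_forall_exists_int isPreconnected_univ hcont.continuousOn
    (fun θ _ => hint θ) (mem_univ 1) (mem_univ 0)
  simp only [intervalIntegral.integral_same, sub_self] at h4
  linarith

theorem contMDiff_unitAngle : ContMDiff 𝓘(ℝ, ℝ) (𝓡 1) ∞ unitAngle :=
  contMDiff_circleExp.comp (contDiff_const.mul contDiff_id).contMDiff

theorem unitAngle_add_one (θ : ℝ) : unitAngle (θ + 1) = unitAngle θ := by
  rw [unitAngle, mul_add, mul_one, Circle.exp_add_two_pi]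
  rfl

theorem unitAngle_eq_unitAngle_iff {a b : ℝ} : unitAngle a = unitAngle b ↔ ∃ n : ℤ, a = b + n := by
  have hpi := Real.pi_ne_zero
  rw [unitAngle, unitAngle, Circle.exp_eq_exp]
  refine exists_congr fun n => ⟨fun h => ?_, fun h => by rw [h]; ring⟩
  have : 2 * Real.pi * a = 2 * Real.pi * (b + n) := by rw [h]; ring
  exact mul_left_cancel₀ (by positivity) this

theorem unitAngle_surjective : Function.Surjective unitAngle := by
  intro z
  obtain ⟨t, rfl⟩ := Circle.exp_surjective z
  exact ⟨t / (2 * Real.pi), by rw [unitAngle]; congr 1; field_simp⟩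

end SymplecticSurface

/-! ### The deformation invariant -/

namespace SymplecticSurface

open Set Filter Topology MeasureTheory

variable {M : Type*} [TopologicalSpace M] [ChartedSpace (EuclideanHalfSpace 2) M]
  [IsManifold (𝓡∂ 2) ∞ M]

/-- A smooth map `u` from the surface to the unit circle, equal to `1` outside a compact subset `K`
of the interior, whose restriction to the curve `c` has degree one. -/
structure IsDegreeOneMap (c : Circle → M) (u : M → ℂ) (K : Set M) : Prop where
  smooth : ContMDiff (𝓡∂ 2) 𝓘(ℝ, ℂ) ∞ u
  norm_eq_one : ∀ x, ‖u x‖ = 1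
  compact : IsCompact K
  subset : K ⊆ (𝓡∂ 2).interior M
  eq_one : ∀ x ∉ K, u x = 1
  lift : ∃ h : ℝ → ℝ, Continuous h ∧ (∀ θ, u (c (unitAngle θ)) = unitAngle (h θ)) ∧
    ∀ θ, h (θ + 1) = h θ + 1

theorem angularForm_eq_zero [T2Space M] {u : M → ℂ} {K : Set M} (hK : IsCompact K)
    (hu : ∀ x ∉ K, u x = 1) {x : M} (hx : x ∉ K) : angularForm u x = 0 := by
  have h : u =ᶠ[𝓝 x] fun _ => 1 := by
    filter_upwards [hK.isClosed.isOpen_compl.mem_nhds hx] with y hy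
    exact hu y hy
  ext v
  rw [angularForm_apply, h.mfderiv_eq, mfderiv_const]
  change (2 * Real.pi)⁻¹ * (starRingEnd ℂ (u x) * (0 : ℂ)).im = 0
  simp

theorem angularForm_mfderiv {u : M → ℂ} (hu : ContMDiff (𝓡∂ 2) 𝓘(ℝ, ℂ) ∞ u) {γ : ℝ → M} {θ : ℝ}
    (hγ : MDifferentiableAt 𝓘(ℝ, ℝ) (𝓡∂ 2) γ θ) :
    angularForm u (γ θ) (mfderiv 𝓘(ℝ, ℝ) (𝓡∂ 2) γ θ (1 : ℝ)) = turnRate (fun θ => u (γ θ)) θ := by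
  rw [angularForm_apply, turnRate]
  have h1 : mfderiv 𝓘(ℝ, ℝ) 𝓘(ℝ, ℂ) (u ∘ γ) θ =
      (mfderiv (𝓡∂ 2) 𝓘(ℝ, ℂ) u (γ θ)).comp (mfderiv 𝓘(ℝ, ℝ) (𝓡∂ 2) γ θ) :=
    mfderiv_comp θ ((hu (γ θ)).mdifferentiableAt (by simp)) hγ
  have h2 : deriv (fun θ => u (γ θ)) θ =
      (show ℂ from mfderiv (𝓡∂ 2) 𝓘(ℝ, ℂ) u (γ θ) (mfderiv 𝓘(ℝ, ℝ) (𝓡∂ 2) γ θ (1 : ℝ))) := by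
    rw [← fderiv_apply_one_eq_deriv]
    rw [mfderiv_eq_fderiv] at h1
    exact DFunLike.congr_fun h1 (1 : ℝ)
  rw [h2]

section Flow

variable [T2Space M] {X : ∀ x : M, TangentSpace (𝓡∂ 2) x} {T : ℝ} {Φ : ℝ × M → M} {c : Circle → M}

theorem IsFlowOn.contMDiffAt (h : IsFlowOn X T ((𝓡∂ 2).interior M) Φ) {t : ℝ} (ht : t ∈ Ioo (-T) T)
    {x : M} (hx : (𝓡∂ 2).IsInteriorPoint x) :
    ContMDiffAt (𝓘(ℝ, ℝ).prod (𝓡∂ 2)) (𝓡∂ 2) ∞ Φ (t, x) :=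
  (h.smooth (t, x) ⟨ht, hx⟩).contMDiffAt
    ((isOpen_Ioo.prod isOpen_interior_surface).mem_nhds ⟨ht, hx⟩)

theorem IsFlowOn.contMDiffAt_right (h : IsFlowOn X T ((𝓡∂ 2).interior M) Φ) {t : ℝ}
    (ht : t ∈ Ioo (-T) T) {x : M} (hx : (𝓡∂ 2).IsInteriorPoint x) :
    ContMDiffAt (𝓡∂ 2) (𝓡∂ 2) ∞ (fun x => Φ (t, x)) x :=
  (h.contMDiffAt ht hx).comp x (contMDiffAt_const.prodMk contMDiffAt_id)

theorem IsFlowOn.neg_cancel (hX : IsSmoothField X) (h : IsFlowOn X T ((𝓡∂ 2).interior M) Φ) {t : ℝ}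
    (ht : t ∈ Ioo (-T) T) {x : M} (hx : (𝓡∂ 2).IsInteriorPoint x) : Φ (-t, Φ (t, x)) = x := by
  have h1 := h.add hX hx (a := -t) (b := t) ⟨by linarith [ht.2], by linarith [ht.1]⟩ ht
    ⟨by linarith [ht.1, ht.2], by linarith [ht.1, ht.2]⟩
  rw [neg_add_cancel] at h1
  exact h1.trans (h.zero x hx)

/-- The flow at time `-t` is a local left inverse, so the chain rule gives a left inverse of the
differential. -/
theorem IsFlowOn.mfderiv_injective (hX : IsSmoothField X)
    (h : IsFlowOn X T ((𝓡∂ 2).interior M) Φ) {t : ℝ}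
    (ht : t ∈ Ioo (-T) T) {x : M} (hx : (𝓡∂ 2).IsInteriorPoint x) :
    Function.Injective (mfderiv (𝓡∂ 2) (𝓡∂ 2) (fun x => Φ (t, x)) x) := by
  have ht' : -t ∈ Ioo (-T) T := ⟨by linarith [ht.2], by linarith [ht.1]⟩
  have h1 : mfderiv (𝓡∂ 2) (𝓡∂ 2) ((fun y => Φ (-t, y)) ∘ fun x => Φ (t, x)) x =
      (mfderiv (𝓡∂ 2) (𝓡∂ 2) (fun y => Φ (-t, y)) (Φ (t, x))).comp
        (mfderiv (𝓡∂ 2) (𝓡∂ 2) (fun x => Φ (t, x)) x) :=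
    mfderiv_comp x ((h.contMDiffAt_right ht' (h.interior x hx t ht)).mdifferentiableAt (by simp))
      ((h.contMDiffAt_right ht hx).mdifferentiableAt (by simp))
  have h2 : ((fun y => Φ (-t, y)) ∘ fun x => Φ (t, x)) =ᶠ[𝓝 x] id := by
    filter_upwards [isOpen_interior_surface.mem_nhds hx] with y hy
    exact h.neg_cancel hX ht hy
  have h3 : HasMFDerivAt (𝓡∂ 2) (𝓡∂ 2) ((fun y => Φ (-t, y)) ∘ fun x => Φ (t, x)) x
      (ContinuousLinearMap.id ℝ (TangentSpace (𝓡∂ 2) x)) :=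
    (hasMFDerivAt_id x).congr_of_eventuallyEq h2
  intro v w hvw
  have h4 : ∀ v : TangentSpace (𝓡∂ 2) x, (show EuclideanSpace ℝ (Fin 2) from
      mfderiv (𝓡∂ 2) (𝓡∂ 2) (fun y => Φ (-t, y)) (Φ (t, x))
        (mfderiv (𝓡∂ 2) (𝓡∂ 2) (fun x => Φ (t, x)) x v)) = v := fun v =>
    (DFunLike.congr_fun (h1.symm.trans h3.mfderiv) v)
  exact (h4 v).symm.trans ((congrArg _ hvw).trans (h4 w))

/-- The tangent space of the circle is a line, on which an alternating form vanishes. So every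
embedded curve is Lagrangian, and the flow need not be shown to preserve `Ω`. -/
theorem form_circle_eq_zero (Ω : SymplecticForm M) {z : Circle} {x : M}
    (A : TangentSpace (𝓡 1) z →L[ℝ] TangentSpace (𝓡∂ 2) x) (u v : TangentSpace (𝓡 1) z) :
    Ω.form x (A u) (A v) = 0 := by
  let e : EuclideanSpace ℝ (Fin 1) := EuclideanSpace.single 0 1
  have h : ∀ u : EuclideanSpace ℝ (Fin 1), u = u 0 • e := by
    intro u
    ext i
    fin_cases i
    simp [e]
  let A' : EuclideanSpace ℝ (Fin 1) →L[ℝ] TangentSpace (𝓡∂ 2) x := A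
  have h2 : ∀ u v : EuclideanSpace ℝ (Fin 1), Ω.form x (A' u) (A' v) = 0 := by
    intro u v
    rw [h u, h v]
    simp only [map_smul, smul_apply, Ω.alternating, smul_zero]
  exact h2 u v

theorem IsFlowOn.isLagrangianEmbedding (Ω : SymplecticForm M) (hX : IsSmoothField X)
    (h : IsFlowOn X T ((𝓡∂ 2).interior M) Φ) (hc : IsEmbeddedCircle c)
    (hint : ∀ z, (𝓡∂ 2).IsInteriorPoint (c z)) {t : ℝ} (ht : t ∈ Ioo (-T) T) :
    IsLagrangianEmbedding Ω (fun z => Φ (t, c z)) where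
  smooth := fun z => (h.contMDiffAt_right ht (hint z)).comp z (hc.smooth z)
  injective := fun z z' hz => by
    apply hc.injective
    rw [← h.neg_cancel hX ht (hint z), ← h.neg_cancel hX ht (hint z')]
    exact congrArg (fun y => Φ (-t, y)) hz
  immersion := fun z => by
    have h1 : mfderiv (𝓡 1) (𝓡∂ 2) ((fun x => Φ (t, x)) ∘ c) z =
        (mfderiv (𝓡∂ 2) (𝓡∂ 2) (fun x => Φ (t, x)) (c z)).comp (mfderiv (𝓡 1) (𝓡∂ 2) c z) :=
      mfderiv_comp z ((h.contMDiffAt_right ht (hint z)).mdifferentiableAt (by simp))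
        ((hc.smooth z).mdifferentiableAt (by simp))
    change Function.Injective (mfderiv (𝓡 1) (𝓡∂ 2) ((fun x => Φ (t, x)) ∘ c) z)
    rw [h1]
    exact (h.mfderiv_injective hX ht (hint z)).comp (hc.immersion z)
  isotropic := fun z u v => form_circle_eq_zero Ω _ u v

theorem IsFlowOn.isLagrangianIsotopy (Ω : SymplecticForm M) (hX : IsSmoothField X)
    (h : IsFlowOn X T ((𝓡∂ 2).interior M) Φ) (hc : IsEmbeddedCircle c)
    (hint : ∀ z, (𝓡∂ 2).IsInteriorPoint (c z)) {T' : ℝ} (hT' : 0 ≤ T') (hT : T' < T) :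
    IsLagrangianIsotopy Ω c T' (fun t z => Φ (t, c z)) where
  smooth := by
    rintro ⟨t, z⟩ ⟨ht, -⟩
    have ht' : t ∈ Ioo (-T) T := ⟨by linarith [ht.1], by linarith [ht.2]⟩
    exact ((h.contMDiffAt ht' (hint z)).comp (t, z) (contMDiffAt_fst.prodMk
      ((hc.smooth z).comp (t, z) contMDiffAt_snd))).contMDiffWithinAt
  initial := funext fun z => h.zero _ (hint z)
  lagrangian := fun t ht => h.isLagrangianEmbedding Ω hX hc hint
    ⟨by linarith [ht.1], by linarith [ht.2]⟩

theorem IsFlowOn.isotopyVelocity_eq (h : IsFlowOn X T ((𝓡∂ 2).interior M) Φ)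
    (hint : ∀ z, (𝓡∂ 2).IsInteriorPoint (c z)) {T' : ℝ} (hT' : 0 < T') (hT : T' < T)
    {t : ℝ} (ht : t ∈ Icc 0 T') (θ : ℝ) :
    isotopyVelocity T' (fun t z => Φ (t, c z)) t θ = X (Φ (t, c (unitAngle θ))) := by
  have ht' : t ∈ Ioo (-T) T := ⟨by linarith [ht.1], by linarith [ht.2]⟩
  have hsub : Icc 0 T' ⊆ Ioo (-T) T := fun s hs => ⟨by linarith [hs.1], by linarith [hs.2]⟩
  have h1 := (h.integral _ (hint (unitAngle θ)) t ht').mono hsub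
  have h2 := h1.mfderivWithin ((uniqueDiffOn_Icc hT').uniqueMDiffOn t ht)
  rw [isotopyVelocity]
  refine (DFunLike.congr_fun h2 (1 : ℝ)).trans ?_
  change (1 : ℝ) • X (Φ (t, c (unitAngle θ))) = _
  rw [one_smul]

theorem IsFlowOn.contDiffAt_comp (h : IsFlowOn X T ((𝓡∂ 2).interior M) Φ)
    (hc : ContMDiff (𝓡 1) (𝓡∂ 2) ∞ c) (hint : ∀ z, (𝓡∂ 2).IsInteriorPoint (c z)) {u : M → ℂ}
    (hu : ContMDiff (𝓡∂ 2) 𝓘(ℝ, ℂ) ∞ u) {t : ℝ} (ht : t ∈ Ioo (-T) T) (θ : ℝ) :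
    ContDiffAt ℝ ∞ (fun p : ℝ × ℝ => u (Φ (p.1, c (unitAngle p.2)))) (t, θ) := by
  rw [← contMDiffAt_iff_contDiffAt]
  have h1 : ContMDiffAt 𝓘(ℝ, ℝ × ℝ) (𝓘(ℝ, ℝ).prod (𝓡∂ 2)) ∞
      (fun p : ℝ × ℝ => (p.1, c (unitAngle p.2))) (t, θ) :=
    contDiffAt_fst.contMDiffAt.prodMk (ContMDiffAt.comp (g := c ∘ unitAngle)
      (f := fun p : ℝ × ℝ => p.2) (t, θ) ((hc.comp contMDiff_unitAngle) θ)
      contDiffAt_snd.contMDiffAt)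
  exact (hu _).comp (t, θ) ((h.contMDiffAt ht (hint _)).comp (t, θ) h1)

/-- The number of turns of `u` along the curves of an isotopy does not change. -/
theorem IsFlowOn.integral_turnRate (h : IsFlowOn X T ((𝓡∂ 2).interior M) Φ)
    (hc : ContMDiff (𝓡 1) (𝓡∂ 2) ∞ c) (hint : ∀ z, (𝓡∂ 2).IsInteriorPoint (c z)) {u : M → ℂ}
    (hu : ContMDiff (𝓡∂ 2) 𝓘(ℝ, ℂ) ∞ u) (hu1 : ∀ x, ‖u x‖ = 1) {t : ℝ} (ht : t ∈ Ico 0 T) :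
    ∫ θ in (0 : ℝ)..1, turnRate (fun θ => u (Φ (t, c (unitAngle θ)))) θ =
      ∫ θ in (0 : ℝ)..1, turnRate (fun θ => u (c (unitAngle θ))) θ := by
  set W : ℝ × ℝ → ℂ := fun p => u (Φ (p.1, c (unitAngle p.2))) with hW
  have hmem : ∀ s ∈ Icc 0 t, s ∈ Ioo (-T) T := fun s hs =>
    ⟨by linarith [hs.1, hs.2, ht.1, ht.2], by linarith [hs.2, ht.2]⟩
  have hWat : ∀ s ∈ Icc 0 t, ∀ θ, ContDiffAt ℝ ∞ W (s, θ) := fun s hs θ =>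
    h.contDiffAt_comp hc hint hu (hmem s hs) θ
  have hcurve : ∀ s ∈ Icc 0 t, ContDiff ℝ 1 fun θ => W (s, θ) := fun s hs =>
    contDiff_iff_contDiffAt.2 fun θ => ((hWat s hs θ).of_le (by norm_cast)).comp θ
      (contDiffAt_const.prodMk contDiffAt_id)
  have hderiv : ∀ s ∈ Icc 0 t, ∀ θ, deriv (fun θ => W (s, θ)) θ = fderiv ℝ W (s, θ) (0, 1) := by
    intro s hs θ
    exact (((hWat s hs θ).differentiableAt (by simp)).hasFDerivAt.comp_hasDerivAt θ
      ((hasDerivAt_const θ s).prodMk (hasDerivAt_id θ))).deriv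
  have hcont : Continuous fun p : Icc 0 t × ℝ => turnRate (fun θ => W (p.1.1, θ)) p.2 := by
    have e : (fun p : Icc 0 t × ℝ => turnRate (fun θ => W (p.1.1, θ)) p.2) = fun p =>
        (2 * Real.pi)⁻¹ * (starRingEnd ℂ (W (p.1.1, p.2)) *
          fderiv ℝ W (p.1.1, p.2) (0, 1)).im := by
      funext p
      rw [turnRate, hderiv p.1.1 p.1.2]
    rw [e]
    have e1 : Continuous fun p : Icc 0 t × ℝ => ((p.1.1, p.2) : ℝ × ℝ) := by fun_prop
    have e2 : Continuous fun p : Icc 0 t × ℝ => W (p.1.1, p.2) :=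
      continuous_iff_continuousAt.2 fun p =>
        (hWat p.1.1 p.1.2 p.2).continuousAt.comp (f := fun p : Icc 0 t × ℝ => ((p.1.1, p.2) : ℝ × ℝ))
          e1.continuousAt
    have e3 : Continuous fun p : Icc 0 t × ℝ => fderiv ℝ W (p.1.1, p.2) :=
      continuous_iff_continuousAt.2 fun p =>
        (((hWat p.1.1 p.1.2 p.2).fderiv_right (m := 0) (by norm_cast)).continuousAt).comp
          (f := fun p : Icc 0 t × ℝ => ((p.1.1, p.2) : ℝ × ℝ)) e1.continuousAt
    exact continuous_const.mul (Complex.continuous_im.comp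
      ((Complex.continuous_conj.comp e2).mul (e3.clm_apply continuous_const)))
  have hI : Continuous fun s : Icc 0 t => ∫ θ in (0 : ℝ)..1, turnRate (fun θ => W (s.1, θ)) θ :=
    intervalIntegral.continuous_parametric_intervalIntegral_of_continuous' hcont 0 1
  -- The number of turns of a closed loop is an integer; since it depends continuously on `s` in an
  -- interval, it is constant.
  have hint' : ∀ s : Icc 0 t, ∃ n : ℤ,
      ∫ θ in (0 : ℝ)..1, turnRate (fun θ => W (s.1, θ)) θ = n := fun s => by
    refine exists_int_integral_turnRate (hcurve s.1 s.2) (fun θ => hu1 _) ?_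
    have := unitAngle_add_one 0
    rw [zero_add] at this
    simp only [hW, this]
  have : PreconnectedSpace (Icc 0 t) := Subtype.preconnectedSpace isPreconnected_Icc
  have h5 := eq_of_continuousOn_of_forall_exists_int isPreconnected_univ hI.continuousOn
    (fun s _ => hint' s) (mem_univ ⟨t, ht.1, le_rfl⟩) (mem_univ ⟨0, le_rfl, ht.1⟩)
  have h6 : (fun θ => W (0, θ)) = fun θ => u (c (unitAngle θ)) :=
    funext fun θ => congrArg u (h.zero _ (hint _))
  simp only [h6] at h5
  exact h5

end Flow

/-- With `Ω (X, ·) = -a` times the angular form of `u`, the inner flux integral at each time is `-a`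
times the number of turns of `u` along the moved curve. This number is constantly `1`, so the flux
at time `t` is `-(t * a)`. -/
theorem deformationInvariant_eq_top [T2Space M] (Ω : SymplecticForm M) {c : Circle → M}
    (hc : IsEmbeddedCircle c) (hint : ∀ z, (𝓡∂ 2).IsInteriorPoint (c z)) {u : M → ℂ} {K : Set M}
    (hu : IsDegreeOneMap c u K) (a : ℝ) : deformationInvariant Ω c a = ⊤ := by
  rw [EReal.eq_top_iff_forall_lt]
  intro y
  set T : ℝ := max y 0 + 1 with hT
  have hTpos : 0 < T := by positivity
  refine lt_of_lt_of_le (b := (T : EReal))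
    (EReal.coe_lt_coe_iff.2 (by linarith [le_max_left y 0])) (le_sSup ⟨T, hTpos.le, rfl, ?_⟩)
  set β : ∀ x : M, TangentSpace (𝓡∂ 2) x →L[ℝ] ℝ := fun x => (-a) • angularForm u x with hβ
  have hX : IsSmoothField (dualField Ω β) := isSmoothField_dualField Ω fun x₀ v =>
    (contMDiffAt_const (c := -a)).mul (contMDiffAt_angularForm_chartField hu.smooth x₀ v)
  have hXK : ∀ x ∉ K, dualField Ω β x = 0 := fun x hx => Ω.nondegenerate x _ fun w => by
    rw [form_dualField, hβ]
    simp [angularForm_eq_zero hu.compact hu.eq_one hx]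
  -- The extra unit of time places the closed interval `[0, T]` inside the open time domain of the
  -- flow.
  obtain ⟨Φ, hΦ⟩ := exists_isFlowOn_long_time hX hu.compact hu.subset hXK (T + 1)
  refine ⟨fun t z => Φ (t, c z), hΦ.isLagrangianIsotopy Ω hX hc hint hTpos.le (by linarith), ?_⟩
  intro t ht
  obtain ⟨h, hhc, hh, hh1⟩ := hu.lift
  have hdeg : ∫ θ in (0 : ℝ)..1, turnRate (fun θ => u (c (unitAngle θ))) θ = 1 := by
    have hw : ContDiff ℝ 1 fun θ => u (c (unitAngle θ)) :=
      ((hu.smooth.comp (hc.smooth.comp contMDiff_unitAngle)).contDiff).of_le (by norm_cast)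
    rw [integral_turnRate_eq hw hhc hh]
    have := hh1 0
    rw [zero_add] at this
    rw [this]
    ring
  have hrate : ∀ s ∈ Icc 0 T, (∫ θ in (0 : ℝ)..1, Ω.form (Φ (s, c (unitAngle θ)))
      (isotopyVelocity T (fun t z => Φ (t, c z)) s θ)
      (curveVelocity (fun t z => Φ (t, c z)) s θ)) = -a := by
    intro s hs
    have hs' : s ∈ Ioo (-(T + 1)) (T + 1) := ⟨by linarith [hs.1], by linarith [hs.2]⟩
    have e : ∀ θ, Ω.form (Φ (s, c (unitAngle θ)))
        (isotopyVelocity T (fun t z => Φ (t, c z)) s θ)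
        (curveVelocity (fun t z => Φ (t, c z)) s θ) =
        -a * turnRate (fun θ => u (Φ (s, c (unitAngle θ)))) θ := by
      intro θ
      rw [hΦ.isotopyVelocity_eq hint hTpos (by linarith) hs θ]
      refine (form_dualField Ω β _ _).trans ?_
      have hγ : ContMDiff 𝓘(ℝ, ℝ) (𝓡∂ 2) ∞ fun θ => Φ (s, c (unitAngle θ)) := fun θ =>
        ContMDiffAt.comp (g := fun x => Φ (s, x)) (f := c ∘ unitAngle) θ
          (hΦ.contMDiffAt_right hs' (hint _)) ((hc.smooth.comp contMDiff_unitAngle) θ)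
      have e3 : angularForm u (Φ (s, c (unitAngle θ)))
          (curveVelocity (fun t z => Φ (t, c z)) s θ) =
          turnRate (fun θ => u (Φ (s, c (unitAngle θ)))) θ :=
        angularForm_mfderiv (γ := fun θ => Φ (s, c (unitAngle θ))) hu.smooth
          ((hγ θ).mdifferentiableAt (by simp))
      rw [← e3]
      rfl
    have e2 := hΦ.integral_turnRate hc.smooth hint hu.smooth hu.norm_eq_one
      (t := s) ⟨hs.1, by linarith [hs.2]⟩
    refine (intervalIntegral.integral_congr fun θ _ => e θ).trans ?_
    refine (intervalIntegral.integral_const_mul (-a) _).trans ?_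
    refine (congrArg (fun r => -a * r) (e2.trans hdeg)).trans ?_
    exact mul_one _
  rw [flux, intervalIntegral.integral_congr (g := fun _ => -a)]
  · simp
  · intro s hs
    rw [uIcc_of_le ht.1] at hs
    exact hrate s ⟨hs.1, hs.2.trans ht.2⟩

end SymplecticSurface

/-! ### Powers of the degree-one map, approximation on the curve, and vanishing brackets -/

namespace SymplecticSurface

open Set Filter Topology

theorem unitAngle_fract (t : ℝ) : unitAngle (Int.fract t) = unitAngle t :=
  unitAngle_eq_unitAngle_iff.2 ⟨-⌊t⌋, by rw [Int.fract]; push_cast; ring⟩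

theorem coe_unitAngle (θ : ℝ) :
    (unitAngle θ : ℂ) = Complex.exp (2 * Real.pi * Complex.I * (θ : ℂ)) := by
  rw [unitAngle, Circle.coe_exp]
  push_cast
  ring_nf

theorem coe_unitAngle_add (a b : ℝ) :
    (unitAngle (a + b) : ℂ) = (unitAngle a : ℂ) * (unitAngle b : ℂ) := by
  rw [coe_unitAngle, coe_unitAngle, coe_unitAngle, ← Complex.exp_add]
  push_cast
  ring_nf

theorem coe_unitAngle_neg (a : ℝ) : (unitAngle (-a) : ℂ) = starRingEnd ℂ (unitAngle a : ℂ) := by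
  rw [coe_unitAngle, coe_unitAngle, ← Complex.exp_conj]
  simp [map_ofNat]

theorem dist_unitAngle_le (a b : ℝ) :
    dist (unitAngle (a + b) : ℂ) (unitAngle a : ℂ) ≤ 2 * Real.pi * |b| := by
  rw [dist_eq_norm, coe_unitAngle_add, ← mul_sub_one, norm_mul, Circle.norm_coe, one_mul]
  have h := Real.norm_exp_I_mul_ofReal_sub_one_le (x := 2 * Real.pi * b)
  rw [Real.norm_eq_abs, abs_mul, abs_of_pos Real.two_pi_pos] at h
  rw [coe_unitAngle]
  convert! h using 4
  push_cast
  ring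

/-- A continuous periodic function factors through the circle. -/
theorem exists_continuous_comp_unitAngle {r : ℝ → ℝ} (hr : Continuous r)
    (hper : Function.Periodic r 1) : ∃ ρ : C(Circle, ℝ), ∀ θ, ρ (unitAngle θ) = r θ := by
  have hfr : ∀ t, r (Int.fract t) = r t := fun t => by
    have := hper.sub_zsmul_eq ⌊t⌋ (x := t)
    rwa [zsmul_one] at this
  let φ : C(Icc (0 : ℝ) 1, Circle) := ⟨fun t => unitAngle t,
    contMDiff_unitAngle.continuous.comp continuous_subtype_val⟩
  have hmem : ∀ t : ℝ, Int.fract t ∈ Icc (0 : ℝ) 1 := fun t =>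
    ⟨Int.fract_nonneg t, (Int.fract_lt_one t).le⟩
  have hsurj : Function.Surjective φ := fun z => by
    obtain ⟨t, rfl⟩ := unitAngle_surjective z
    exact ⟨⟨Int.fract t, hmem t⟩, unitAngle_fract t⟩
  have hq : IsQuotientMap φ := φ.continuous.isClosedMap.isQuotientMap φ.continuous hsurj
  let R : C(Icc (0 : ℝ) 1, ℝ) := ⟨fun t => r t, hr.comp continuous_subtype_val⟩
  have hR : Function.FactorsThrough R φ := by
    intro a b hab
    obtain ⟨n, hn⟩ := unitAngle_eq_unitAngle_iff.1 hab
    have := hper.int_mul n (b : ℝ)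
    rw [mul_one] at this
    change r a = r b
    rw [hn, this]
  refine ⟨hq.lift R hR, fun θ => ?_⟩
  have h1 := DFunLike.congr_fun (hq.lift_comp R hR) ⟨Int.fract θ, hmem θ⟩
  have h2 : hq.lift R hR (unitAngle (Int.fract θ)) = r (Int.fract θ) := h1
  rwa [unitAngle_fract, hfr] at h2

variable {M : Type*} [TopologicalSpace M] [ChartedSpace (EuclideanHalfSpace 2) M]
  [IsManifold (𝓡∂ 2) ∞ M]

theorem contMDiff_complex_mul {u v : M → ℂ} (hu : ContMDiff (𝓡∂ 2) 𝓘(ℝ, ℂ) ∞ u)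
    (hv : ContMDiff (𝓡∂ 2) 𝓘(ℝ, ℂ) ∞ v) : ContMDiff (𝓡∂ 2) 𝓘(ℝ, ℂ) ∞ fun x => u x * v x :=
  fun x => (hu x).complex_mul (hv x)

theorem contMDiff_complex_conj {u : M → ℂ} (hu : ContMDiff (𝓡∂ 2) 𝓘(ℝ, ℂ) ∞ u) :
    ContMDiff (𝓡∂ 2) 𝓘(ℝ, ℂ) ∞ fun x => starRingEnd ℂ (u x) :=
  Complex.conjCLE.contDiff.contMDiff.comp hu

theorem contDiff_coe_unitAngle : ContDiff ℝ ∞ fun θ : ℝ => (unitAngle θ : ℂ) := by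
  simp only [coe_unitAngle]
  exact (contDiff_const.mul Complex.ofRealCLM.contDiff).cexp

/-- A map of degree one can be raised to any power. -/
theorem IsDegreeOneMap.exists_zpow {c : Circle → M} {u : M → ℂ} {K : Set M}
    (hu : IsDegreeOneMap c u K) (k : ℤ) :
    ∃ v : M → ℂ, ContMDiff (𝓡∂ 2) 𝓘(ℝ, ℂ) ∞ v ∧ (∀ x, ‖v x‖ = 1) ∧ (∀ x ∉ K, v x = 1) ∧
      ∃ h : ℝ → ℝ, Continuous h ∧ (∀ θ, v (c (unitAngle θ)) = unitAngle (h θ)) ∧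
        ∀ θ, h (θ + 1) = h θ + k := by
  obtain ⟨h₀, hc₀, hu₀, hp₀⟩ := hu.lift
  induction k with
  | zero =>
    exact ⟨fun _ => 1, contMDiff_const, by simp, by simp, fun _ => 0, continuous_const,
      by simp [coe_unitAngle], by simp⟩
  | succ n ih =>
    obtain ⟨v, hv, hv1, hvK, h, hc, hvh, hp⟩ := ih
    refine ⟨fun x => v x * u x, contMDiff_complex_mul hv hu.smooth,
      fun x => by simp [hv1, hu.norm_eq_one], fun x hx => by simp [hvK x hx, hu.eq_one x hx],
      fun θ => h θ + h₀ θ, hc.add hc₀, fun θ => by beta_reduce; rw [coe_unitAngle_add, hvh, hu₀],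
      fun θ => ?_⟩
    beta_reduce
    rw [hp, hp₀]
    push_cast
    ring
  | pred n ih =>
    obtain ⟨v, hv, hv1, hvK, h, hc, hvh, hp⟩ := ih
    refine ⟨fun x => v x * starRingEnd ℂ (u x),
      contMDiff_complex_mul hv (contMDiff_complex_conj hu.smooth),
      fun x => by simp [hv1, hu.norm_eq_one], fun x hx => by simp [hvK x hx, hu.eq_one x hx],
      fun θ => h θ + -h₀ θ, hc.add hc₀.neg,
      fun θ => by beta_reduce; rw [coe_unitAngle_add, coe_unitAngle_neg, hvh, hu₀], fun θ => ?_⟩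
    beta_reduce
    rw [hp, hp₀]
    push_cast
    ring

/-- A continuous function on an embedded curve is approximated by smooth compactly supported
functions on the surface. -/
theorem exists_contMDiff_approx_on_curve [T2Space M] [SecondCountableTopology M] {c : Circle → M}
    (hc : IsEmbeddedCircle c) (ρ : C(Circle, ℝ)) {ε : ℝ} (hε : 0 < ε) :
    ∃ R : M → ℝ, ContMDiff (𝓡∂ 2) 𝓘(ℝ, ℝ) ∞ R ∧ HasCompactSupport R ∧
      ∀ z, |R (c z) - ρ z| < ε := by
  have : LocallyCompactSpace M := Manifold.locallyCompact_of_finiteDimensional (𝓡∂ 2)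
  have hemb : IsClosedEmbedding c := hc.smooth.continuous.isClosedEmbedding hc.injective
  obtain ⟨g, hg⟩ := ContinuousMap.exists_extension' hemb ρ
  obtain ⟨χ, hχ, -, hχc, -⟩ := exists_continuous_one_zero_of_isCompact
    (isCompact_range hc.smooth.continuous) isClosed_empty (disjoint_empty (range c))
  -- A Tietze extension `g` of `ρ`, cut off by a compactly supported `χ` equal to `1` on the curve,
  -- is smoothed without enlarging its support.
  obtain ⟨R, hR, hRs⟩ := Continuous.exists_contMDiff_approx (𝓡∂ 2) (f := fun x => χ x * g x)
    (ε := fun _ => ε) ⊤ (χ.continuous.mul g.continuous) continuous_const (fun _ => hε)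
  refine ⟨R, R.contMDiff, ?_, fun z => ?_⟩
  · exact hχc.mono (hRs.trans (Function.support_mul_subset_left _ _))
  · have h1 := hR (c z)
    have h2 : g (c z) = ρ z := congrFun hg z
    rw [Real.dist_eq, hχ (mem_range_self z), h2] at h1
    simpa using h1

/-- Differentiating `‖U‖ ^ 2 = 1` leaves only the component tangent to the circle, and the angular
form measures that component. -/
theorem mfderiv_eq_of_norm_eq_one {U : M → ℂ} (hU : ContMDiff (𝓡∂ 2) 𝓘(ℝ, ℂ) ∞ U)
    (h1 : ∀ x, ‖U x‖ = 1) (x : M) (v : TangentSpace (𝓡∂ 2) x) :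
    (show ℂ from mfderiv (𝓡∂ 2) 𝓘(ℝ, ℂ) U x v) =
      (angularForm U x v) • (2 * Real.pi * Complex.I * U x) := by
  set A : ℂ := (show ℂ from mfderiv (𝓡∂ 2) 𝓘(ℝ, ℂ) U x v) with hA
  have hcomp : mfderiv (𝓡∂ 2) 𝓘(ℝ, ℝ) ((fun z : ℂ => ‖z‖ ^ 2) ∘ U) x =
      (mfderiv 𝓘(ℝ, ℂ) 𝓘(ℝ, ℝ) (fun z : ℂ => ‖z‖ ^ 2) (U x)).comp
        (mfderiv (𝓡∂ 2) 𝓘(ℝ, ℂ) U x) :=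
    mfderiv_comp x (((contDiff_id (𝕜 := ℝ) (n := ∞)).norm_sq ℝ).contMDiff.contMDiffAt.mdifferentiableAt
      (by simp)) ((hU x).mdifferentiableAt (by simp))
  have hconst : ((fun z : ℂ => ‖z‖ ^ 2) ∘ U) = fun _ => 1 := by
    funext y
    simp [h1]
  have hre : 2 * inner ℝ (U x) A = 0 := by
    rw [hconst, mfderiv_const, mfderiv_eq_fderiv] at hcomp
    have h2 := DFunLike.congr_fun hcomp v
    have h3 : fderiv ℝ (fun z : ℂ => ‖z‖ ^ 2) (U x) A = 0 := h2.symm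
    rw [fderiv_norm_sq_apply] at h3
    simpa only [smul_apply, innerSL_apply_apply, nsmul_eq_mul, Nat.cast_ofNat] using h3
  have hre' : (starRingEnd ℂ (U x) * A).re = 0 := by
    rw [Complex.inner, mul_comm A] at hre
    linarith
  have him : starRingEnd ℂ (U x) * A = ((starRingEnd ℂ (U x) * A).im : ℂ) * Complex.I := by
    apply Complex.ext
    · rw [hre']
      simp
    · simp only [Complex.im_ofReal_mul, Complex.I_im, mul_one]
  have hpi : (Real.pi : ℂ) ≠ 0 := by exact_mod_cast Real.pi_ne_zero
  rw [angularForm_apply, ← hA, Complex.real_smul]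
  calc A = U x * (starRingEnd ℂ (U x) * A) := by
        rw [← mul_assoc, mul_comm (U x), conj_mul_self_of_norm_eq_one (h1 x), one_mul]
    _ = U x * (((starRingEnd ℂ (U x) * A).im : ℂ) * Complex.I) := by rw [← him]
    _ = _ := by
      push_cast
      field_simp

/-- The differential of a function of a circle valued map is a multiple of the angular form. -/
theorem exists_differential_eq_smul {U : M → ℂ} (hU : ContMDiff (𝓡∂ 2) 𝓘(ℝ, ℂ) ∞ U)
    (h1 : ∀ x, ‖U x‖ = 1) {f : ℂ → ℝ} (hf : ContDiff ℝ ∞ f) (x : M) :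
    ∃ a : ℝ, ∀ v, differential (fun x => f (U x)) x v = a * angularForm U x v := by
  refine ⟨fderiv ℝ f (U x) (2 * Real.pi * Complex.I * U x), fun v => ?_⟩
  have hcomp : mfderiv (𝓡∂ 2) 𝓘(ℝ, ℝ) (f ∘ U) x =
      (mfderiv 𝓘(ℝ, ℂ) 𝓘(ℝ, ℝ) f (U x)).comp (mfderiv (𝓡∂ 2) 𝓘(ℝ, ℂ) U x) :=
    mfderiv_comp x (hf.contMDiff.contMDiffAt.mdifferentiableAt (by simp))
      ((hU x).mdifferentiableAt (by simp))
  rw [mfderiv_eq_fderiv] at hcomp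
  have h2 : differential (fun x => f (U x)) x v =
      fderiv ℝ f (U x) (show ℂ from mfderiv (𝓡∂ 2) 𝓘(ℝ, ℂ) U x v) := DFunLike.congr_fun hcomp v
  rw [h2, mfderiv_eq_of_norm_eq_one hU h1, map_smul, smul_eq_mul, mul_comm]

/-- If `a ≠ 0`, then `Ω (sgrad F, sgrad F) = 0` says that `β` vanishes on `sgrad F`, and so does
`dG`. If `a = 0`, then `sgrad F = 0` by nondegeneracy. -/
theorem poissonBracket_eq_zero (Ω : SymplecticForm M) {F G : M → ℝ} {x : M}
    {β : TangentSpace (𝓡∂ 2) x → ℝ} {a b : ℝ} (hF : ∀ v, differential F x v = a * β v)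
    (hG : ∀ v, differential G x v = b * β v) : poissonBracket Ω F G x = 0 := by
  have h1 : -(a * β (sgrad Ω F x)) = 0 := by
    rw [← hF, ← sgrad_spec, Ω.alternating]
  have h2 : poissonBracket Ω F G x = -(b * β (sgrad Ω F x)) := by
    rw [← hG, poissonBracket, sgrad_spec]
  rcases eq_or_ne a 0 with rfl | ha
  · have h3 : sgrad Ω F x = 0 := Ω.nondegenerate x _ fun w => by
      rw [sgrad_spec, hF, zero_mul, neg_zero]
    rw [poissonBracket, h3, map_zero]
  · have h3 : β (sgrad Ω F x) = 0 := by simpa [ha] using h1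
    rw [h2, h3, mul_zero, neg_zero]

end SymplecticSurface

/-! ### The Poisson bracket invariant -/

namespace SymplecticSurface

open Set Filter Topology

theorem isCompact_image_unitAngle (a b : ℝ) :
    IsCompact ((fun z : Circle => (z : ℂ)) '' (unitAngle '' Icc a b)) :=
  (isCompact_Icc.image contMDiff_unitAngle.continuous).image continuous_subtype_val

theorem disjoint_image_unitAngle {a b a' b' : ℝ} (h₁ : b < a') (h₂ : b' < a + 1) :
    Disjoint ((fun z : Circle => (z : ℂ)) '' (unitAngle '' Icc a b))
      ((fun z : Circle => (z : ℂ)) '' (unitAngle '' Icc a' b')) := by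
  refine (Set.disjoint_image_iff Circle.coe_injective).2 (Set.disjoint_left.2 ?_)
  rintro _ ⟨s, hs, rfl⟩ ⟨t, ht, hst⟩
  obtain ⟨n, hn⟩ := unitAngle_eq_unitAngle_iff.1 hst
  have h3 : (0 : ℝ) < n := by linarith [hs.2, ht.1]
  have h4 : (n : ℝ) < 1 := by linarith [hs.1, ht.2]
  have h5 : (0 : ℤ) < n := by exact_mod_cast h3
  have h6 : n < (1 : ℤ) := by exact_mod_cast h4
  omega

/-- Disjoint compact sets in the plane are separated by a smooth function which is constant near
each of them. -/
theorem exists_contDiff_separating {A B : Set ℂ} (hA : IsCompact A) (hB : IsCompact B)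
    (hAB : Disjoint A B) : ∃ δ > 0, ∃ F : ℂ → ℝ, ContDiff ℝ ∞ F ∧
      (∀ z, ∀ a ∈ A, dist z a ≤ δ → F z = 0) ∧ ∀ z, ∀ b ∈ B, dist z b ≤ δ → F z = 1 := by
  obtain ⟨δ, hδ, hd⟩ := hAB.exists_cthickenings hA hB.isClosed
  obtain ⟨F, hF0, hF1, -⟩ := exists_contMDiffMap_zero_one_of_isClosed 𝓘(ℝ, ℂ) (n := ⊤)
    Metric.isClosed_cthickening Metric.isClosed_cthickening hd
  exact ⟨δ, hδ, F, F.contMDiff.contDiff,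
    fun z a ha h => hF0 (Metric.mem_cthickening_of_dist_le z a δ A ha h),
    fun z b hb h => hF1 (Metric.mem_cthickening_of_dist_le z b δ B hb h)⟩

variable {M : Type*} [TopologicalSpace M] [ChartedSpace (EuclideanHalfSpace 2) M]
  [IsManifold (𝓡∂ 2) ∞ M]

/-- Given a map of degree one, every fibration of the curve extends, up to a small error, to a
circle valued map on the surface which is constant outside a compact set. -/
theorem IsDegreeOneMap.exists_extension [T2Space M] [SecondCountableTopology M] {c : Circle → M}
    (hc : IsEmbeddedCircle c) {u : M → ℂ} {K : Set M} (hu : IsDegreeOneMap c u K)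
    {f : Circle → Circle} {k : ℤ} (hf : HasClass f k) (t₀ : ℝ) {δ : ℝ} (hδ : 0 < δ) :
    ∃ U : M → ℂ, ContMDiff (𝓡∂ 2) 𝓘(ℝ, ℂ) ∞ U ∧ (∀ x, ‖U x‖ = 1) ∧
      (∃ K' : Set M, IsCompact K' ∧ ∀ x ∉ K', U x = unitAngle t₀) ∧
      ∀ z, dist (U (c z)) (f z : ℂ) ≤ δ := by
  obtain ⟨g, hg, hfg, hgp⟩ := hf
  obtain ⟨v, hv, hv1, hvK, h, hh, hvh, hhp⟩ := hu.exists_zpow k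
  -- The lifts `h` and `g` both gain `k` per turn, so this difference descends to the circle.
  -- Subtracting a smooth approximation `R` of it from the angle `t₀ + h` of the rotated `v` leaves
  -- nearly the angle `g` of `f`. The tolerance `δ / (2 * π)` turns an angle measured in turns into
  -- a distance in the plane.
  obtain ⟨ρ, hρ⟩ := exists_continuous_comp_unitAngle (r := fun θ => h θ + t₀ - g θ)
    ((hh.add continuous_const).sub hg) (fun θ => by simp only [hhp, hgp]; ring)
  have hε : 0 < δ / (2 * Real.pi) := div_pos hδ Real.two_pi_pos
  obtain ⟨R, hR, hRc, hRρ⟩ := exists_contMDiff_approx_on_curve hc ρ hε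
  have hsm : ContMDiff (𝓡∂ 2) 𝓘(ℝ, ℂ) ∞ fun x => (unitAngle (-R x) : ℂ) :=
    contDiff_coe_unitAngle.contMDiff.comp hR.neg
  refine ⟨fun x => (unitAngle t₀ : ℂ) * (v x * unitAngle (-R x)),
    contMDiff_complex_mul contMDiff_const (contMDiff_complex_mul hv hsm),
    fun x => by rw [norm_mul, norm_mul, hv1, Circle.norm_coe, Circle.norm_coe, one_mul, one_mul],
    ⟨K ∪ tsupport R, hu.compact.union hRc, fun x hx => ?_⟩, fun z => ?_⟩
  · rw [mem_union, not_or] at hx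
    beta_reduce
    rw [hvK x hx.1, image_eq_zero_of_notMem_tsupport hx.2]
    simp [coe_unitAngle]
  · obtain ⟨θ, rfl⟩ := unitAngle_surjective z
    have h1 := hRρ (unitAngle θ)
    rw [hρ] at h1
    have h2 := dist_unitAngle_le (g θ) (h θ + t₀ - g θ - R (c (unitAngle θ)))
    rw [abs_sub_comm, lt_div_iff₀ Real.two_pi_pos] at h1
    beta_reduce
    rw [hvh, ← coe_unitAngle_add, ← coe_unitAngle_add, hfg]
    have h3 : t₀ + (h θ + -R (c (unitAngle θ))) =
      g θ + (h θ + t₀ - g θ - R (c (unitAngle θ))) := by ring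
    rw [h3]
    linarith

/-- The admissible pair is `F ∘ U`, `1 - G ∘ U`. Since `F` and `G` are constant on neighbourhoods of
the arcs, it suffices that `U` is close to `f` on the curve. Two functions of one circle-valued map
have zero bracket. -/
theorem bpOfFibration_eq_top [T2Space M] [SecondCountableTopology M] (Ω : SymplecticForm M)
    {c : Circle → M} (hc : IsEmbeddedCircle c) {u : M → ℂ} {K : Set M} (hu : IsDegreeOneMap c u K)
    {f : Circle → Circle} {k : ℤ} (hf : HasClass f k) (d : ArcDivision) :
    bpOfFibration Ω c f d = ⊤ := by
  obtain ⟨δ₁, hδ₁, F, hF, hF0, hF1⟩ := exists_contDiff_separating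
    (isCompact_image_unitAngle d.t₀ d.t₁) (isCompact_image_unitAngle d.t₂ d.t₃)
    (disjoint_image_unitAngle d.h₁₂ d.h₃₀)
  obtain ⟨δ₂, hδ₂, G, hG, hG1, hG0⟩ := exists_contDiff_separating
    (isCompact_image_unitAngle d.t₁ d.t₂) (isCompact_image_unitAngle d.t₃ (d.t₀ + 1))
    (disjoint_image_unitAngle d.h₂₃ (by linarith [d.h₀₁]))
  obtain ⟨U, hU, hU1, ⟨K', hK', hUK⟩, hUc⟩ := hu.exists_extension hc hf d.t₀ (lt_min hδ₁ hδ₂)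
  have hUc₁ := fun z => (hUc z).trans (min_le_left _ _)
  have hUc₂ := fun z => (hUc z).trans (min_le_right _ _)
  -- The value `t₀` of `U` off a compact set is the common endpoint of the first and fourth arcs.
  -- Both `F` and `1 - G` vanish there, which gives the pair compact supports.
  have hF' : F (unitAngle d.t₀) = 0 := hF0 _ _
    ⟨_, ⟨d.t₀, left_mem_Icc.2 d.h₀₁.le, rfl⟩, rfl⟩ (by simpa using hδ₁.le)
  have hG' : G (unitAngle d.t₀) = 1 := hG0 _ _
    ⟨_, ⟨d.t₀ + 1, right_mem_Icc.2 d.h₃₀.le, unitAngle_add_one _⟩, rfl⟩ (by simpa using hδ₂.le)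
  have hsub : ContDiff ℝ ∞ fun z => 1 - G z := contDiff_const.sub hG
  have hle : pb4Plus Ω (c '' (f ⁻¹' d.arc₁)) (c '' (f ⁻¹' d.arc₃))
      (c '' (f ⁻¹' d.arc₄)) (c '' (f ⁻¹' d.arc₂)) ≤ 0 := by
    refine iInf₂_le_of_le (⟨fun x => F (U x), fun x => 1 - G (U x)⟩ : (M → ℝ) × (M → ℝ))
      ⟨hF.contMDiff.comp hU, HasCompactSupport.intro hK' fun x hx => ?_, hsub.contMDiff.comp hU,
        HasCompactSupport.intro hK' fun x hx => ?_, ?_, ?_, ?_, ?_⟩ (iSup_le fun x => ?_)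
    · dsimp only
      rw [hUK x hx, hF']
    · dsimp only
      rw [hUK x hx, hG', sub_self]
    · rintro _ ⟨z, hz, rfl⟩
      exact (hF0 _ _ ⟨_, hz, rfl⟩ (hUc₁ z)).le
    · rintro _ ⟨z, hz, rfl⟩
      exact (hF1 _ _ ⟨_, hz, rfl⟩ (hUc₁ z)).ge
    · rintro _ ⟨z, hz, rfl⟩
      dsimp only
      rw [hG0 _ _ ⟨_, hz, rfl⟩ (hUc₂ z), sub_self]
    · rintro _ ⟨z, hz, rfl⟩
      dsimp only
      rw [hG1 _ _ ⟨_, hz, rfl⟩ (hUc₂ z), sub_zero]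
    · obtain ⟨a, ha⟩ := exists_differential_eq_smul hU hU1 hF x
      obtain ⟨b, hb⟩ := exists_differential_eq_smul hU hU1 hsub x
      rw [poissonBracket_eq_zero Ω ha hb, EReal.coe_zero]
  rw [bpOfFibration, invPb4Plus, if_pos hle]

theorem bp_eq_top [T2Space M] [SecondCountableTopology M] (Ω : SymplecticForm M) {c : Circle → M}
    (hc : IsEmbeddedCircle c) {u : M → ℂ} {K : Set M} (hu : IsDegreeOneMap c u K) (k : ℤ) :
    bp Ω c k = ⊤ := by
  rw [bp]
  split_ifs with hk
  · rfl
  · simp only [iInf_eq_top]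
    exact fun f _ hf d => bpOfFibration_eq_top Ω hc hu hf d

end SymplecticSurface

/-! ### Smooth phases and removal of point singularities -/

namespace SymplecticSurface

open Set Filter Topology

variable {M : Type*} [TopologicalSpace M] [ChartedSpace (EuclideanHalfSpace 2) M]
  [IsManifold (𝓡∂ 2) ∞ M]

theorem contDiffAt_arg {z : ℂ} (hz : z ∈ Complex.slitPlane) : ContDiffAt ℝ ∞ Complex.arg z := by
  have h := Complex.imCLM.contDiff.contDiffAt.comp z
    ((Complex.contDiffAt_log (n := ∞) hz).restrict_scalars ℝ)
  exact h.congr_of_eventuallyEq (Eventually.of_forall fun w => (Complex.log_im w).symm)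

theorem div_norm_eq_exp_arg {z : ℂ} (hz : z ≠ 0) :
    z / (‖z‖ : ℂ) = Complex.exp (z.arg * Complex.I) := by
  rw [div_eq_iff (by simpa using hz), mul_comm, Complex.norm_mul_exp_arg_mul_I]

theorem _root_.ContMDiffAt.complex_inv {f : M → ℂ} {x : M} (hf : ContMDiffAt (𝓡∂ 2) 𝓘(ℝ, ℂ) ∞ f x)
    (h0 : f x ≠ 0) : ContMDiffAt (𝓡∂ 2) 𝓘(ℝ, ℂ) ∞ (fun y => (f y)⁻¹) x :=
  ContMDiffAt.comp (g := fun z : ℂ => z⁻¹) (f := f) x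
    (contDiffAt_inv ℝ h0).contMDiffAt hf

theorem _root_.ContMDiffAt.complex_div {f g : M → ℂ} {x : M}
    (hf : ContMDiffAt (𝓡∂ 2) 𝓘(ℝ, ℂ) ∞ f x) (hg : ContMDiffAt (𝓡∂ 2) 𝓘(ℝ, ℂ) ∞ g x)
    (h0 : g x ≠ 0) : ContMDiffAt (𝓡∂ 2) 𝓘(ℝ, ℂ) ∞ (fun y => f y / g y) x := by
  simp only [div_eq_mul_inv]
  exact hf.complex_mul (hg.complex_inv h0)

theorem _root_.ContMDiffAt.complex_arg {f : M → ℂ} {x : M} (hf : ContMDiffAt (𝓡∂ 2) 𝓘(ℝ, ℂ) ∞ f x)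
    (h0 : f x ∈ Complex.slitPlane) :
    ContMDiffAt (𝓡∂ 2) 𝓘(ℝ, ℝ) ∞ (fun y => (f y).arg) x :=
  ContMDiffAt.comp (g := Complex.arg) (f := f) x (contDiffAt_arg h0).contMDiffAt hf

theorem _root_.ContMDiffAt.complex_conj {f : M → ℂ} {x : M}
    (hf : ContMDiffAt (𝓡∂ 2) 𝓘(ℝ, ℂ) ∞ f x) :
    ContMDiffAt (𝓡∂ 2) 𝓘(ℝ, ℂ) ∞ (fun y => starRingEnd ℂ (f y)) x :=
  ContMDiffAt.comp (g := fun z : ℂ => starRingEnd ℂ z) (f := f) x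
    Complex.conjCLE.contDiff.contMDiff.contMDiffAt hf

theorem _root_.ContMDiffAt.exp_ofReal_mul_I {g : M → ℝ} {x : M}
    (hg : ContMDiffAt (𝓡∂ 2) 𝓘(ℝ, ℝ) ∞ g x) :
    ContMDiffAt (𝓡∂ 2) 𝓘(ℝ, ℂ) ∞ (fun y => Complex.exp (g y * Complex.I)) x := by
  have h : ContDiff ℝ ∞ fun t : ℝ => Complex.exp (t * Complex.I) :=
    (Complex.ofRealCLM.contDiff.mul contDiff_const).cexp
  exact ContMDiffAt.comp (g := fun t : ℝ => Complex.exp (t * Complex.I)) (f := g) x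
    h.contMDiff.contMDiffAt hg

/-- The function `f` has a smooth real phase on a punctured neighbourhood of `p`. -/
def HasPhase (f : M → ℂ) (p : M) : Prop :=
  ∃ g : M → ℝ, ∀ᶠ x in 𝓝[≠] p, ContMDiffAt (𝓡∂ 2) 𝓘(ℝ, ℝ) ∞ g x ∧
    f x = Complex.exp (g x * Complex.I)

theorem HasPhase.mul {f f' : M → ℂ} {p : M} (hf : HasPhase f p) (hf' : HasPhase f' p) :
    HasPhase (fun x => f x * f' x) p := by
  obtain ⟨g, hg⟩ := hf
  obtain ⟨g', hg'⟩ := hf'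
  refine ⟨fun x => g x + g' x, ?_⟩
  filter_upwards [hg, hg'] with x h h'
  refine ⟨h.1.add h'.1, ?_⟩
  rw [h.2, h'.2, ← Complex.exp_add]
  push_cast
  ring_nf

theorem HasPhase.conj {f : M → ℂ} {p : M} (hf : HasPhase f p) :
    HasPhase (fun x => starRingEnd ℂ (f x)) p := by
  obtain ⟨g, hg⟩ := hf
  refine ⟨fun x => -g x, ?_⟩
  filter_upwards [hg] with x h
  refine ⟨h.1.neg, ?_⟩
  rw [h.2, ← Complex.exp_conj]
  simp

theorem HasPhase.congr {f f' : M → ℂ} {p : M} (hf : HasPhase f p) (h : f' =ᶠ[𝓝[≠] p] f) :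
    HasPhase f' p := by
  obtain ⟨g, hg⟩ := hf
  refine ⟨g, ?_⟩
  filter_upwards [hg, h] with x h₁ h₂
  exact ⟨h₁.1, h₂.trans h₁.2⟩

/-- Two unimodular functions with a common phase factor. -/
theorem HasPhase.of_mul_conj {f f' a : M → ℂ} {p : M} (ha : ∀ᶠ x in 𝓝[≠] p, ‖a x‖ = 1)
    (hf : HasPhase (fun x => f x * starRingEnd ℂ (a x)) p)
    (hf' : HasPhase (fun x => f' x * starRingEnd ℂ (a x)) p) :
    HasPhase (fun x => f x * starRingEnd ℂ (f' x)) p := by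
  refine (hf.mul hf'.conj).congr ?_
  filter_upwards [ha] with x hx
  have h := conj_mul_self_of_norm_eq_one hx
  rw [map_mul, Complex.conj_conj]
  linear_combination (-(f x * starRingEnd ℂ (f' x))) * h

/-- Near `p` the quotient `f / f p` is close to `1`, hence lies in the slit plane, where `arg` is
smooth. -/
theorem hasPhase_of_eventually_contMDiffAt {f : M → ℂ} {p : M}
    (hf : ∀ᶠ x in 𝓝 p, ContMDiffAt (𝓡∂ 2) 𝓘(ℝ, ℂ) ∞ f x ∧ ‖f x‖ = 1) : HasPhase f p := by
  have hp := hf.self_of_nhds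
  have h0 : f p ≠ 0 := norm_ne_zero_iff.1 (by rw [hp.2]; exact one_ne_zero)
  have hcont : ContinuousAt (fun x => f x / f p) p := hp.1.continuousAt.div_const _
  have hev : ∀ᶠ x in 𝓝 p, f x / f p ∈ Complex.slitPlane :=
    hcont.eventually (Complex.isOpen_slitPlane.mem_nhds (by simp [h0]))
  refine ⟨fun x => (f p).arg + (f x / f p).arg, ?_⟩
  filter_upwards [nhdsWithin_le_nhds hf, nhdsWithin_le_nhds hev] with x h₁ h₂
  refine ⟨contMDiffAt_const.add ((h₁.1.complex_div contMDiffAt_const h0).complex_arg h₂), ?_⟩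
  have h₃ := div_norm_eq_exp_arg h0
  have h₄ := div_norm_eq_exp_arg (Complex.slitPlane_ne_zero h₂)
  rw [norm_div, h₁.2, hp.2] at h₄
  rw [hp.2] at h₃
  push_cast
  rw [add_mul, Complex.exp_add, ← h₃, ← h₄]
  push_cast
  field_simp

/-- A singularity with a smooth phase can be removed by a modification in an arbitrarily small
neighbourhood. -/
theorem HasPhase.exists_modification [T2Space M] {f : M → ℂ} {p : M} (hf : HasPhase f p) {O : Set M}
    (hO : O ∈ 𝓝 p) : ∃ (f' : M → ℂ) (K : Set M), IsCompact K ∧ K ⊆ O ∧ (∀ x ∉ K, f' x = f x) ∧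
      ContMDiffAt (𝓡∂ 2) 𝓘(ℝ, ℂ) ∞ f' p ∧ ‖f' p‖ = 1 ∧
      (∀ x ≠ p, ContMDiffAt (𝓡∂ 2) 𝓘(ℝ, ℂ) ∞ f x → ContMDiffAt (𝓡∂ 2) 𝓘(ℝ, ℂ) ∞ f' x) ∧
      ∀ x ≠ p, ‖f x‖ = 1 → ‖f' x‖ = 1 := by
  obtain ⟨g, hg⟩ := hf
  rw [eventually_nhdsWithin_iff] at hg
  obtain ⟨χ, -, hχ⟩ := (SmoothBumpFunction.nhds_basis_tsupport (I := 𝓡∂ 2) p).mem_iff.1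
    (inter_mem hO hg)
  classical
  -- Where `χ = 1` the factor cancels the phase and leaves the constant `1`, also the value assigned
  -- at `p`. Off the support of `χ` nothing changes.
  set f' : M → ℂ := fun x => if x = p then 1 else f x * Complex.exp ((-(χ x * g x) : ℝ) * Complex.I)
    with hf'
  have hout : ∀ x ∉ tsupport χ, f' x = f x := fun x hx => by
    have hxp : x ≠ p := by
      rintro rfl
      exact hx (subset_tsupport _ (by simp))
    simp [hf', hxp, image_eq_zero_of_notMem_tsupport hx]
  have hnear : f' =ᶠ[𝓝 p] fun _ => 1 := by
    filter_upwards [χ.eventuallyEq_one, hg] with x h₁ h₂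
    by_cases hxp : x = p
    · simp [hf', hxp]
    · simp only [hf', hxp, if_false, h₁, Pi.one_apply, one_mul, (h₂ hxp).2, ← Complex.exp_add]
      simp
  refine ⟨f', tsupport χ, χ.hasCompactSupport, fun x hx => (hχ hx).1, hout,
    contMDiffAt_const.congr_of_eventuallyEq hnear, by simp [hf'], fun x hxp hx => ?_,
    fun x hxp hx => ?_⟩
  · by_cases hxs : x ∈ tsupport χ
    · have h₁ := ((χ.contMDiffAt (x := x)).mul ((hχ hxs).2 hxp).1).neg.exp_ofReal_mul_I
      refine (hx.complex_mul h₁).congr_of_eventuallyEq ?_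
      filter_upwards [isOpen_ne.mem_nhds hxp] with y hy
      simp only [hf', if_neg (show y ≠ p from hy)]
      rfl
    · refine hx.congr_of_eventuallyEq ?_
      filter_upwards [(isClosed_tsupport χ).isOpen_compl.mem_nhds hxs] with y hy
      exact hout y hy
  · simp only [hf', if_neg hxp, norm_mul, hx, Complex.norm_exp_ofReal_mul_I, one_mul]

end SymplecticSurface

/-! ### Oriented coordinates and winding around a point -/

namespace SymplecticSurface

open Set Filter Topology

variable {M : Type*} [TopologicalSpace M] [ChartedSpace (EuclideanHalfSpace 2) M]
  [IsManifold (𝓡∂ 2) ∞ M]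

/-- A complex valued coordinate `z` near `p`, with `z p = 0`, compatible at `p` with the orientation
given by the symplectic form. -/
structure IsOrientedCoordinate (Ω : SymplecticForm M) (z : M → ℂ) (p : M) : Prop where
  smooth : ∀ᶠ x in 𝓝 p, ContMDiffAt (𝓡∂ 2) 𝓘(ℝ, ℂ) ∞ z x
  eq_zero : z p = 0
  oriented : ∃ D : EuclideanSpace ℝ (Fin 2) →L[ℝ] ℂ, HasMFDerivAt (𝓡∂ 2) 𝓘(ℝ, ℂ) z p D ∧
    ∃ a > 0, ∀ v w : EuclideanSpace ℝ (Fin 2),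
      Ω.form p v w = a * (starRingEnd ℂ (D v) * D w).im

theorem hasFDerivAt_comp_extChartAt_symm {z : M → ℂ} {p : M} (hp : (𝓡∂ 2).IsInteriorPoint p)
    {D : EuclideanSpace ℝ (Fin 2) →L[ℝ] ℂ} (hz : HasMFDerivAt (𝓡∂ 2) 𝓘(ℝ, ℂ) z p D) :
    HasFDerivAt (fun y => z ((extChartAt (𝓡∂ 2) p).symm y)) D (extChartAt (𝓡∂ 2) p p) := by
  exact HasFDerivWithinAt.hasFDerivAt hz.2 (mem_interior_iff_mem_nhds.1 hp)

/-- A real linear map of the plane is the sum of a complex linear and an antilinear map. -/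
theorem exists_eq_mul_add_mul_conj (L : ℂ →L[ℝ] ℂ) : ∃ α β : ℂ,
    (∀ w, L w = α * w + β * starRingEnd ℂ w) ∧
    ‖α‖ ^ 2 - ‖β‖ ^ 2 = (starRingEnd ℂ (L 1) * L Complex.I).im := by
  refine ⟨(L 1 - Complex.I * L Complex.I) / 2, (L 1 + Complex.I * L Complex.I) / 2,
    fun w => ?_, ?_⟩
  · have h : L w = w.re • L 1 + w.im • L Complex.I := by
      rw [← map_smul, ← map_smul, ← map_add]
      congr 1
      apply Complex.ext <;> simp
    rw [h]
    apply Complex.ext <;> simp <;> ring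
  · rw [← Complex.normSq_eq_norm_sq, ← Complex.normSq_eq_norm_sq]
    simp [Complex.normSq_apply]
    ring

/-- The differential `D` of `z` is invertible because `Ω` is nondegenerate, and `L` is `D'` composed
with its inverse. Its determinant is positive because both coordinates pull the area form back to
positive multiples of the same `Ω`. -/
theorem IsOrientedCoordinate.exists_linear {Ω : SymplecticForm M} {z z' : M → ℂ} {p : M}
    (hp : (𝓡∂ 2).IsInteriorPoint p) (hz : IsOrientedCoordinate Ω z p)
    (hz' : IsOrientedCoordinate Ω z' p) : (∀ᶠ x in 𝓝[≠] p, z x ≠ 0) ∧ ∃ L : ℂ →L[ℝ] ℂ,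
      0 < (starRingEnd ℂ (L 1) * L Complex.I).im ∧
      (fun x => z' x - L (z x)) =o[𝓝 p] z := by
  obtain ⟨D, hD, a, ha, hform⟩ := hz.oriented
  obtain ⟨D', hD', a', ha', hform'⟩ := hz'.oriented
  have hinj : Function.Injective D := by
    rw [injective_iff_map_eq_zero]
    intro v hv
    refine Ω.nondegenerate p v fun w => ?_
    rw [hform v w, hv]
    simp
  let e : EuclideanSpace ℝ (Fin 2) ≃L[ℝ] ℂ := (LinearEquiv.ofInjectiveOfFinrankEq
    (D : EuclideanSpace ℝ (Fin 2) →ₗ[ℝ] ℂ) hinj (by simp)).toContinuousLinearEquiv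
  have he : ∀ v, e v = D v := fun v => rfl
  have hind : IsInducing D := e.toHomeomorph.isInducing
  set φ := extChartAt (𝓡∂ 2) p
  have hφ : Tendsto φ (𝓝 p) (𝓝 (φ p)) := continuousAt_extChartAt p
  have hinv : ∀ᶠ x in 𝓝 p, x ∈ φ.source := extChartAt_source_mem_nhds p
  have hF := hasFDerivAt_comp_extChartAt_symm hp hD
  have hF' := hasFDerivAt_comp_extChartAt_symm hp hD'
  have hsymm : φ.symm (φ p) = p := φ.left_inv (mem_extChartAt_source p)
  -- Invertibility of `D` bounds the chart displacement by `z`. This makes `p` an isolated zero of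
  -- `z` and converts errors small relative to the displacement into errors small relative to `z`.
  have hO : (fun x => φ x - φ p) =O[𝓝 p] z := by
    refine ((HasFDerivAt.isTheta_sub hF hind).isBigO_symm.comp_tendsto hφ).congr' EventuallyEq.rfl ?_
    filter_upwards [hinv] with x hx
    change z (φ.symm (φ x)) - z (φ.symm (φ p)) = _
    rw [φ.left_inv hx, hsymm, hz.eq_zero, sub_zero]
  have ho : (fun x => z x - D (φ x - φ p)) =o[𝓝 p] fun x => φ x - φ p := by
    refine (hF.isLittleO.comp_tendsto hφ).congr' ?_ EventuallyEq.rfl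
    filter_upwards [hinv] with x hx
    change z (φ.symm (φ x)) - z (φ.symm (φ p)) - _ = _
    rw [φ.left_inv hx, hsymm, hz.eq_zero, sub_zero]
  have ho' : (fun x => z' x - D' (φ x - φ p)) =o[𝓝 p] fun x => φ x - φ p := by
    refine (hF'.isLittleO.comp_tendsto hφ).congr' ?_ EventuallyEq.rfl
    filter_upwards [hinv] with x hx
    change z' (φ.symm (φ x)) - z' (φ.symm (φ p)) - _ = _
    rw [φ.left_inv hx, hsymm, hz'.eq_zero, sub_zero]
  let L : ℂ →L[ℝ] ℂ := D' ∘L (e.symm : ℂ →L[ℝ] EuclideanSpace ℝ (Fin 2))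
  have hL : ∀ v, L (D v) = D' v := fun v => by
    rw [← he]
    simp [L]
  refine ⟨?_, L, ?_, ?_⟩
  · obtain ⟨C, hC⟩ := hO.bound
    filter_upwards [nhdsWithin_le_nhds hC, nhdsWithin_le_nhds hinv, self_mem_nhdsWithin]
      with x h₁ h₂ h₃ h₄
    rw [h₄, norm_zero, mul_zero, norm_le_zero_iff, sub_eq_zero] at h₁
    exact h₃ (φ.injOn h₂ (mem_extChartAt_source p) h₁)
  · have h₁ := hform (e.symm 1) (e.symm Complex.I)
    have h₂ := hform' (e.symm 1) (e.symm Complex.I)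
    rw [← he, ← he, e.apply_symm_apply, e.apply_symm_apply] at h₁
    simp only [map_one, one_mul, Complex.I_im, mul_one] at h₁
    have h₃ : a' * (starRingEnd ℂ (L 1) * L Complex.I).im = a := h₂.symm.trans h₁
    by_contra! h₄
    nlinarith
  · have h : (fun x => L (z x - D (φ x - φ p))) =o[𝓝 p] fun x => φ x - φ p :=
      (L.isBigO_comp _ _).trans_isLittleO ho
    refine ((ho'.sub h).trans_isBigO hO).congr_left fun x => ?_
    rw [map_sub L, hL]
    ring

/-- The angles of two oriented coordinates differ by a smooth phase. -/
theorem IsOrientedCoordinate.hasPhase {Ω : SymplecticForm M} {z z' : M → ℂ} {p : M}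
    (hp : (𝓡∂ 2).IsInteriorPoint p) (hz : IsOrientedCoordinate Ω z p)
    (hz' : IsOrientedCoordinate Ω z' p) :
    HasPhase (fun x => z' x / ‖z' x‖ * starRingEnd ℂ (z x / ‖z x‖)) p := by
  obtain ⟨hne, L, hL, ho⟩ := hz.exists_linear hp hz'
  obtain ⟨α, β, hαβ, hdet⟩ := exists_eq_mul_add_mul_conj L
  -- Positive determinant means that the complex linear part dominates the antilinear one.
  have hlt : ‖β‖ < ‖α‖ := by
    refine lt_of_pow_lt_pow_left₀ 2 (norm_nonneg _) ?_
    linarith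
  have hα : 0 < ‖α‖ := (norm_nonneg _).trans_lt hlt
  have hα0 : α ≠ 0 := norm_pos_iff.1 hα
  -- With the `o(z)` error taken below `(‖α‖ - ‖β‖) / 2`, the total deviation from `α * z` is less
  -- than `‖α‖ * ‖z‖`. So the quotient is within distance `1` of `1` and has a smooth argument.
  have hr : ∀ᶠ x in 𝓝[≠] p, z' x / (α * z x) ∈ Complex.slitPlane := by
    filter_upwards [hne, nhdsWithin_le_nhds (ho.def (half_pos (sub_pos.2 hlt)))] with x h₁ h₂
    refine Complex.mem_slitPlane_of_norm_lt_one (z := z' x / (α * z x) - 1) ?_ |> fun h => by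
      simpa using h
    have hz0 : 0 < ‖z x‖ := norm_pos_iff.2 h₁
    have h₃ : z' x / (α * z x) - 1 = (z' x - L (z x) + β * starRingEnd ℂ (z x)) / (α * z x) := by
      rw [hαβ]
      field_simp
      ring
    rw [h₃, norm_div, norm_mul, div_lt_one (mul_pos hα hz0)]
    calc _ ≤ ‖z' x - L (z x)‖ + ‖β * starRingEnd ℂ (z x)‖ := norm_add_le _ _
      _ ≤ (‖α‖ - ‖β‖) / 2 * ‖z x‖ + ‖β‖ * ‖z x‖ := by
        rw [norm_mul, Complex.norm_conj]
        gcongr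
      _ < _ := by nlinarith
  refine ⟨fun x => α.arg + (z' x / (α * z x)).arg, ?_⟩
  filter_upwards [hne, hr, nhdsWithin_le_nhds hz.smooth, nhdsWithin_le_nhds hz'.smooth]
    with x h₁ h₂ h₃ h₄
  have hsm : ContMDiffAt (𝓡∂ 2) 𝓘(ℝ, ℂ) ∞ (fun x => z' x / (α * z x)) x :=
    h₄.complex_div (contMDiffAt_const.complex_mul h₃) (mul_ne_zero hα0 h₁)
  refine ⟨contMDiffAt_const.add (hsm.complex_arg h₂), ?_⟩
  push_cast
  rw [add_mul, Complex.exp_add, ← div_norm_eq_exp_arg hα0,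
    ← div_norm_eq_exp_arg (Complex.slitPlane_ne_zero h₂), norm_div, norm_mul]
  have hz0 : (‖z x‖ : ℂ) ≠ 0 := by simpa using h₁
  have hα0' : (‖α‖ : ℂ) ≠ 0 := by simpa using hα0
  have hz'0 : (‖z' x‖ : ℂ) ≠ 0 := by
    have := Complex.slitPlane_ne_zero h₂
    simpa using (div_ne_zero_iff.1 this).1
  have hconj : starRingEnd ℂ (z x) = (‖z x‖ : ℂ) ^ 2 / z x := by
    rw [eq_div_iff h₁, mul_comm, Complex.mul_conj, Complex.normSq_eq_norm_sq]
    push_cast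
    rfl
  rw [map_div₀, Complex.conj_ofReal, hconj]
  push_cast
  field_simp

/-- The function `u` winds once around `p`, in the positive direction, and has norm one: up to a
smooth phase, it is the angle of an oriented coordinate. -/
def IsAngle (Ω : SymplecticForm M) (u : M → ℂ) (p : M) : Prop :=
  ∃ z, IsOrientedCoordinate Ω z p ∧ HasPhase (fun x => u x * starRingEnd ℂ (z x / ‖z x‖)) p

theorem IsAngle.mul_hasPhase {Ω : SymplecticForm M} {u f : M → ℂ} {p : M} (hu : IsAngle Ω u p)
    (hf : HasPhase f p) : IsAngle Ω (fun x => u x * f x) p := by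
  obtain ⟨z, hz, h⟩ := hu
  exact ⟨z, hz, (h.mul hf).congr (Eventually.of_forall fun x => by ring)⟩

theorem IsAngle.congr {Ω : SymplecticForm M} {u u' : M → ℂ} {p : M} (hu : IsAngle Ω u p)
    (h : u' =ᶠ[𝓝[≠] p] u) : IsAngle Ω u' p := by
  obtain ⟨z, hz, hp⟩ := hu
  refine ⟨z, hz, hp.congr ?_⟩
  filter_upwards [h] with x hx
  rw [hx]

/-- Opposite winding numbers cancel: `u` and the conjugate of `u'` are angles of two oriented
coordinates, which differ by a smooth phase. -/
theorem IsAngle.hasPhase_mul {Ω : SymplecticForm M} {u u' : M → ℂ} {p : M}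
    (hp : (𝓡∂ 2).IsInteriorPoint p) (hu : IsAngle Ω u p)
    (hu' : IsAngle Ω (fun x => starRingEnd ℂ (u' x)) p) : HasPhase (fun x => u x * u' x) p := by
  obtain ⟨z, hz, h⟩ := hu
  obtain ⟨z', hz', h'⟩ := hu'
  have hunit : ∀ {z : M → ℂ}, IsOrientedCoordinate Ω z p → ∀ᶠ x in 𝓝[≠] p, ‖z x / ‖z x‖‖ = 1 := by
    intro z hz
    filter_upwards [(hz.exists_linear hp hz).1] with x hx
    rw [norm_div, Complex.norm_real, norm_norm, div_self (norm_ne_zero_iff.2 hx)]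
  have h₁ := (h.mul (hz.hasPhase hp hz').conj).congr (f' := fun x =>
      u x * starRingEnd ℂ (z' x / ‖z' x‖)) (by
    filter_upwards [hunit hz] with x hx
    have := conj_mul_self_of_norm_eq_one hx
    rw [map_mul, Complex.conj_conj]
    linear_combination (-(u x * starRingEnd ℂ (z' x / ‖z' x‖))) * this)
  exact (HasPhase.of_mul_conj (hunit hz') h₁ h').congr (Eventually.of_forall fun x => by simp)

end SymplecticSurface

/-! ### Dipoles in the plane and products of dipoles on the surface -/

namespace SymplecticSurface

open Set Filter Topology

section Plane

/-- The unit complex number which has the same argument `α` as `(z - p) / (z - q)` where `χ = 0`,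
and the argument `(1 - χ) α` in general. -/
noncomputable def dipoleFun (p q : ℂ) (χ : ℂ → ℝ) (z : ℂ) : ℂ :=
  (z - p) / (z - q) / (‖(z - p) / (z - q)‖ : ℂ) *
    Complex.exp ((-(χ z * ((z - p) / (z - q)).arg) : ℝ) * Complex.I)

/-- If the quotient equals `-t` with `t ≥ 0`, then `z = (p + t q) / (1 + t)`. The case `z = q`,
where division by zero gives `0`, also lies on the segment. -/
theorem div_mem_slitPlane_of_notMem_segment {p q z : ℂ} (hz : z ∉ segment ℝ p q) :
    (z - p) / (z - q) ∈ Complex.slitPlane := by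
  by_contra h
  rw [Complex.mem_slitPlane_iff, not_or, not_lt, not_not] at h
  apply hz
  by_cases hzq : z - q = 0
  · rw [sub_eq_zero.1 hzq]
    exact right_mem_segment ℝ p q
  obtain ⟨t, ht⟩ : ∃ t : ℝ, t = -((z - p) / (z - q)).re := ⟨_, rfl⟩
  have ht0 : 0 ≤ t := by linarith [h.1]
  have h₁ : (z - p) / (z - q) = -(t : ℂ) := by
    apply Complex.ext <;> simp [ht, h.2]
  rw [div_eq_iff hzq] at h₁
  have h₂ : (1 + t : ℂ) ≠ 0 := by
    rw [← Complex.ofReal_one, ← Complex.ofReal_add]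
    exact_mod_cast (by positivity : (1 + t : ℝ) ≠ 0)
  refine ⟨1 / (1 + t), t / (1 + t), by positivity, by positivity, by field_simp, ?_⟩
  simp only [Complex.real_smul]
  push_cast
  field_simp
  linear_combination -h₁

theorem norm_dipoleFun {p q : ℂ} (χ : ℂ → ℝ) {z : ℂ} (hp : z ≠ p) (hq : z ≠ q) :
    ‖dipoleFun p q χ z‖ = 1 := by
  have h : ‖(z - p) / (z - q)‖ ≠ 0 :=
    norm_ne_zero_iff.2 (div_ne_zero (sub_ne_zero.2 hp) (sub_ne_zero.2 hq))
  rw [dipoleFun, norm_mul, Complex.norm_exp_ofReal_mul_I, mul_one, norm_div, Complex.norm_real,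
    norm_norm, div_self h]

theorem dipoleFun_eq_exp {p q : ℂ} (χ : ℂ → ℝ) {z : ℂ} (hp : z ≠ p) (hq : z ≠ q) :
    dipoleFun p q χ z =
      Complex.exp (((1 - χ z) * ((z - p) / (z - q)).arg : ℝ) * Complex.I) := by
  rw [dipoleFun, div_norm_eq_exp_arg (div_ne_zero (sub_ne_zero.2 hp) (sub_ne_zero.2 hq)),
    ← Complex.exp_add]
  push_cast
  ring_nf

/-- Near the segment `χ` vanishes and the argument does not enter; off the segment the argument is
smooth. -/
theorem contDiffAt_dipoleFun {p q : ℂ} {χ : ℂ → ℝ} (hχ : ContDiff ℝ ∞ χ)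
    (hs : ∀ z ∈ segment ℝ p q, ∀ᶠ z' in 𝓝 z, χ z' = 0) {z : ℂ} (hp : z ≠ p) (hq : z ≠ q) :
    ContDiffAt ℝ ∞ (dipoleFun p q χ) z := by
  have h0 : (z - p) / (z - q) ≠ 0 := div_ne_zero (sub_ne_zero.2 hp) (sub_ne_zero.2 hq)
  have hw : ContDiffAt ℝ ∞ (fun z : ℂ => (z - p) / (z - q)) z :=
    (((contDiffAt_id.sub contDiffAt_const).div (contDiffAt_id.sub contDiffAt_const)
      (sub_ne_zero.2 hq) : ContDiffAt ℂ ∞ (fun z : ℂ => (z - p) / (z - q)) z)).restrict_scalars ℝ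
  have hn : ContDiffAt ℝ ∞ (fun z : ℂ => (‖(z - p) / (z - q)‖ : ℂ)) z :=
    Complex.ofRealCLM.contDiff.contDiffAt.comp z (hw.norm ℝ h0)
  have h1 : ContDiffAt ℝ ∞ (fun z : ℂ => (z - p) / (z - q) / (‖(z - p) / (z - q)‖ : ℂ)) z := by
    simp only [div_eq_mul_inv _ ((‖_‖ : ℝ) : ℂ)]
    exact hw.mul (hn.inv (by simpa [sub_eq_zero] using ⟨hp, hq⟩))
  by_cases hz : z ∈ segment ℝ p q
  · refine h1.congr_of_eventuallyEq ?_
    filter_upwards [hs z hz] with y hy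
    simp [dipoleFun, hy]
  · have h2 : ContDiffAt ℝ ∞ (fun z : ℂ => -(χ z * ((z - p) / (z - q)).arg)) z :=
      (hχ.contDiffAt.mul ((contDiffAt_arg (div_mem_slitPlane_of_notMem_segment hz)).comp
        (f := fun z : ℂ => (z - p) / (z - q)) z hw)).neg
    exact h1.mul ((Complex.ofRealCLM.contDiff.contDiffAt.comp z h2).mul contDiffAt_const).cexp

theorem exists_cutoff_segment {C : Set ℂ} (hC : IsOpen C) {p q : ℂ} (h : segment ℝ p q ⊆ C) :
    ∃ (χ : ℂ → ℝ) (K : Set ℂ), ContDiff ℝ ∞ χ ∧ IsCompact K ∧ K ⊆ C ∧ (∀ z ∉ K, χ z = 1) ∧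
      ∀ z ∈ segment ℝ p q, ∀ᶠ z' in 𝓝 z, χ z' = 0 := by
  have hS : IsCompact (segment ℝ p q) := by
    rw [← convexHull_pair]
    exact (Set.toFinite _).isCompact_convexHull ℝ
  obtain ⟨K₁, hK₁, hSK, hKC⟩ := exists_compact_between hS hC h
  obtain ⟨K₂, hK₂, hKK, hKC₂⟩ := exists_compact_between hK₁ hC hKC
  obtain ⟨χ, h0, h1, -⟩ := exists_contMDiffMap_zero_one_of_isClosed 𝓘(ℝ, ℂ) (n := ⊤)
    hK₁.isClosed isOpen_interior.isClosed_compl (disjoint_compl_right_iff_subset.2 hKK)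
  refine ⟨χ, K₂, χ.contMDiff.contDiff, hK₂, hKC₂, fun z hz => h1 fun h => hz (interior_subset h),
    fun z hz => ?_⟩
  filter_upwards [mem_interior_iff_mem_nhds.1 (hSK hz)] with y hy
  exact h0 hy

end Plane

variable {M : Type*} [TopologicalSpace M] [ChartedSpace (EuclideanHalfSpace 2) M]
  [IsManifold (𝓡∂ 2) ∞ M]

/-- A map `u` to the unit circle, defined and smooth outside of two points `p` and `q`, which has
winding number `1` around `p` and `-1` around `q`, and equals `1` outside of a compact subset `K` of
the interior of the surface. -/
structure IsDipole (Ω : SymplecticForm M) (u : M → ℂ) (K : Set M) (p q : M) : Prop where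
  compact : IsCompact K
  subset : K ⊆ (𝓡∂ 2).interior M
  eq_one : ∀ x ∉ K, u x = 1
  smooth : ∀ x, x ≠ p → x ≠ q → ContMDiffAt (𝓡∂ 2) 𝓘(ℝ, ℂ) ∞ u x
  norm_eq_one : ∀ x, x ≠ p → x ≠ q → ‖u x‖ = 1
  angle : IsAngle Ω u p
  angle_conj : IsAngle Ω (fun x => starRingEnd ℂ (u x)) q

theorem IsDipole.conj {Ω : SymplecticForm M} {u : M → ℂ} {K : Set M} {p q : M}
    (h : IsDipole Ω u K p q) : IsDipole Ω (fun x => starRingEnd ℂ (u x)) K q p where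
  compact := h.compact
  subset := h.subset
  eq_one x hx := by rw [h.eq_one x hx, map_one]
  smooth x hq hp := (h.smooth x hp hq).complex_conj
  norm_eq_one x hq hp := by rw [Complex.norm_conj, h.norm_eq_one x hp hq]
  angle := h.angle_conj
  angle_conj := h.angle.congr (Eventually.of_forall fun x => Complex.conj_conj _)

theorem IsDipole.hasPhase [T2Space M] {Ω : SymplecticForm M} {u : M → ℂ} {K : Set M} {p q x : M}
    (h : IsDipole Ω u K p q) (hp : x ≠ p) (hq : x ≠ q) : HasPhase u x := by
  refine hasPhase_of_eventually_contMDiffAt ?_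
  filter_upwards [isOpen_ne.mem_nhds hp, isOpen_ne.mem_nhds hq] with y h₁ h₂
  exact ⟨h.smooth y h₁ h₂, h.norm_eq_one y h₁ h₂⟩

/-- Dipoles can be concatenated. -/
theorem IsDipole.trans [T2Space M] {Ω : SymplecticForm M} {u u' : M → ℂ} {K K' : Set M}
    {p q r : M} (h : IsDipole Ω u K p q) (h' : IsDipole Ω u' K' q r) (hpq : p ≠ q) (hqr : q ≠ r)
    (hpr : p ≠ r) (hq : (𝓡∂ 2).IsInteriorPoint q) {N : Set M} (hN : N ∈ 𝓝 q) (hK : K ⊆ N)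
    (hK' : K' ⊆ N) : ∃ u'' K'', IsDipole Ω u'' K'' p r ∧ K'' ⊆ N := by
  -- At the common point `q` the windings `1` and `-1` cancel, so the product can be repaired there
  -- without touching `p` and `r`.
  have hphase : HasPhase (fun x => u' x * u x) q := h'.angle.hasPhase_mul hq h.angle_conj
  obtain ⟨f, L, hL, hLO, hout, hsm, hn, hsm', hn'⟩ := hphase.exists_modification
    (inter_mem (inter_mem hN (isOpen_interior_surface.mem_nhds hq))
      (inter_mem (isOpen_ne.mem_nhds hpq.symm) (isOpen_ne.mem_nhds hqr)))
  have heq : ∀ x ∉ L, ∀ᶠ y in 𝓝 x, f y = u' y * u y := fun x hx => by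
    filter_upwards [hL.isClosed.isOpen_compl.mem_nhds hx] with y hy using hout y hy
  have hp : p ∉ L := fun h => (hLO h).2.1 rfl
  have hr : r ∉ L := fun h => (hLO h).2.2 rfl
  refine ⟨f, L ∪ (K ∪ K'), ⟨hL.union (h.compact.union h'.compact), ?_, fun x hx => ?_,
    fun x hxp hxr => ?_, fun x hxp hxr => ?_, ?_, ?_⟩, ?_⟩
  · exact union_subset (fun x hx => (hLO hx).1.2) (union_subset h.subset h'.subset)
  · simp only [mem_union, not_or] at hx
    rw [hout x hx.1, h.eq_one x hx.2.1, h'.eq_one x hx.2.2, one_mul]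
  · by_cases hxq : x = q
    · rwa [hxq]
    · exact hsm' x hxq ((h'.smooth x hxq hxr).complex_mul (h.smooth x hxp hxq))
  · by_cases hxq : x = q
    · rwa [hxq]
    · refine hn' x hxq ?_
      rw [norm_mul, h'.norm_eq_one x hxq hxr, h.norm_eq_one x hxp hxq, one_mul]
  · refine (h.angle.mul_hasPhase (h'.hasPhase hpq hpr)).congr ?_
    filter_upwards [nhdsWithin_le_nhds (heq p hp)] with x hx
    rw [hx, mul_comm]
  · refine (h'.angle_conj.mul_hasPhase (h.hasPhase hpr.symm hqr.symm).conj).congr ?_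
    filter_upwards [nhdsWithin_le_nhds (heq r hr)] with x hx
    rw [hx, map_mul]
  · exact union_subset (fun x hx => (hLO hx).1.1) (union_subset hK hK')

/-- The singularities of two opposite dipoles cancel. -/
theorem IsDipole.exists_mul [T2Space M] {Ω : SymplecticForm M} {u u' : M → ℂ} {K K' : Set M}
    {p q : M} (h : IsDipole Ω u K p q) (h' : IsDipole Ω u' K' q p) (hpq : p ≠ q)
    (hp : (𝓡∂ 2).IsInteriorPoint p) (hq : (𝓡∂ 2).IsInteriorPoint q) {N : Set M} (hNp : N ∈ 𝓝 p)
    (hNq : N ∈ 𝓝 q) : ∃ (f : M → ℂ) (L : Set M), ContMDiff (𝓡∂ 2) 𝓘(ℝ, ℂ) ∞ f ∧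
      (∀ x, ‖f x‖ = 1) ∧ IsCompact L ∧ L ⊆ (𝓡∂ 2).interior M ∧ (∀ x ∉ L, f x = 1) ∧
      ∀ x ∉ N, f x = u x * u' x := by
  have h₁ : HasPhase (fun x => u x * u' x) p := h.angle.hasPhase_mul hp h'.angle_conj
  obtain ⟨f₁, L₁, hL₁, hLO₁, hout₁, hsm₁, hn₁, hsm₁', hn₁'⟩ := h₁.exists_modification
    (inter_mem (inter_mem hNp (isOpen_interior_surface.mem_nhds hp)) (isOpen_ne.mem_nhds hpq))
  have hqL : q ∉ L₁ := fun h => (hLO₁ h).2 rfl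
  -- The repair at `p` was confined to a compact set missing `q`, so near `q` the function is still
  -- the product of the two dipoles.
  have h₂ : HasPhase f₁ q := by
    refine (h'.angle.hasPhase_mul hq h.angle_conj).congr ?_
    filter_upwards [nhdsWithin_le_nhds (hL₁.isClosed.isOpen_compl.mem_nhds hqL)] with x hx
    rw [hout₁ x hx, mul_comm]
  obtain ⟨f₂, L₂, hL₂, hLO₂, hout₂, hsm₂, hn₂, hsm₂', hn₂'⟩ := h₂.exists_modification
    (inter_mem (inter_mem hNq (isOpen_interior_surface.mem_nhds hq)) (isOpen_ne.mem_nhds hpq.symm))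
  refine ⟨f₂, L₁ ∪ L₂ ∪ (K ∪ K'), fun x => ?_, fun x => ?_,
    (hL₁.union hL₂).union (h.compact.union h'.compact), ?_, fun x hx => ?_, fun x hx => ?_⟩
  · by_cases hxq : x = q
    · rwa [hxq]
    refine hsm₂' x hxq ?_
    by_cases hxp : x = p
    · rwa [hxp]
    exact hsm₁' x hxp ((h.smooth x hxp hxq).complex_mul (h'.smooth x hxq hxp))
  · by_cases hxq : x = q
    · rwa [hxq]
    refine hn₂' x hxq ?_
    by_cases hxp : x = p
    · rwa [hxp]
    refine hn₁' x hxp ?_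
    rw [norm_mul, h'.norm_eq_one x hxq hxp, h.norm_eq_one x hxp hxq, one_mul]
  · exact union_subset (union_subset (fun x hx => (hLO₁ hx).1.2) fun x hx => (hLO₂ hx).1.2)
      (union_subset h.subset h'.subset)
  · simp only [mem_union, not_or] at hx
    rw [hout₂ x hx.1.2, hout₁ x hx.1.1, h.eq_one x hx.2.1, h'.eq_one x hx.2.2, one_mul]
  · rw [hout₂ x fun h => hx (hLO₂ h).1.1, hout₁ x fun h => hx (hLO₁ h).1.1]

end SymplecticSurface

/-! ### Dipoles in charts and chains of dipoles -/

namespace SymplecticSurface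

open Set Filter Topology

variable {M : Type*} [TopologicalSpace M] [ChartedSpace (EuclideanHalfSpace 2) M]
  [IsManifold (𝓡∂ 2) ∞ M]

/-- A convex open set `C` in the plane which parametrizes, through the chart around `x₀` and a
linear isomorphism `j`, an open subset of `O` in the interior of the surface, compatibly with the
orientations. -/
structure IsChartDisc (Ω : SymplecticForm M) (x₀ : M) (O : Set M)
    (j : EuclideanSpace ℝ (Fin 2) ≃L[ℝ] ℂ) (C : Set ℂ) : Prop where
  isOpen : IsOpen C
  convex : Convex ℝ C
  mem_target : ∀ ζ ∈ C, j.symm ζ ∈ interior (extChartAt (𝓡∂ 2) x₀).target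
  mem : ∀ ζ ∈ C, (extChartAt (𝓡∂ 2) x₀).symm (j.symm ζ) ∈ O
  oriented : ∀ ζ ∈ C, ∃ a > 0, ∀ v w : EuclideanSpace ℝ (Fin 2),
    Ω.form ((extChartAt (𝓡∂ 2) x₀).symm (j.symm ζ)) (chartField x₀ v _) (chartField x₀ w _) =
      a * (starRingEnd ℂ (j v) * j w).im

/-- The standard identification, followed by conjugation when `b < 0`, works for every area density
of the same sign as `b`. -/
theorem exists_orientedEquiv {b : ℝ} (hb : b ≠ 0) : ∃ j : EuclideanSpace ℝ (Fin 2) ≃L[ℝ] ℂ,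
    ∀ b', 0 < b * b' → ∃ a > 0, ∀ v w : EuclideanSpace ℝ (Fin 2),
      b' * (v 0 * w 1 - v 1 * w 0) = a * (starRingEnd ℂ (j v) * j w).im := by
  let e : EuclideanSpace ℝ (Fin 2) ≃L[ℝ] ℂ :=
    Complex.orthonormalBasisOneI.repr.symm.toContinuousLinearEquiv
  have he : ∀ v, e v = v 0 + v 1 * Complex.I := fun v => by
    simp [e, Complex.orthonormalBasisOneI_repr_symm_apply]
  rcases hb.lt_or_gt with hb | hb
  · refine ⟨e.trans Complex.conjCLE, fun b' h => ⟨-b', by nlinarith, fun v w => ?_⟩⟩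
    simp [he, -mul_eq_mul_left_iff]
    ring
  · refine ⟨e, fun b' h => ⟨b', by nlinarith, fun v w => ?_⟩⟩
    simp [he, -mul_eq_mul_left_iff]
    ring

/-- The disc is a small ball intersected with the interior of the model half-plane. It stays convex
and nonempty even when `x₀` is a boundary point, and it contains the images of all interior points
close to `x₀`. -/
theorem exists_isChartDisc (Ω : SymplecticForm M) (x₀ : M) {O : Set M} (hO : O ∈ 𝓝 x₀) :
    ∃ j C, IsChartDisc Ω x₀ O j C ∧ C.Nonempty ∧
      ∀ᶠ x in 𝓝 x₀, x ∈ (extChartAt (𝓡∂ 2) x₀).source ∧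
        ((𝓡∂ 2).IsInteriorPoint x → j (extChartAt (𝓡∂ 2) x₀ x) ∈ C) := by
  set φ := extChartAt (𝓡∂ 2) x₀ with hφ
  have hb := areaDensity_ne_zero Ω x₀ (mem_chart_source (EuclideanHalfSpace 2) x₀)
  obtain ⟨j, hj⟩ := exists_orientedEquiv hb
  have hsign : ∀ᶠ x in 𝓝 x₀, 0 < areaDensity Ω x₀ x₀ * areaDensity Ω x₀ x :=
    (continuousAt_const.mul (contMDiffAt_areaDensity Ω x₀).continuousAt).eventually
      (lt_mem_nhds (mul_self_pos.2 hb))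
  have hpre : φ.symm ⁻¹' (O ∩ {x | 0 < areaDensity Ω x₀ x₀ * areaDensity Ω x₀ x}) ∈ 𝓝 (φ x₀) :=
    extChartAt_preimage_mem_nhds (inter_mem hO hsign)
  obtain ⟨V, hV, hVt⟩ := mem_nhdsWithin_iff_exists_mem_nhds_inter.1
    (extChartAt_target_mem_nhdsWithin (I := 𝓡∂ 2) x₀)
  obtain ⟨r, hr, hball⟩ := Metric.mem_nhds_iff.1 (inter_mem hpre hV)
  set B := Metric.ball (φ x₀) r ∩ interior (range (𝓡∂ 2)) with hB
  have hBo : IsOpen B := Metric.isOpen_ball.inter isOpen_interior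
  have hBt : B ⊆ interior φ.target := interior_maximal
    (fun y hy => hVt ⟨(hball hy.1).2, interior_subset hy.2⟩) hBo
  refine ⟨j, j.symm ⁻¹' B, ⟨hBo.preimage j.symm.continuous, ?_, fun ζ hζ => hBt hζ,
    fun ζ hζ => (hball hζ.1).1.1, fun ζ hζ => ?_⟩, ?_, ?_⟩
  · exact Convex.linear_preimage (𝕜 := ℝ) ((convex_ball _ _).inter (𝓡∂ 2).convex_range.interior)
      (j.symm : ℂ →ₗ[ℝ] EuclideanSpace ℝ (Fin 2))
  · obtain ⟨a, ha, h⟩ := hj _ (hball hζ.1).1.2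
    exact ⟨a, ha, fun v w => by rw [form_chartField, h]⟩
  · obtain ⟨y, hy⟩ := mem_closure_iff_nhds.1 ((𝓡∂ 2).range_subset_closure_interior
      (mem_range_self (chartAt (EuclideanHalfSpace 2) x₀ x₀))) _ (Metric.ball_mem_nhds _ hr)
    exact ⟨j y, by rwa [mem_preimage, j.symm_apply_apply]⟩
  · filter_upwards [extChartAt_source_mem_nhds (I := 𝓡∂ 2) x₀,
      (continuousAt_extChartAt (I := 𝓡∂ 2) x₀).eventually (Metric.ball_mem_nhds _ hr)] with x h₁ h₂
    refine ⟨h₁, fun hx => ?_⟩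
    rw [mem_preimage, j.symm_apply_apply]
    exact ⟨h₂, interior_mono (extChartAt_target_subset_range x₀)
      ((isInteriorPoint_iff_extChartAt h₁).1 hx)⟩

section

variable {Ω : SymplecticForm M} {x₀ : M} {O : Set M} {j : EuclideanSpace ℝ (Fin 2) ≃L[ℝ] ℂ}
  {C : Set ℂ}

theorem IsChartDisc.symm_mem_source (h : IsChartDisc Ω x₀ O j C) {ζ : ℂ} (hζ : ζ ∈ C) :
    (extChartAt (𝓡∂ 2) x₀).symm (j.symm ζ) ∈ (extChartAt (𝓡∂ 2) x₀).source :=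
  (extChartAt (𝓡∂ 2) x₀).map_target (interior_subset (h.mem_target ζ hζ))

theorem IsChartDisc.apply_symm (h : IsChartDisc Ω x₀ O j C) {ζ : ℂ} (hζ : ζ ∈ C) :
    j (extChartAt (𝓡∂ 2) x₀ ((extChartAt (𝓡∂ 2) x₀).symm (j.symm ζ))) = ζ := by
  rw [(extChartAt (𝓡∂ 2) x₀).right_inv (interior_subset (h.mem_target ζ hζ)), j.apply_symm_apply]

theorem IsChartDisc.isInteriorPoint (h : IsChartDisc Ω x₀ O j C) {ζ : ℂ} (hζ : ζ ∈ C) :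
    (𝓡∂ 2).IsInteriorPoint ((extChartAt (𝓡∂ 2) x₀).symm (j.symm ζ)) := by
  rw [isInteriorPoint_iff_extChartAt (h.symm_mem_source hζ),
    (extChartAt (𝓡∂ 2) x₀).right_inv (interior_subset (h.mem_target ζ hζ))]
  exact h.mem_target ζ hζ

/-- At `p` the Möbius function `(ζ - p) / (ζ - q)` has the nonzero complex derivative `κ = (p -
q)⁻¹`. Multiplication by `κ` scales areas by `normSq κ > 0`, so the orientation is kept. -/
theorem IsChartDisc.isOrientedCoordinate (h : IsChartDisc Ω x₀ O j C) {p q : ℂ} (hp : p ∈ C)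
    (hpq : p ≠ q) : IsOrientedCoordinate Ω
      (fun x => (j (extChartAt (𝓡∂ 2) x₀ x) - p) / (j (extChartAt (𝓡∂ 2) x₀ x) - q))
      ((extChartAt (𝓡∂ 2) x₀).symm (j.symm p)) := by
  have hs := h.symm_mem_source hp
  set P := (extChartAt (𝓡∂ 2) x₀).symm (j.symm p) with hP
  have hjP : j (extChartAt (𝓡∂ 2) x₀ P) = p := h.apply_symm hp
  have hsub : p - q ≠ 0 := sub_ne_zero.2 hpq
  have hsm : ∀ x ∈ (extChartAt (𝓡∂ 2) x₀).source,
      ContMDiffAt (𝓡∂ 2) 𝓘(ℝ, ℂ) ∞ (fun x => j (extChartAt (𝓡∂ 2) x₀ x)) x := fun x hx =>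
    ContMDiffAt.comp (g := j) (f := extChartAt (𝓡∂ 2) x₀) x
      j.contDiff.contMDiff.contMDiffAt (contMDiffAt_extChartAt' (by simpa using hx))
  refine ⟨?_, ?_, ?_⟩
  · have hne : ∀ᶠ x in 𝓝 P, j (extChartAt (𝓡∂ 2) x₀ x) ≠ q :=
      (hsm P hs).continuousAt.eventually_ne (by rwa [hjP])
    filter_upwards [(isOpen_extChartAt_source (I := 𝓡∂ 2) x₀).mem_nhds hs, hne] with x h₁ h₂
    exact ((hsm x h₁).sub contMDiffAt_const).complex_div ((hsm x h₁).sub contMDiffAt_const)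
      (sub_ne_zero.2 h₂)
  · beta_reduce
    rw [hjP, sub_self, zero_div]
  · have hder : HasDerivAt (fun ζ : ℂ => (ζ - p) / (ζ - q)) (p - q)⁻¹ p := by
      have := ((hasDerivAt_id p).sub_const p).div ((hasDerivAt_id p).sub_const q) hsub
      refine this.congr_deriv ?_
      simp only [id, one_mul, mul_one, sub_self, sub_zero]
      field_simp
    set κ := (p - q)⁻¹ with hκ
    have hκ0 : 0 < Complex.normSq κ := Complex.normSq_pos.2 (inv_ne_zero hsub)
    have hder' : HasFDerivAt (fun ζ : ℂ => (ζ - p) / (ζ - q))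
        (ContinuousLinearMap.mul ℝ ℂ κ) p := by
      refine (hder.hasFDerivAt.restrictScalars ℝ).congr_fderiv ?_
      ext1
      simp [mul_comm]
    set A : EuclideanSpace ℝ (Fin 2) →L[ℝ] EuclideanSpace ℝ (Fin 2) :=
      mfderiv (𝓡∂ 2) 𝓘(ℝ, EuclideanSpace ℝ (Fin 2)) (extChartAt (𝓡∂ 2) x₀) P with hA
    have hφ : HasMFDerivAt (𝓡∂ 2) 𝓘(ℝ, EuclideanSpace ℝ (Fin 2)) (extChartAt (𝓡∂ 2) x₀) P A :=
      ((contMDiffAt_extChartAt' (n := ∞) (by simpa using hs)).mdifferentiableAt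
        (by simp)).hasMFDerivAt
    have hder'' : HasFDerivAt (fun y => (j y - p) / (j y - q))
        ((ContinuousLinearMap.mul ℝ ℂ κ) ∘L (j : EuclideanSpace ℝ (Fin 2) →L[ℝ] ℂ))
        (extChartAt (𝓡∂ 2) x₀ P) := by
      have h1 : HasFDerivAt (fun ζ : ℂ => (ζ - p) / (ζ - q)) (ContinuousLinearMap.mul ℝ ℂ κ)
        (j (extChartAt (𝓡∂ 2) x₀ P)) := by rwa [hjP]
      exact h1.comp _ j.hasFDerivAt
    refine ⟨((ContinuousLinearMap.mul ℝ ℂ κ) ∘L (j : EuclideanSpace ℝ (Fin 2) →L[ℝ] ℂ)) ∘L A,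
      HasMFDerivAt.comp P hder''.hasMFDerivAt hφ, ?_⟩
    obtain ⟨a, ha, hform⟩ := h.oriented p hp
    refine ⟨a / Complex.normSq κ, div_pos ha hκ0, fun v w => ?_⟩
    obtain ⟨v', hv'⟩ := exists_chartField_eq x₀ (by simpa using hs) (x := P) v
    obtain ⟨w', hw'⟩ := exists_chartField_eq x₀ (by simpa using hs) (x := P) w
    have hAv : A v = v' := by
      rw [← hv']
      exact mfderiv_extChartAt_chartField x₀ v' (by simpa using hs)
    have hAw : A w = w' := by
      rw [← hw']
      exact mfderiv_extChartAt_chartField x₀ w' (by simpa using hs)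
    have h1 : Ω.form P v w = a * (starRingEnd ℂ (j v') * j w').im := by
      rw [← hv', ← hw']
      exact hform v' w'
    rw [h1]
    simp only [ContinuousLinearMap.comp_apply, hAv, hAw, ContinuousLinearMap.mul_apply',
      ContinuousLinearEquiv.coe_coe, map_mul]
    have h2 : starRingEnd ℂ κ * starRingEnd ℂ (j v') * (κ * j w') =
        (Complex.normSq κ : ℂ) * (starRingEnd ℂ (j v') * j w') := by
      rw [Complex.normSq_eq_conj_mul_self]
      ring
    rw [h2, Complex.im_ofReal_mul]
    field_simp

open scoped Classical in
/-- The planar dipole, transplanted to the surface by the chart around `x₀`. -/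
noncomputable def chartDipole (x₀ : M) (j : EuclideanSpace ℝ (Fin 2) ≃L[ℝ] ℂ) (p q : ℂ) (χ : ℂ → ℝ)
    (x : M) : ℂ :=
  if x ∈ (extChartAt (𝓡∂ 2) x₀).source then dipoleFun p q χ (j (extChartAt (𝓡∂ 2) x₀ x)) else 1

theorem chartDipole_of_mem {j : EuclideanSpace ℝ (Fin 2) ≃L[ℝ] ℂ} {p q : ℂ} {χ : ℂ → ℝ} {x : M}
    (hx : x ∈ (extChartAt (𝓡∂ 2) x₀).source) :
    chartDipole x₀ j p q χ x = dipoleFun p q χ (j (extChartAt (𝓡∂ 2) x₀ x)) := if_pos hx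

/-- Near `p`, where `χ = 0`, the function is exactly the angle of the coordinate `(ζ - p) / (ζ -
q)`. Near `q` its conjugate is the angle of the inverse quotient. The required phases are therefore
zero. -/
theorem IsChartDisc.isDipole [T2Space M] (h : IsChartDisc Ω x₀ O j C) {p q : ℂ} (hp : p ∈ C)
    (hq : q ∈ C) (hpq : p ≠ q) {χ : ℂ → ℝ} {K : Set ℂ} (hχ : ContDiff ℝ ∞ χ) (hK : IsCompact K)
    (hKC : K ⊆ C) (h1 : ∀ z ∉ K, χ z = 1) (h0 : ∀ z ∈ segment ℝ p q, ∀ᶠ z' in 𝓝 z, χ z' = 0) :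
    IsDipole Ω (chartDipole x₀ j p q χ) ((fun ζ => (extChartAt (𝓡∂ 2) x₀).symm (j.symm ζ)) '' K)
      ((extChartAt (𝓡∂ 2) x₀).symm (j.symm p)) ((extChartAt (𝓡∂ 2) x₀).symm (j.symm q)) := by
  set φ := extChartAt (𝓡∂ 2) x₀ with hφ
  set ψ : ℂ → M := fun ζ => φ.symm (j.symm ζ) with hψ
  have hψφ : ∀ x ∈ φ.source, ψ (j (φ x)) = x := fun x hx => by
    simp only [hψ, j.symm_apply_apply]
    exact φ.left_inv hx
  have hψC : ∀ ζ ∈ C, ψ ζ ∈ φ.source := fun ζ hζ => h.symm_mem_source hζ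
  have hφψ : ∀ ζ ∈ C, j (φ (ψ ζ)) = ζ := fun ζ hζ => h.apply_symm hζ
  have hpK : p ∈ K := by
    by_contra hcon
    exact zero_ne_one ((h0 p (left_mem_segment ℝ p q)).self_of_nhds.symm.trans (h1 p hcon))
  have hqK : q ∈ K := by
    by_contra hcon
    exact zero_ne_one ((h0 q (right_mem_segment ℝ p q)).self_of_nhds.symm.trans (h1 q hcon))
  have hcomp : IsCompact (ψ '' K) := hK.image_of_continuousOn
    ((continuousOn_extChartAt_symm x₀).comp j.symm.continuous.continuousOn
      fun ζ hζ => interior_subset (h.mem_target ζ (hKC hζ)))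
  have hone : ∀ x ∉ ψ '' K, chartDipole x₀ j p q χ x = 1 := fun x hx => by
    by_cases hxs : x ∈ φ.source
    · have hζ : j (φ x) ∉ K := fun hcon => hx ⟨_, hcon, hψφ x hxs⟩
      rw [chartDipole_of_mem hxs, dipoleFun_eq_exp χ (fun hcon => hζ (by rwa [hcon]))
        (fun hcon => hζ (by rwa [hcon])), h1 _ hζ]
      simp
    · exact if_neg hxs
  have hcont : ∀ ζ ∈ C, Tendsto (fun x => j (φ x)) (𝓝 (ψ ζ)) (𝓝 ζ) := fun ζ hζ => by
    have := (j.continuous.continuousAt.comp (continuousAt_extChartAt' (hψC ζ hζ))).tendsto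
    rwa [show (j ∘ extChartAt (𝓡∂ 2) x₀) (ψ ζ) = ζ from hφψ ζ hζ] at this
  have hnear : ∀ ζ ∈ C, ∀ᶠ x in 𝓝 (ψ ζ), x ∈ φ.source := fun ζ hζ =>
    (isOpen_extChartAt_source (I := 𝓡∂ 2) x₀).mem_nhds (hψC ζ hζ)
  have hne : ∀ ζ, ∀ x ∈ φ.source, x ≠ ψ ζ → j (φ x) ≠ ζ := fun ζ x hx hxζ hcon =>
    hxζ (by rw [← hcon, hψφ x hx])
  refine ⟨hcomp, ?_, hone, fun x hxp hxq => ?_, fun x hxp hxq => ?_,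
    ⟨_, h.isOrientedCoordinate hp hpq, fun _ => 0, ?_⟩,
    ⟨_, h.isOrientedCoordinate hq hpq.symm, fun _ => 0, ?_⟩⟩
  · rintro _ ⟨ζ, hζ, rfl⟩
    exact h.isInteriorPoint (hKC hζ)
  · by_cases hx : x ∈ ψ '' K
    · obtain ⟨ζ, hζ, rfl⟩ := hx
      have hs := hψC ζ (hKC hζ)
      have hd : ContDiffAt ℝ ∞ (fun y => dipoleFun p q χ (j y)) (φ (ψ ζ)) :=
        (contDiffAt_dipoleFun hχ h0 (hne p _ hs hxp) (hne q _ hs hxq)).comp (φ (ψ ζ))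
          j.contDiff.contDiffAt
      refine ContMDiffAt.congr_of_eventuallyEq (ContMDiffAt.comp
        (g := fun y => dipoleFun p q χ (j y)) (f := φ) _ hd.contMDiffAt
        (contMDiffAt_extChartAt' (by simpa [hφ] using hs))) ?_
      filter_upwards [hnear ζ (hKC hζ)] with y hy
      exact chartDipole_of_mem hy
    · refine (contMDiffAt_const (c := (1 : ℂ))).congr_of_eventuallyEq ?_
      filter_upwards [hcomp.isClosed.isOpen_compl.mem_nhds hx] with y hy
      exact hone y hy
  · by_cases hxs : x ∈ φ.source
    · rw [chartDipole_of_mem hxs, norm_dipoleFun χ (hne p _ hxs hxp) (hne q _ hxs hxq)]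
    · rw [chartDipole, if_neg hxs, norm_one]
  · filter_upwards [self_mem_nhdsWithin, nhdsWithin_le_nhds (hnear p hp),
      nhdsWithin_le_nhds ((hcont p hp).eventually (h0 p (left_mem_segment ℝ p q))),
      nhdsWithin_le_nhds ((hcont p hp).eventually_ne hpq)] with x h₁ h₂ h₃ h₄
    refine ⟨contMDiffAt_const, ?_⟩
    have h₅ : (j (φ x) - p) / (j (φ x) - q) ≠ 0 :=
      div_ne_zero (sub_ne_zero.2 (hne p x h₂ h₁)) (sub_ne_zero.2 h₄)
    rw [chartDipole_of_mem h₂, dipoleFun, h₃]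
    have h₆ := conj_mul_self_of_norm_eq_one
      (z := (j (φ x) - p) / (j (φ x) - q) / (‖(j (φ x) - p) / (j (φ x) - q)‖ : ℂ))
      (by rw [norm_div, Complex.norm_real, norm_norm, div_self (norm_ne_zero_iff.2 h₅)])
    simp only [zero_mul, neg_zero, Complex.ofReal_zero, Complex.exp_zero, mul_one]
    rw [mul_comm, h₆]
  · filter_upwards [self_mem_nhdsWithin, nhdsWithin_le_nhds (hnear q hq),
      nhdsWithin_le_nhds ((hcont q hq).eventually (h0 q (right_mem_segment ℝ p q))),
      nhdsWithin_le_nhds ((hcont q hq).eventually_ne hpq.symm)] with x h₁ h₂ h₃ h₄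
    refine ⟨contMDiffAt_const, ?_⟩
    have h₅ : (j (φ x) - p) / (j (φ x) - q) ≠ 0 :=
      div_ne_zero (sub_ne_zero.2 h₄) (sub_ne_zero.2 (hne q x h₂ h₁))
    rw [chartDipole_of_mem h₂, dipoleFun, h₃, ← map_mul, ← inv_div (j (φ x) - p) (j (φ x) - q),
      norm_inv]
    have h₆ : (‖(j (φ x) - p) / (j (φ x) - q)‖ : ℂ) ≠ 0 := by
      exact_mod_cast norm_ne_zero_iff.2 h₅
    generalize (j (φ x) - p) / (j (φ x) - q) = w at h₅ h₆ ⊢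
    have h₇ : w / (‖w‖ : ℂ) * Complex.exp ((-(0 * w.arg) : ℝ) * Complex.I) *
        (w⁻¹ / ((‖w‖⁻¹ : ℝ) : ℂ)) = 1 := by
      push_cast
      simp only [zero_mul, neg_zero, Complex.exp_zero, mul_one]
      field_simp
    rw [h₇]
    simp

end

theorem dense_interior_surface (Ω : SymplecticForm M) : Dense ((𝓡∂ 2).interior M) := by
  intro x
  refine mem_closure_iff_nhds.2 fun O hO => ?_
  obtain ⟨j, C, h, ⟨ζ, hζ⟩, -⟩ := exists_isChartDisc Ω x hO
  exact ⟨_, h.mem ζ hζ, h.isInteriorPoint hζ⟩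

/-- Two nearby points in the interior are joined by a dipole. -/
theorem exists_isDipole_local [T2Space M] (Ω : SymplecticForm M) {N : Set M} {x₀ : M}
    (hN : N ∈ 𝓝 x₀) : ∃ U ∈ 𝓝 x₀, ∀ p ∈ U ∩ (𝓡∂ 2).interior M, ∀ q ∈ U ∩ (𝓡∂ 2).interior M,
      p ≠ q → ∃ u K, IsDipole Ω u K p q ∧ K ⊆ N := by
  obtain ⟨j, C, h, -, hev⟩ := exists_isChartDisc Ω x₀ hN
  refine ⟨_, hev, fun p hp q hq hpq => ?_⟩
  have hinv : ∀ x ∈ (extChartAt (𝓡∂ 2) x₀).source, (extChartAt (𝓡∂ 2) x₀).symm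
      (j.symm (j (extChartAt (𝓡∂ 2) x₀ x))) = x := fun x hx => by
    rw [j.symm_apply_apply, (extChartAt (𝓡∂ 2) x₀).left_inv hx]
  have hpC := hp.1.2 hp.2
  have hqC := hq.1.2 hq.2
  obtain ⟨χ, K, hχ, hK, hKC, h1, h0⟩ := exists_cutoff_segment h.isOpen
    (h.convex.segment_subset hpC hqC)
  have hd := h.isDipole hpC hqC (fun heq => hpq (by rw [← hinv p hp.1.1, heq, hinv q hq.1.1]))
    hχ hK hKC h1 h0
  rw [hinv p hp.1.1, hinv q hq.1.1] at hd
  refine ⟨_, _, hd, ?_⟩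
  rintro _ ⟨ζ, hζ, rfl⟩
  exact h.mem ζ (hKC hζ)

/-- Any two interior points in a connected open set are joined by a dipole in that set. -/
theorem exists_isDipole [T2Space M] (Ω : SymplecticForm M) {N : Set M} (hN : IsOpen N)
    (hc : IsPreconnected N) {p q : M} (hp : p ∈ N) (hq : q ∈ N) (hpi : (𝓡∂ 2).IsInteriorPoint p)
    (hqi : (𝓡∂ 2).IsInteriorPoint q) (hpq : p ≠ q) : ∃ u K, IsDipole Ω u K p q ∧ K ⊆ N := by
  let Q : M → M → Prop := fun x y => x ≠ y → ∃ u K, IsDipole Ω u K x y ∧ K ⊆ N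
  -- The induction passes through all points of `N`, including boundary points, where no dipole can
  -- end. So the relation speaks of all interior points near `x` and `y`; transitivity uses an
  -- auxiliary interior point near the middle one, found by density.
  let P : M → M → Prop := fun x y => ∃ U ∈ 𝓝 x, ∃ V ∈ 𝓝 y, ∀ x' ∈ U ∩ (𝓡∂ 2).interior M,
    ∀ y' ∈ V ∩ (𝓡∂ 2).interior M, Q x' y'
  have hP : P p q := by
    refine hc.induction₂ P (fun x hx => ?_) (fun x y z hx hy hz hxy hyz => ?_)
      (fun x y hx hy hxy => ?_) hp hq
    · obtain ⟨U, hU, h⟩ := exists_isDipole_local Ω (hN.mem_nhds hx)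
      filter_upwards [nhdsWithin_le_nhds (eventually_mem_nhds_iff.2 hU)] with y hy
      exact ⟨U, hU, U, hy, h⟩
    · obtain ⟨U, hU, V, hV, h⟩ := hxy
      obtain ⟨V', hV', W, hW, h'⟩ := hyz
      refine ⟨U, hU, W, hW, fun x' hx' z' hz' hne => ?_⟩
      obtain ⟨y', hy', hyi⟩ := (dense_interior_surface Ω).inter_nhds_nonempty
        (inter_mem (inter_mem hV hV') (hN.mem_nhds hy))
      by_cases hxy : x' = y'
      · exact hxy ▸ h' y' ⟨hyi.1.2, hy'⟩ z' hz' (hxy ▸ hne)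
      by_cases hyz : y' = z'
      · exact hyz ▸ h x' hx' y' ⟨hyi.1.1, hy'⟩ hxy
      obtain ⟨u, K, hu, hK⟩ := h x' hx' y' ⟨hyi.1.1, hy'⟩ hxy
      obtain ⟨u', K', hu', hK'⟩ := h' y' ⟨hyi.1.2, hy'⟩ z' hz' hyz
      exact hu.trans hu' hxy hyz hne hy' (hN.mem_nhds hyi.2) hK hK'
    · obtain ⟨U, hU, V, hV, h⟩ := hxy
      refine ⟨V, hV, U, hU, fun y' hy' x' hx' hne => ?_⟩
      obtain ⟨u, K, hu, hK⟩ := h x' hx' y' hy' hne.symm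
      exact ⟨_, K, hu.conj, hK⟩
  obtain ⟨U, hU, V, hV, h⟩ := hP
  exact h p ⟨mem_of_mem_nhds hU, hpi⟩ q ⟨mem_of_mem_nhds hV, hqi⟩ hpq

end SymplecticSurface

/-! ### Degree of a loop whose angle jumps once, and regularity of the curve in charts -/

namespace SymplecticSurface

open Set Filter Topology

section Lift

theorem exists_int_eq_of_coe_unitAngle_eq {a b : ℝ} (h : (unitAngle a : ℂ) = unitAngle b) :
    ∃ n : ℤ, a - b = n := by
  obtain ⟨n, hn⟩ := unitAngle_eq_unitAngle_iff.1 (Circle.coe_injective h)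
  exact ⟨n, by rw [hn]; ring⟩

/-- A loop in the unit circle which has, on the interval `(0, 1)`, a continuous angle that increases
by one, has degree one. -/
theorem exists_lift_of_angle {w : ℝ → ℂ} (hw : ContDiff ℝ 1 w) (h1 : ∀ θ, ‖w θ‖ = 1)
    (hper : ∀ θ, w (θ + 1) = w θ) {G : ℝ → ℝ} (hG : ContinuousOn G (Ioo 0 1))
    (hwG : ∀ θ ∈ Ioo (0 : ℝ) 1, w θ = unitAngle (G θ)) {a : ℝ} (h₀ : Tendsto G (𝓝[>] 0) (𝓝 a))
    (h₁ : Tendsto G (𝓝[<] 1) (𝓝 (a + 1))) :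
    ∃ h : ℝ → ℝ, Continuous h ∧ (∀ θ, w θ = unitAngle (h θ)) ∧ ∀ θ, h (θ + 1) = h θ + 1 := by
  obtain ⟨b, hb⟩ := unitAngle_surjective ⟨w 0, by simpa [Submonoid.unitSphere] using h1 0⟩
  have hb' : (unitAngle b : ℂ) = w 0 := congrArg (fun z : Circle => (z : ℂ)) hb
  set h : ℝ → ℝ := fun θ => b + ∫ η in (0 : ℝ)..θ, turnRate w η with hh
  have hc : Continuous h := continuous_const.add (intervalIntegral.continuous_primitive
    (fun a b => (continuous_turnRate hw).intervalIntegrable a b) 0)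
  have hwh : ∀ θ, w θ = unitAngle (h θ) := fun θ => by
    rw [eq_mul_exp_integral_turnRate hw h1 θ, ← hb', hh, coe_unitAngle_add,
      coe_unitAngle (∫ η in (0 : ℝ)..θ, turnRate w η)]
  -- Two continuous angles differ by a constant on `(0, 1)`. The one-sided limits of `G` at the ends
  -- then give `h 1 - h 0 = 1`.
  have hmem : ∀ {x : ℝ}, x ∈ Ioo (0 : ℝ) 1 → h x - G x = h (1 / 2) - G (1 / 2) := fun hx =>
    eq_of_continuousOn_of_forall_exists_int isPreconnected_Ioo (f := fun x => h x - G x)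
      (hc.continuousOn.sub hG) (fun θ hθ => exists_int_eq_of_coe_unitAngle_eq
        ((hwh θ).symm.trans (hwG θ hθ))) hx (by norm_num)
  have hlim₀ : h 0 - a = h (1 / 2) - G (1 / 2) := by
    refine tendsto_nhds_unique (((hc.tendsto 0).mono_left nhdsWithin_le_nhds).sub h₀)
      (tendsto_const_nhds.congr' ?_)
    filter_upwards [Ioo_mem_nhdsGT (zero_lt_one' ℝ)] with x hx
    exact (hmem hx).symm
  have hlim₁ : h 1 - (a + 1) = h (1 / 2) - G (1 / 2) := by
    refine tendsto_nhds_unique (((hc.tendsto 1).mono_left nhdsWithin_le_nhds).sub h₁)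
      (tendsto_const_nhds.congr' ?_)
    filter_upwards [Ioo_mem_nhdsLT (zero_lt_one' ℝ)] with x hx
    exact (hmem hx).symm
  refine ⟨h, hc, hwh, fun θ => ?_⟩
  have h2 := eq_of_continuousOn_of_forall_exists_int isPreconnected_univ
    (f := fun θ => h (θ + 1) - h θ)
    ((hc.comp (continuous_id.add continuous_const)).sub hc).continuousOn
    (fun θ _ => exists_int_eq_of_coe_unitAngle_eq
      (by rw [← hwh, ← hwh, hper])) (mem_univ θ) (mem_univ 0)
  simp only [zero_add] at h2
  linarith

end Lift

section Plane

theorem im_sub_div_add (ρ : ℂ) (δ : ℝ) :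
    ((ρ - δ * Complex.I) / (ρ + δ * Complex.I)).im =
      -(2 * δ * ρ.re) / Complex.normSq (ρ + δ * Complex.I) := by
  rw [Complex.div_im]
  simp
  ring

/-- The angle of `(ρ - i δ) / (ρ + i δ)` jumps from `π` to `-π` where `ρ` crosses the imaginary
axis at `0` to the right. -/
theorem tendsto_arg_sub_div_add {ρ : ℝ → ℂ} (hρ : Tendsto ρ (𝓝 0) (𝓝 0)) {δ : ℝ} (hδ : 0 < δ)
    (hpos : ∀ᶠ θ in 𝓝[>] 0, 0 < (ρ θ).re) (hneg : ∀ᶠ θ in 𝓝[<] 0, (ρ θ).re < 0) :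
    Tendsto (fun θ => ((ρ θ - δ * Complex.I) / (ρ θ + δ * Complex.I)).arg) (𝓝[>] 0)
      (𝓝 (-Real.pi)) ∧
    Tendsto (fun θ => ((ρ θ - δ * Complex.I) / (ρ θ + δ * Complex.I)).arg) (𝓝[<] 0)
      (𝓝 Real.pi) := by
  have hδI : (δ * Complex.I : ℂ) ≠ 0 := by simp [hδ.ne']
  -- The quotient tends to `-1`, on the cut of `arg`. Its imaginary part has the sign opposite to
  -- `re ρ`, which decides between the limits `-π` and `π`.
  have hlim : Tendsto (fun θ => (ρ θ - δ * Complex.I) / (ρ θ + δ * Complex.I)) (𝓝 0) (𝓝 (-1)) := by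
    have := (hρ.sub_const (δ * Complex.I)).div (hρ.add_const (δ * Complex.I)) (by simpa using hδI)
    rwa [zero_sub, zero_add, neg_div, div_self hδI] at this
  have hne : ∀ᶠ θ in 𝓝 0, ρ θ + δ * Complex.I ≠ 0 :=
    (hρ.add_const (δ * Complex.I)).eventually_ne (by simpa using hδI)
  constructor
  · refine (Complex.tendsto_arg_nhdsWithin_im_neg_of_re_neg_of_im_zero (z := -1) (by simp)
      (by simp)).comp (tendsto_nhdsWithin_iff.2 ⟨hlim.mono_left nhdsWithin_le_nhds, ?_⟩)
    filter_upwards [hpos, nhdsWithin_le_nhds hne] with θ h₁ h₂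
    rw [im_sub_div_add]
    exact div_neg_of_neg_of_pos (by nlinarith [mul_pos hδ h₁]) (Complex.normSq_pos.2 h₂)
  · refine (Complex.tendsto_arg_nhdsWithin_im_nonneg_of_re_neg_of_im_zero (z := -1) (by simp)
      (by simp)).comp (tendsto_nhdsWithin_iff.2 ⟨hlim.mono_left nhdsWithin_le_nhds, ?_⟩)
    filter_upwards [hneg] with θ h₁
    rw [im_sub_div_add]
    exact div_nonneg (by nlinarith [mul_neg_of_pos_of_neg hδ h₁]) (Complex.normSq_nonneg _)

theorem hasDerivAt_coe_unitAngle (θ : ℝ) : HasDerivAt (fun θ : ℝ => (unitAngle θ : ℂ))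
    (unitAngle θ * (2 * Real.pi * Complex.I)) θ := by
  simp only [coe_unitAngle]
  have := ((Complex.ofRealCLM.hasDerivAt (x := θ)).const_mul (2 * Real.pi * Complex.I)).cexp
  simpa using this

end Plane

variable {M : Type*} [TopologicalSpace M] [ChartedSpace (EuclideanHalfSpace 2) M]
  [IsManifold (𝓡∂ 2) ∞ M]

/-- Composition with the inclusion of the circle in `ℂ` is an exponential, with explicit nonzero
derivative. -/
theorem mfderiv_unitAngle_ne_zero (θ : ℝ) :
    (show EuclideanSpace ℝ (Fin 1) from mfderiv 𝓘(ℝ, ℝ) (𝓡 1) unitAngle θ (1 : ℝ)) ≠ 0 := by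
  intro h
  have hcoe : ContMDiff (𝓡 1) 𝓘(ℝ, ℂ) ∞ (fun z : Circle => (z : ℂ)) := by
    have : Fact (Module.finrank ℝ ℂ = 1 + 1) := ⟨Complex.finrank_real_complex⟩
    exact contMDiff_coe_sphere
  have hcomp := mfderiv_comp θ ((hcoe (unitAngle θ)).mdifferentiableAt (by simp))
    ((contMDiff_unitAngle θ).mdifferentiableAt (by simp))
  have h2 := DFunLike.congr_fun hcomp (1 : ℝ)
  have h3 : (show ℂ from mfderiv 𝓘(ℝ, ℝ) 𝓘(ℝ, ℂ)
      ((fun z : Circle => (z : ℂ)) ∘ unitAngle) θ (1 : ℝ)) = 0 :=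
    h2.trans ((congrArg (mfderiv (𝓡 1) 𝓘(ℝ, ℂ) (fun z : Circle => (z : ℂ)) (unitAngle θ)) h).trans
      (map_zero _))
  rw [mfderiv_eq_fderiv] at h3
  have h4 : deriv (fun θ : ℝ => (unitAngle θ : ℂ)) θ = 0 := by
    rw [← fderiv_apply_one_eq_deriv]
    exact h3
  rw [(hasDerivAt_coe_unitAngle θ).deriv] at h4
  simp [Real.pi_ne_zero] at h4

/-- An embedded curve is regular in a chart. -/
theorem IsEmbeddedCircle.exists_hasDerivAt {c : Circle → M} (hc : IsEmbeddedCircle c) {x₀ : M}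
    (j : EuclideanSpace ℝ (Fin 2) ≃L[ℝ] ℂ) {θ : ℝ}
    (hs : c (unitAngle θ) ∈ (extChartAt (𝓡∂ 2) x₀).source) :
    ∃ τ ≠ 0, HasDerivAt (fun θ => j (extChartAt (𝓡∂ 2) x₀ (c (unitAngle θ)))) τ θ := by
  set D : ℝ →L[ℝ] EuclideanSpace ℝ (Fin 1) := mfderiv 𝓘(ℝ, ℝ) (𝓡 1) unitAngle θ with hD
  set B : EuclideanSpace ℝ (Fin 1) →L[ℝ] EuclideanSpace ℝ (Fin 2) :=
    mfderiv (𝓡 1) (𝓡∂ 2) c (unitAngle θ) with hB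
  set A : EuclideanSpace ℝ (Fin 2) →L[ℝ] EuclideanSpace ℝ (Fin 2) :=
    mfderiv (𝓡∂ 2) 𝓘(ℝ, EuclideanSpace ℝ (Fin 2)) (extChartAt (𝓡∂ 2) x₀) (c (unitAngle θ)) with hA
  have h₁ : HasMFDerivAt 𝓘(ℝ, ℝ) (𝓡 1) unitAngle θ D :=
    ((contMDiff_unitAngle θ).mdifferentiableAt (by simp)).hasMFDerivAt
  have h₂ : HasMFDerivAt (𝓡 1) (𝓡∂ 2) c (unitAngle θ) B :=
    ((hc.smooth (unitAngle θ)).mdifferentiableAt (by simp)).hasMFDerivAt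
  have h₃ : HasMFDerivAt (𝓡∂ 2) 𝓘(ℝ, EuclideanSpace ℝ (Fin 2)) (extChartAt (𝓡∂ 2) x₀)
      (c (unitAngle θ)) A :=
    ((contMDiffAt_extChartAt' (n := ∞) (by simpa using hs)).mdifferentiableAt
      (by simp)).hasMFDerivAt
  have h₄ : HasMFDerivAt 𝓘(ℝ, ℝ) 𝓘(ℝ, EuclideanSpace ℝ (Fin 2))
      (fun θ => extChartAt (𝓡∂ 2) x₀ (c (unitAngle θ))) θ (A ∘L (B ∘L D)) :=
    HasMFDerivAt.comp θ (g := extChartAt (𝓡∂ 2) x₀) (f := c ∘ unitAngle) h₃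
      (HasMFDerivAt.comp θ h₂ h₁)
  have h₅ : HasFDerivAt (fun θ => extChartAt (𝓡∂ 2) x₀ (c (unitAngle θ))) (A ∘L (B ∘L D)) θ :=
    hasMFDerivAt_iff_hasFDerivAt.1 h₄
  have h₅' : HasDerivAt (fun θ => j (extChartAt (𝓡∂ 2) x₀ (c (unitAngle θ)))) (j (A (B (D 1)))) θ :=
    (j.hasFDerivAt.comp θ h₅).hasDerivAt
  refine ⟨j (A (B (D 1))), fun h0 => ?_, h₅'⟩
  have h6 : A (B (D 1)) = 0 := by simpa using h0
  have hAinj : Function.Injective A :=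
    (isInvertible_mfderiv_extChartAt (I := 𝓡∂ 2) hs).injective
  have h7 : B (D 1) = 0 := hAinj (h6.trans (map_zero A).symm)
  have h8 : D 1 = 0 := hc.immersion (unitAngle θ) (h7.trans (map_zero B).symm)
  exact mfderiv_unitAngle_ne_zero θ h8

end SymplecticSurface

/-! ### A short transversal segment and the map of degree one -/

namespace SymplecticSurface

open Set Filter Topology

variable {M : Type*} [TopologicalSpace M] [ChartedSpace (EuclideanHalfSpace 2) M]
  [IsManifold (𝓡∂ 2) ∞ M]

/-- After division by the tangent `τ` the curve runs along the real axis. The factor `1 / 2`, being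
less than `1`, fixes the sign of the real part and excludes purely imaginary values for `θ ≠ 0`. -/
theorem eventually_norm_sub_le {γ : ℝ → ℂ} {τ : ℂ} (hτ : τ ≠ 0)
    (h : HasDerivAt γ τ 0) :
    ∀ᶠ θ in 𝓝 (0 : ℝ), ‖(γ θ - γ 0) / τ - θ‖ ≤ 1 / 2 * ‖θ‖ := by
  have h₁ : HasDerivAt (fun θ => (γ θ - γ 0) / τ) 1 0 := by
    simpa [hτ] using (h.sub_const (γ 0)).div_const τ
  have h₂ := (hasDerivAt_iff_isLittleO.1 h₁).def (one_half_pos (α := ℝ))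
  simpa using h₂

/-- A short segment transversal to an embedded curve meets the curve in one point only. -/
theorem IsChartDisc.exists_transversal [T2Space M] {Ω : SymplecticForm M} {x₀ : M} {O : Set M}
    {j : EuclideanSpace ℝ (Fin 2) ≃L[ℝ] ℂ} {C : Set ℂ} (h : IsChartDisc Ω x₀ O j C)
    {c : Circle → M} (hc : IsEmbeddedCircle c)
    (hs : c (unitAngle 0) ∈ (extChartAt (𝓡∂ 2) x₀).source) {m : ℂ}
    (hm : j (extChartAt (𝓡∂ 2) x₀ (c (unitAngle 0))) = m) (hmC : m ∈ C) :
    ∃ τ ≠ 0, HasDerivAt (fun θ => j (extChartAt (𝓡∂ 2) x₀ (c (unitAngle θ)))) τ 0 ∧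
      ∃ δ > 0, ∀ s : ℝ, |s| ≤ δ → m + s * (Complex.I * τ) ∈ C ∧
        ∀ θ, (extChartAt (𝓡∂ 2) x₀).symm (j.symm (m + s * (Complex.I * τ))) = c (unitAngle θ) →
          s = 0 ∧ ∃ n : ℤ, θ = n := by
  set φ := extChartAt (𝓡∂ 2) x₀ with hφ
  have hcc : Continuous fun θ => c (unitAngle θ) :=
    hc.smooth.continuous.comp contMDiff_unitAngle.continuous
  obtain ⟨τ, hτ, hder⟩ := hc.exists_hasDerivAt j hs
  refine ⟨τ, hτ, hder, ?_⟩
  obtain ⟨η, hη, hnear⟩ := Metric.eventually_nhds_iff.1 (eventually_norm_sub_le hτ hder)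
  simp only [dist_zero_right, Real.norm_eq_abs] at hnear
  -- This is the part of the curve away from the crossing. It is compact and misses the crossing
  -- point, so a sufficiently short segment avoids it.
  set A : Set M := (fun θ => c (unitAngle θ)) '' {θ | η ≤ |θ| ∧ |θ| ≤ 1 / 2} with hA
  have hAc : IsCompact A := by
    refine IsCompact.image ?_ hcc
    refine (isCompact_closedBall (0 : ℝ) (1 / 2)).of_isClosed_subset
      ((isClosed_le continuous_const continuous_abs).inter
        (isClosed_le continuous_abs continuous_const)) fun θ hθ => ?_
    simpa using hθ.2
  have hψm : φ.symm (j.symm m) = c (unitAngle 0) := by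
    rw [← hm, j.symm_apply_apply, φ.left_inv hs]
  have hmA : φ.symm (j.symm m) ∉ A := by
    rw [hψm]
    rintro ⟨θ, ⟨h₁, h₂⟩, h₃⟩
    obtain ⟨n, hn⟩ := unitAngle_eq_unitAngle_iff.1 (hc.injective h₃)
    rw [zero_add] at hn
    rw [hn] at h₁ h₂
    have h₄ : |n| < 1 := by
      have : |(n : ℝ)| < 1 := by linarith
      exact_mod_cast this
    rw [Int.abs_lt_one_iff.1 h₄, Int.cast_zero, abs_zero] at h₁
    linarith
  have hcont : ContinuousAt (fun ζ => φ.symm (j.symm ζ)) m :=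
    ContinuousAt.comp (g := φ.symm) (f := j.symm)
      (contMDiffAt_extChartAt_symm_of_mem_interior (h.mem_target m hmC)).continuousAt
      j.symm.continuous.continuousAt
  have hline : Tendsto (fun s : ℝ => m + s * (Complex.I * τ)) (𝓝 0) (𝓝 m) := by
    have : Continuous fun s : ℝ => m + s * (Complex.I * τ) := by fun_prop
    simpa using this.tendsto 0
  obtain ⟨δ, hδ, hball⟩ := Metric.eventually_nhds_iff.1 ((hline.eventually
    (h.isOpen.mem_nhds hmC)).and (hline.eventually
      (hcont.eventually (hAc.isClosed.isOpen_compl.mem_nhds hmA))))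
  refine ⟨δ / 2, half_pos hδ, fun s hsδ => ?_⟩
  obtain ⟨hsC, hsA⟩ := hball (y := s) (by rw [dist_zero_right, Real.norm_eq_abs]; linarith)
  refine ⟨hsC, fun θ hθ => ?_⟩
  have hround : c (unitAngle θ) = c (unitAngle (θ - round θ)) := by
    rw [unitAngle_eq_unitAngle_iff.2 ⟨round θ, (sub_add_cancel θ (round θ : ℝ)).symm⟩]
  rw [hround] at hθ
  have hlt : |θ - round θ| < η := by
    by_contra! hcon
    exact hsA ⟨_, ⟨hcon, abs_sub_round θ⟩, hθ.symm⟩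
  have h₁ := hnear hlt
  rw [← hθ, h.apply_symm hsC, hm] at h₁
  -- In the coordinate divided by `τ` the segment is purely imaginary. Comparing real parts gives
  -- `|θ - round θ| ≤ |θ - round θ| / 2`, so `θ` is an integer, and then `s = 0`.
  have h₂ : (m + s * (Complex.I * τ) - m) / τ - ((θ - round θ : ℝ) : ℂ) =
      s * Complex.I - ((θ - round θ : ℝ) : ℂ) := by
    field_simp
    ring
  rw [h₂] at h₁
  have h₃ := (Complex.abs_re_le_norm _).trans h₁
  simp only [Complex.sub_re, Complex.re_ofReal_mul, Complex.I_re, mul_zero, Complex.ofReal_re,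
    zero_sub, abs_neg] at h₃
  have h₄ : |θ - round θ| = 0 := le_antisymm (by linarith) (abs_nonneg _)
  rw [abs_eq_zero] at h₄
  rw [h₄] at h₁
  refine ⟨?_, round θ, sub_eq_zero.1 h₄⟩
  have h₅ : ‖(s : ℂ) * Complex.I‖ ≤ 0 := by simpa using h₁
  simpa using norm_le_zero_iff.1 h₅

/-- If the complement of an embedded curve in the interior of a symplectic surface is connected,
there is a circle valued map on the surface, trivial outside of a compact set, which has degree one
along the curve. -/
theorem exists_isDegreeOneMap [T2Space M] (Ω : SymplecticForm M) {c : Circle → M}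
    (hc : IsEmbeddedCircle c) (hint : ∀ z : Circle, (𝓡∂ 2).IsInteriorPoint (c z))
    (hsep : IsPreconnected (range c)ᶜ) : ∃ u K, IsDegreeOneMap c u K := by
  have hcc : Continuous fun θ => c (unitAngle θ) :=
    hc.smooth.continuous.comp contMDiff_unitAngle.continuous
  obtain ⟨j, C, h, -, hev⟩ := exists_isChartDisc Ω (c (unitAngle 0)) (univ_mem)
  set φ := extChartAt (𝓡∂ 2) (c (unitAngle 0)) with hφ
  set ψ : ℂ → M := fun ζ => φ.symm (j.symm ζ) with hψ
  set γ : ℝ → ℂ := fun θ => j (φ (c (unitAngle θ))) with hγ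
  have hψγ : ∀ θ, c (unitAngle θ) ∈ φ.source → ψ (γ θ) = c (unitAngle θ) := fun θ hθ => by
    simp only [hψ, hγ, j.symm_apply_apply]
    exact φ.left_inv hθ
  have hs := hev.self_of_nhds.1
  have hmC : γ 0 ∈ C := hev.self_of_nhds.2 (hint _)
  obtain ⟨τ, hτ, hder, δ, hδ, htr⟩ := h.exists_transversal hc hs rfl hmC
  set m := γ 0 with hm
  set L : ℝ → ℂ := fun s => m + s * (Complex.I * τ) with hL
  set p := L δ with hp
  set q := L (-δ) with hq
  have hδ₁ : |δ| ≤ δ := (abs_of_pos hδ).le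
  have hδ₂ : |-δ| ≤ δ := by rwa [abs_neg]
  have hpC : p ∈ C := (htr δ hδ₁).1
  have hqC : q ∈ C := (htr (-δ) hδ₂).1
  have hIτ : Complex.I * τ ≠ 0 := mul_ne_zero Complex.I_ne_zero hτ
  have hpq : p ≠ q := fun heq => by
    have : (δ : ℂ) * (Complex.I * τ) = ((-δ : ℝ) : ℂ) * (Complex.I * τ) := add_left_cancel heq
    have h2 : δ = -δ := by exact_mod_cast mul_right_cancel₀ hIτ this
    linarith
  have hseg : ∀ z ∈ segment ℝ p q, ∃ s : ℝ, |s| ≤ δ ∧ L s = z := by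
    rintro z ⟨a, b, ha, hb, hab, rfl⟩
    refine ⟨(a - b) * δ, ?_, ?_⟩
    · rw [abs_mul, abs_of_pos hδ]
      have : |a - b| ≤ 1 := abs_le.2 ⟨by linarith, by linarith⟩
      nlinarith
    · simp only [hp, hq, hL, Complex.real_smul]
      push_cast
      have : (a : ℂ) + b = 1 := by exact_mod_cast hab
      linear_combination -m * this
  have hmseg : m ∈ segment ℝ p q := by
    refine ⟨1 / 2, 1 / 2, by norm_num, by norm_num, by norm_num, ?_⟩
    simp only [hp, hq, hL, Complex.real_smul]
    push_cast
    ring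
  have hPL : ψ p ∉ range c := by
    rintro ⟨z, hz⟩
    obtain ⟨θ, rfl⟩ := unitAngle_surjective z
    exact hδ.ne' ((htr δ hδ₁).2 θ hz.symm).1
  have hQL : ψ q ∉ range c := by
    rintro ⟨z, hz⟩
    obtain ⟨θ, rfl⟩ := unitAngle_surjective z
    exact hδ.ne' (neg_eq_zero.1 ((htr (-δ) hδ₂).2 θ hz.symm).1)
  have hPQ : ψ p ≠ ψ q := fun heq => hpq (by
    rw [← h.apply_symm hpC, ← h.apply_symm hqC]
    exact congrArg (fun x => j (φ x)) heq)
  obtain ⟨χ, K, hχ, hK, hKC, h1, h0⟩ := exists_cutoff_segment h.isOpen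
    (h.convex.segment_subset hpC hqC)
  have hd := h.isDipole hpC hqC hpq hχ hK hKC h1 h0
  set u₀ := chartDipole (c (unitAngle 0)) j p q χ with hu₀
  have hLo : IsOpen (range c)ᶜ := (isCompact_range hc.smooth.continuous).isClosed.isOpen_compl
  -- The only use of the connected complement: the second dipole leads back from `q` to `p` without
  -- meeting the curve. On the curve it equals `1`, so the product restricts there to `u₀`.
  obtain ⟨u', K', hd', hK'⟩ := exists_isDipole Ω hLo hsep hQL hPL (h.isInteriorPoint hqC)
    (h.isInteriorPoint hpC) hPQ.symm
  obtain ⟨f, K'', hf, hf1, hK'', hK''i, hfK, hfu⟩ := hd.exists_mul hd' hPQ (h.isInteriorPoint hpC)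
    (h.isInteriorPoint hqC) (hLo.mem_nhds hPL) (hLo.mem_nhds hQL)
  have hfc : ∀ θ, f (c (unitAngle θ)) = u₀ (c (unitAngle θ)) := fun θ => by
    have hmem : c (unitAngle θ) ∉ (range c)ᶜ := fun hcon => hcon (mem_range_self _)
    rw [hfu _ hmem, hd'.eq_one _ (fun hcon => hmem (hK' hcon)), mul_one]
  refine ⟨f, K'', hf, hf1, hK'', hK''i, hfK, ?_⟩
  have hper : ∀ θ, unitAngle (θ + 1) = unitAngle θ := unitAngle_add_one
  have hnotint : ∀ θ ∈ Ioo (0 : ℝ) 1, ¬ ∃ n : ℤ, θ = n := by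
    rintro θ hθ ⟨n, rfl⟩
    have h₁ : (0 : ℤ) < n := by exact_mod_cast hθ.1
    have h₂ : n < (1 : ℤ) := by exact_mod_cast hθ.2
    omega
  have hγseg : ∀ θ ∈ Ioo (0 : ℝ) 1, c (unitAngle θ) ∈ φ.source → γ θ ∉ segment ℝ p q := by
    intro θ hθ hθs hcon
    obtain ⟨s, hs, hsz⟩ := hseg _ hcon
    refine hnotint θ hθ ((htr s hs).2 θ ?_).2
    rw [← hψγ θ hθs, ← hsz]
  have hγp : ∀ θ ∈ Ioo (0 : ℝ) 1, c (unitAngle θ) ∈ φ.source → γ θ ≠ p := fun θ hθ hθs hcon =>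
    hγseg θ hθ hθs (hcon ▸ left_mem_segment ℝ p q)
  have hγq : ∀ θ ∈ Ioo (0 : ℝ) 1, c (unitAngle θ) ∈ φ.source → γ θ ≠ q := fun θ hθ hθs hcon =>
    hγseg θ hθ hθs (hcon ▸ right_mem_segment ℝ p q)
  have hsource : ∀ θ, c (unitAngle θ) ∈ φ.source →
      ∀ᶠ θ' in 𝓝 θ, c (unitAngle θ') ∈ φ.source := fun θ hθ =>
    hcc.continuousAt.eventually ((isOpen_extChartAt_source (I := 𝓡∂ 2) _).mem_nhds hθ)
  have hγc : ∀ θ, c (unitAngle θ) ∈ φ.source → ContinuousAt γ θ := fun θ hθ =>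
    j.continuous.continuousAt.comp (ContinuousAt.comp (g := φ) (f := fun θ => c (unitAngle θ))
      (continuousAt_extChartAt' hθ) hcc.continuousAt)
  classical
  -- This is the angle of `u₀` along the curve, in turns. For `0 < θ < 1` the curve avoids the
  -- segment, so the argument does not meet its cut and `G` is continuous; the jump occurs at
  -- integers.
  set G : ℝ → ℝ := fun θ => if c (unitAngle θ) ∈ φ.source then
    (1 - χ (γ θ)) * ((γ θ - p) / (γ θ - q)).arg / (2 * Real.pi) else 0 with hG
  have hGper : ∀ θ, G (θ + 1) = G θ := fun θ => by simp only [hG, hγ, hper]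
  have hw : ContDiff ℝ ∞ fun θ => f (c (unitAngle θ)) :=
    (hf.comp (hc.smooth.comp contMDiff_unitAngle)).contDiff
  have hpi := Real.pi_ne_zero
  have hG₀ : G =ᶠ[𝓝 0] fun θ => ((γ θ - p) / (γ θ - q)).arg / (2 * Real.pi) := by
    filter_upwards [hsource 0 hs, (hγc 0 hs).eventually (h0 m hmseg)] with θ h₁ h₂
    simp only [hG, if_pos h₁, h₂, sub_zero, one_mul]
  -- Centring at `m` and dividing by `τ` moves `p` and `q` to `iδ` and `-iδ`, with the curve
  -- crossing the imaginary axis from left to right.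
  have hρ : ∀ θ, (γ θ - p) / (γ θ - q) =
      ((γ θ - m) / τ - δ * Complex.I) / ((γ θ - m) / τ + δ * Complex.I) := fun θ => by
    rw [← mul_div_mul_left ((γ θ - m) / τ - δ * Complex.I) _ hτ]
    congr 1 <;> simp only [hp, hq, hL] <;> field_simp <;> push_cast <;> ring
  have hρ0 : Tendsto (fun θ => (γ θ - m) / τ) (𝓝 0) (𝓝 0) := by
    have := ((hγc 0 hs).tendsto.sub_const m).div_const τ
    rwa [← hm, sub_self, zero_div] at this
  have hre : ∀ᶠ θ in 𝓝 (0 : ℝ), |((γ θ - m) / τ).re - θ| ≤ 1 / 2 * |θ| := by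
    filter_upwards [eventually_norm_sub_le hτ hder] with θ hθ
    have := (Complex.abs_re_le_norm _).trans hθ
    rwa [Complex.sub_re, Complex.ofReal_re] at this
  obtain ⟨hlim₁, hlim₂⟩ := tendsto_arg_sub_div_add hρ0 hδ
    (by
      filter_upwards [nhdsWithin_le_nhds hre, self_mem_nhdsWithin] with θ h₁ (h₂ : 0 < θ)
      rw [abs_of_pos h₂] at h₁
      linarith [(abs_le.1 h₁).1])
    (by
      filter_upwards [nhdsWithin_le_nhds hre, self_mem_nhdsWithin] with θ h₁ (h₂ : θ < 0)
      rw [abs_of_neg h₂] at h₁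
      linarith [(abs_le.1 h₁).2])
  simp only [← hρ] at hlim₁ hlim₂
  -- The argument tends to `-π` from the right of `0` and to `π` from the left. In turns these are
  -- `-1 / 2` and `1 / 2`, and periodicity of `G` carries the second limit to `θ = 1`.
  refine exists_lift_of_angle (G := G) (a := -Real.pi / (2 * Real.pi))
    (hw.of_le (by norm_cast)) (fun θ => hf1 _) (fun θ => by rw [hper]) (fun θ hθ => ?_)
    (fun θ hθ => ?_) ?_ ?_
  · refine ContinuousAt.continuousWithinAt ?_
    by_cases hθK : c (unitAngle θ) ∈ ψ '' K
    · have hθs : c (unitAngle θ) ∈ φ.source := by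
        obtain ⟨ζ, hζ, hζθ⟩ := hθK
        rw [← hζθ]
        exact h.symm_mem_source (hKC hζ)
      have hcont : ContinuousAt (fun θ =>
          (1 - χ (γ θ)) * ((γ θ - p) / (γ θ - q)).arg / (2 * Real.pi)) θ := by
        have harg := (Complex.continuousAt_arg
          (div_mem_slitPlane_of_notMem_segment (hγseg θ hθ hθs))).comp
          (f := fun θ => (γ θ - p) / (γ θ - q))
          (((hγc θ hθs).sub continuousAt_const).div ((hγc θ hθs).sub continuousAt_const)
            (sub_ne_zero.2 (hγq θ hθ hθs)))
        exact ((continuousAt_const.sub (hχ.continuous.continuousAt.comp (hγc θ hθs))).mul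
          harg).div_const _
      refine hcont.congr ?_
      filter_upwards [hsource θ hθs] with θ' h'
      simp only [hG, if_pos h']
    · refine (continuousAt_const (y := (0 : ℝ))).congr ?_
      filter_upwards [hcc.continuousAt.eventually
        (hd.compact.isClosed.isOpen_compl.mem_nhds hθK)] with θ' h'
      simp only [hG]
      split_ifs with h''
      · rw [h1 _ fun hcon => h' ⟨_, hcon, hψγ θ' h''⟩]
        simp
      · rfl
  · rw [hfc, coe_unitAngle]
    by_cases hθs : c (unitAngle θ) ∈ φ.source
    · rw [hu₀, chartDipole_of_mem hθs]
      refine (dipoleFun_eq_exp χ (hγp θ hθ hθs) (hγq θ hθ hθs)).trans ?_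
      simp only [hG, if_pos hθs]
      congr 1
      have : (Real.pi : ℂ) ≠ 0 := by exact_mod_cast hpi
      push_cast
      field_simp
    · rw [hu₀, chartDipole, if_neg hθs]
      simp only [hG, if_neg hθs, Complex.ofReal_zero, mul_zero, Complex.exp_zero]
  · exact (hlim₁.div_const _).congr' (nhdsWithin_le_nhds hG₀.symm)
  · have hshift : Tendsto (fun θ : ℝ => θ - 1) (𝓝[<] 1) (𝓝[<] 0) := by
      refine tendsto_nhdsWithin_iff.2 ⟨?_, ?_⟩
      · have : Continuous fun θ : ℝ => θ - 1 := by fun_prop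
        simpa using (this.tendsto 1).mono_left nhdsWithin_le_nhds
      · filter_upwards [self_mem_nhdsWithin] with θ (hθ : θ < 1)
        exact sub_neg.2 hθ
    have h₁ : Tendsto G (𝓝[<] 0) (𝓝 (Real.pi / (2 * Real.pi))) :=
      (hlim₂.div_const _).congr' (nhdsWithin_le_nhds hG₀.symm)
    have h₂ := h₁.comp hshift
    have h₃ : -Real.pi / (2 * Real.pi) + 1 = Real.pi / (2 * Real.pi) := by
      field_simp
      ring
    rw [h₃]
    refine h₂.congr fun θ => ?_
    rw [Function.comp_apply, ← hGper, sub_add_cancel]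

end SymplecticSurface

theorem mainTheorem6 {M : Type*} [TopologicalSpace M] [T2Space M] [SecondCountableTopology M]
    [ConnectedSpace M] [ChartedSpace (EuclideanHalfSpace 2) M] [IsManifold (𝓡∂ 2) ∞ M]
    (Ω : SymplecticSurface.SymplecticForm M)
    (c : Circle → M) (hc : SymplecticSurface.IsEmbeddedCircle c)
    (hint : ∀ z : Circle, (𝓡∂ 2).IsInteriorPoint (c z))
    (hsep : IsConnected (Set.range c)ᶜ) (k : ℤ) :
    SymplecticSurface.bp Ω c k = ⊤ ∧
      SymplecticSurface.deformationInvariant Ω c (k : ℝ) = ⊤ := by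
  obtain ⟨u, K, hu⟩ := SymplecticSurface.exists_isDegreeOneMap Ω hc hint hsep.isPreconnected
  exact ⟨SymplecticSurface.bp_eq_top Ω hc hu k,
    SymplecticSurface.deformationInvariant_eq_top Ω hc hint hu k⟩
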